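/- Setting. A server has $L\ge 1$ identical downloading threads. A sequence of $N$ read requests, $1\le N\le\infty$, arrives at deterministic times $0=a_1\le a_2\le\cdots$. The file of request $i$ is stored as $n_i$ coded chunks of an $(n_i,k_i)$ MDS code, $1\le k_i\le n_i$, and request $i$ is completed, at time $c_i$, as soon as any $k_i$ of its $n_i$ chunks have been downloaded; the other downloads of its chunks are then terminated at once. At any time each thread serves at most one chunk, and each chunk is served by at most one thread. Preemption is not allowed: a thread that has started a chunk serves it until it is downloaded or until its request is completed. The downloading times of the chunks are i.i.d. exponential with mean $1/\mu$, $\mu>0$. A policy is online if its decisions up to time $t$ depend only on the requests that have arrived by time $t$ (and their parameters), on which chunks were downloaded by time $t$ and when, and possibly on an independent randomization; threads may be left idle. For a policy $\pi$ let $$\overline D_\pi=\frac1N\sum_{i=1}^N\bigl(\mathbb E\{c_{i,\pi}\}-a_i\bigr)\quad(N<\infty),$$ and for $N=\infty$ let $\overline D_\pi$ be the $\limsup$, as $M\to\infty$, of this quantity for the system with the first $M$ requests only. Let $\overline D_{\rm opt}$ be the infimum of $\overline D_\pi$ over all non-preemptive online policies $\pi$, and let $d_{\min}=\min_i (n_i-k_i+1)$.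 Non-preemptive SEDPT-R is the following policy, with ties broken arbitrarily. For an unfinished request $i$ that has arrived let $\alpha_i$ be the number of chunks still to be downloaded to complete it and $\delta_i$ the number of threads that are serving it. At any time, as long as some thread is idle and some unfinished request that has arrived has an available chunk (one that is neither downloaded nor under service), an idle thread is assigned to an available chunk of a request with the smallest $\alpha_i-\delta_i$ among the unfinished requests that have an available chunk (and $\delta_i$ increases by one). Theorem. Non-preemptive SEDPT-R is a well-defined non-preemptive online policy (that is, such a policy exists), and for any $N$ and any request parameters $(a_i,k_i,n_i)_{i=1}^N$ its average flow time satisfies $$\overline D_{\rm opt}\;\le\;\overline D_{\text{SEDPT-R}}\;\le\;\overline D_{\rm opt}+\frac1\mu+\frac1\mu\sum_{l=d_{\min}}^{L-1}\frac1l ,$$ where the sum is $0$ if $d_{\min}\ge L$. -/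

import Mathlib

open MeasureTheory ProbabilityTheory
open scoped ENNReal NNReal

namespace MDSQueue

/-- A chunk `(i, c)`: the coded chunk number `c` of the file of request number `i`
(requests and chunks are numbered from `0`). -/
abbrev Chunk := ℕ × ℕ

/-- Parameters of a sequence of read requests: arrival times `a i`, and the parameters
`(n i, k i)` of the MDS code with which the file of request `i` is stored. Only the
indices `i < N` matter when there are `N` requests. -/
structure Requests where
  a : ℕ → ℝ≥0
  k : ℕ → ℕ
  n : ℕ → ℕ

/-- The first `N` requests (all of them if `N = ⊤`) have `0 = a 0 ≤ a 1 ≤ ⋯`, and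
`1 ≤ k i ≤ n i`. -/
structure Requests.Valid (r : Requests) (N : ℕ∞) : Prop where
  first_arrival : r.a 0 = 0
  monotone : ∀ i j : ℕ, i ≤ j → (j : ℕ∞) < N → r.a i ≤ r.a j
  one_le_k : ∀ i : ℕ, (i : ℕ∞) < N → 1 ≤ r.k i
  k_le_n : ∀ i : ℕ, (i : ℕ∞) < N → r.k i ≤ r.n i

/-- The minimum Hamming distance `n i - k i + 1` of the codes of the first `N` requests. -/
noncomputable def Requests.dMin (r : Requests) (N : ℕ∞) : ℕ :=
  sInf {d : ℕ | ∃ i : ℕ, (i : ℕ∞) < N ∧ d = r.n i - r.k i + 1}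

/-! A realization `x` gives the downloading time `x j` of each chunk `j`. A schedule `s` gives
the time `s j` at which a thread starts to download the chunk `j`, `⊤` if this never happens.
Without preemption a chunk, once started, keeps its thread until it is downloaded or until its
request is completed, so that these two functions determine everything that happens. -/

/-- The time at which the download of chunk `j` is (or, in case it is terminated before,
would have been) over. -/
noncomputable def finish (s : Chunk → ℝ≥0∞) (x : Chunk → ℝ) (j : Chunk) : ℝ≥0∞ :=
  s j + ENNReal.ofReal (x j)

/-- The completion time of request `i`: the first time at which `k i` of its chunks have been
downloaded; `⊤` if there is no such time. -/
noncomputable def complTime (r : Requests) (s : Chunk → ℝ≥0∞) (x : Chunk → ℝ) (i : ℕ) : ℝ≥0∞ :=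
  sInf {t : ℝ≥0∞ | r.k i ≤ {c : ℕ | c < r.n i ∧ finish s x (i, c) ≤ t}.ncard}

/-- The chunks that have been downloaded by time `t`. The downloads that are not over when the
request is completed are terminated at that time, and do not count. -/
def downloaded (r : Requests) (s : Chunk → ℝ≥0∞) (x : Chunk → ℝ) (t : ℝ≥0) : Set Chunk :=
  {j | finish s x j ≤ t ∧ finish s x j ≤ complTime r s x j.1}

/-- The chunks under service just after the decisions of time `t`. -/
def inService (r : Requests) (s : Chunk → ℝ≥0∞) (x : Chunk → ℝ) (t : ℝ≥0) : Set Chunk :=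
  {j | s j ≤ t ∧ t < finish s x j ∧ t < complTime r s x j.1}

/-- The chunks under service at time `t` just before the decisions of time `t`, but after
the completions and terminations of time `t`. -/
def inServicePre (r : Requests) (s : Chunk → ℝ≥0∞) (x : Chunk → ℝ) (t : ℝ≥0) : Set Chunk :=
  {j | s j < t ∧ t < finish s x j ∧ t < complTime r s x j.1}

/-- A non-preemptive schedule is feasible with `L` threads: only chunks of requests that have
arrived and are not completed are started, and at most `L` chunks are under service at any
time. -/
structure Feasible (L : ℕ) (r : Requests) (N : ℕ) (x : Chunk → ℝ) (s : Chunk → ℝ≥0∞) : Prop where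
  start : ∀ j : Chunk, s j ≠ ⊤ →
    j.1 < N ∧ j.2 < r.n j.1 ∧ r.a j.1 ≤ s j ∧ s j < complTime r s x j.1
  threads : ∀ t : ℝ≥0, (inService r s x t).encard ≤ L

/-- Up to and including time `t`, the decision-maker sees the same in both situations: the same
requests have arrived, at the same times and with the same parameters, and the same chunks have
been downloaded at the same times. -/
structure SameHistory (t : ℝ≥0)
    (r : Requests) (N : ℕ) (x : Chunk → ℝ) (s : Chunk → ℝ≥0∞)
    (r' : Requests) (N' : ℕ) (x' : Chunk → ℝ) (s' : Chunk → ℝ≥0∞) : Prop where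
  arrived : ∀ i : ℕ, (i < N ∧ r.a i ≤ t) ↔ (i < N' ∧ r'.a i ≤ t)
  params : ∀ i : ℕ, i < N → r.a i ≤ t → r.a i = r'.a i ∧ r.k i = r'.k i ∧ r.n i = r'.n i
  downloads : ∀ τ : ℝ≥0, τ ≤ t → downloaded r s x τ = downloaded r' s' x' τ

/-- A non-preemptive online policy for `L` threads, possibly randomized by a seed that is
uniform on `[0, 1]` and independent of the downloading times. It gives the schedule
for all request parameters and all downloading times, such that the chunks that have been started
by time `t` depend only on the seed and on what has been seen by time `t`: neither on
the number and the parameters of later requests, nor on the downloading times of the chunks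
that have not been downloaded. -/
structure OnlinePolicy (L : ℕ) where
  start : unitInterval → Requests → ℕ → (Chunk → ℝ) → Chunk → ℝ≥0∞
  measurable : ∀ (r : Requests) (N : ℕ), r.Valid N → ∀ j : Chunk,
    Measurable fun p : unitInterval × (Chunk → ℝ) => start p.1 r N p.2 j
  feasible : ∀ (u : unitInterval) (r : Requests) (N : ℕ) (x : Chunk → ℝ), r.Valid N →
    (∀ j, 0 < x j) → Feasible L r N x (start u r N x)
  nonanticipating : ∀ (u : unitInterval) (t : ℝ≥0) (r r' : Requests) (N N' : ℕ)
    (x x' : Chunk → ℝ), r.Valid N → r'.Valid N' → (∀ j, 0 < x j) → (∀ j, 0 < x' j) →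
    SameHistory t r N x (start u r N x) r' N' x' (start u r' N' x') →
    ∀ j : Chunk, start u r N x j ≤ t ↔ start u r' N' x' j ≤ t

/-- `α i`: the number of chunks that are still to be downloaded at time `t` to complete the
unfinished request `i`. -/
noncomputable def remaining (r : Requests) (s : Chunk → ℝ≥0∞) (x : Chunk → ℝ) (t : ℝ≥0)
    (i : ℕ) : ℤ :=
  (r.k i : ℤ) - ({c : ℕ | c < r.n i ∧ (i, c) ∈ downloaded r s x t}.ncard : ℤ)

/-- `δ i`: the number of threads that serve request `i` when `B` is the set of chunks under
service. -/
noncomputable def assigned (B : Set Chunk) (i : ℕ) : ℤ :=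
  ({c : ℕ | (i, c) ∈ B}.ncard : ℤ)

/-- When the chunks in `B` are under service at time `t`, chunk `j` could be given to an idle
thread: its request has arrived and is unfinished, and it is neither downloaded nor under
service. -/
def Waiting (r : Requests) (N : ℕ) (s : Chunk → ℝ≥0∞) (x : Chunk → ℝ) (t : ℝ≥0)
    (B : Set Chunk) (j : Chunk) : Prop :=
  j.1 < N ∧ j.2 < r.n j.1 ∧ r.a j.1 ≤ t ∧ t < complTime r s x j.1 ∧
    j ∉ downloaded r s x t ∧ j ∉ B

/-- One step of the assignment procedure SEDPT-R at time `t`: while the chunks in `B` are under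
service and a thread is idle, this thread is assigned to a waiting chunk `j` of a request
with the smallest `α - δ` among the requests that have a waiting chunk. -/
def SEDPTStep (L : ℕ) (r : Requests) (N : ℕ) (s : Chunk → ℝ≥0∞) (x : Chunk → ℝ) (t : ℝ≥0)
    (B B' : Set Chunk) : Prop :=
  B.encard < L ∧ ∃ j : Chunk, Waiting r N s x t B j ∧ B' = insert j B ∧
    ∀ j' : Chunk, Waiting r N s x t B j' →
      remaining r s x t j.1 - assigned B j.1 ≤ remaining r s x t j'.1 - assigned B j'.1

/-- The policy is non-preemptive SEDPT-R (ties may be broken in any way): at any time the steps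
above are carried out, one after the other, until none is possible, which means that all threads
are occupied or no chunk is waiting. -/
def OnlinePolicy.IsSEDPTR {L : ℕ} (π : OnlinePolicy L) : Prop :=
  ∀ (u : unitInterval) (r : Requests) (N : ℕ) (x : Chunk → ℝ), r.Valid N → (∀ j, 0 < x j) →
    ∀ t : ℝ≥0,
      Relation.ReflTransGen (SEDPTStep L r N (π.start u r N x) x t)
        (inServicePre r (π.start u r N x) x t) (inService r (π.start u r N x) x t) ∧
      ∀ B' : Set Chunk,
        ¬ SEDPTStep L r N (π.start u r N x) x t (inService r (π.start u r N x) x t) B'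

section Delay

variable {Ω : Type*} [MeasurableSpace Ω]

/-- The expected completion time of request `i` out of `N` requests, for the downloading
times `X`. -/
noncomputable def meanComplTime {L : ℕ} (π : OnlinePolicy L) (P : Measure Ω) (X : Chunk → Ω → ℝ)
    (r : Requests) (N : ℕ) (i : ℕ) : ℝ≥0∞ :=
  ∫⁻ p : unitInterval × Ω,
    complTime r (π.start p.1 r N fun j => X j p.2) (fun j => X j p.2) i ∂(volume.prod P)

/-- The average flow time of `N < ∞` requests. (The subtraction is never truncated, since
no chunk of a request is started before its arrival.) -/
noncomputable def avgFlowTimeFin {L : ℕ} (π : OnlinePolicy L) (P : Measure Ω) (X : Chunk → Ω → ℝ)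
    (r : Requests) (N : ℕ) : ℝ≥0∞ :=
  (∑ i ∈ Finset.range N, (meanComplTime π P X r N i - (r.a i : ℝ≥0∞))) / (N : ℝ≥0∞)

open Classical in
/-- The average flow time of `N ≤ ∞` requests; for `N = ∞` it is the upper limit, as the number
of requests tends to infinity. -/
noncomputable def avgFlowTime {L : ℕ} (π : OnlinePolicy L) (P : Measure Ω) (X : Chunk → Ω → ℝ)
    (r : Requests) (N : ℕ∞) : ℝ≥0∞ :=
  if N = ⊤ then Filter.limsup (fun M : ℕ => avgFlowTimeFin π P X r M) Filter.atTop
  else avgFlowTimeFin π P X r N.toNat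

/-- The smallest average flow time, over all non-preemptive online policies. -/
noncomputable def optFlowTime (L : ℕ) (P : Measure Ω) (X : Chunk → Ω → ℝ)
    (r : Requests) (N : ℕ∞) : ℝ≥0∞ :=
  ⨅ π : OnlinePolicy L, avgFlowTime π P X r N

end Delay

end MDSQueue

namespace MDSQueue

/-! ### Chunks and completion times -/

/-! SEDPT-R is compared with an arbitrary policy through two sequences indexed by a number `p` of
requests. For an arbitrary policy, `need` gives the least number of further chunks with which `p` of
the arrived requests can be completed. A download lowers its entries by at most one, and `L` threads
produce downloads at rate at most `L * μ`.

For SEDPT-R the arrived requests are split into `exh` (finished, or with every missing chunk already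
under service) and `avail`. The level at `q` is the minimum, over the `q`-subsets `Q` of `avail`, of
the chunks needed by `exh` and `Q` plus the threads working on the other available requests. The
profile `prof` has zeros at the first `exh.card` positions, followed by these levels minus `L`,
truncated at zero. Since threads go to the request with the smallest `α - δ`, a minimising `Q` can
be taken to contain that request (`exists_cost_le_mem`). Hence assignments do not raise the profile,
and each download lowers every entry by at least one until it is zero (`Inv.assign`,
`Inv.download`). While something is available all `L` threads are busy, so these downloads come at
rate exactly `L * μ`. An arrival acts through the monotone operator `arrive`, as an upper bound for
`prof` and a lower bound for `need`.

Both policies are therefore compared with a sequence reduced at the times of a Poisson process of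
rate `L * μ` (`poisMean`, `meanAt`). Induction over the arrivals shows that `prof` is stochastically
smaller than `need` (`lintegral_prof_le_lintegral_need`). No coupling is used. The probabilistic
input is `lintegral_compensator`: a chunk under service is downloaded with intensity `μ`, whatever
has been observed.

The positive entries of `need` number at most the pending requests of the other policy. For SEDPT-R,
pending requests can exceed the positive entries of `prof`, because a zero need not belong to a
completed request. This excess is charged to the potential `pot`. An unfinished request of `exh`
that needs `m` more chunks has at least `m - 1 + d` threads, and a level at most `L` occurs only
with all `L` threads busy. So harmonic weights make the mean loss rate of `pot`, in units of `μ`, at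
least the number of excess zeros (`Inv.card_zeros_le`). The potential starts at `0`, never increases
and stays above `-bound d L * N`; this gives the additive error `bound d L / μ` per request.
Integrating the pending requests over time gives the sum of the completion times.

For existence the schedule is constructed from event to event (`run`, `sedptStart`). It does not
anticipate, because at the earliest start at which two such schedules with the same history differ
the procedure would have the same input. -/

/-- All chunks of the first `N` requests. -/
def chunks (r : Requests) (N : ℕ) : Finset Chunk :=
  (Finset.range N ×ˢ Finset.range ((Finset.range N).sup r.n)).filter fun j => j.2 < r.n j.1

/-- The number of chunks of request `i` in `D`. -/
def cnt (D : Finset Chunk) (i : ℕ) : ℕ := (D.filter fun j => j.1 = i).card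

lemma mem_chunks {r : Requests} {N : ℕ} {j : Chunk} :
    j ∈ chunks r N ↔ j.1 < N ∧ j.2 < r.n j.1 := by
  simp only [chunks, Finset.mem_filter, Finset.mem_product, Finset.mem_range]
  constructor
  · rintro ⟨⟨h1, -⟩, h2⟩
    exact ⟨h1, h2⟩
  · rintro ⟨h1, h2⟩
    exact ⟨⟨h1, h2.trans_le (Finset.le_sup (f := r.n) (Finset.mem_range.2 h1))⟩, h2⟩

lemma cnt_mono {D D' : Finset Chunk} (h : D ⊆ D') (i : ℕ) : cnt D i ≤ cnt D' i :=
  Finset.card_le_card (Finset.filter_subset_filter _ h)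

lemma cnt_filter_chunks {r : Requests} {N i : ℕ} (hi : i < N) (p : Chunk → Prop)
    [DecidablePred p] :
    cnt ((chunks r N).filter p) i = ((Finset.range (r.n i)).filter fun c => p (i, c)).card := by
  refine (Finset.card_bij (fun c _ => ((i, c) : Chunk)) ?_ ?_ ?_).symm
  · intro c hc
    simp only [Finset.mem_filter, Finset.mem_range] at hc
    simp only [Finset.mem_filter, mem_chunks]
    exact ⟨⟨⟨hi, hc.1⟩, hc.2⟩, trivial⟩
  · intro c _ c' _ h
    simpa using h
  · rintro ⟨i', c⟩ h
    simp only [Finset.mem_filter, mem_chunks] at h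
    obtain ⟨⟨⟨_, h1⟩, h2⟩, rfl⟩ := h
    exact ⟨c, by simpa using ⟨h1, h2⟩, rfl⟩

lemma ncard_eq_cnt {D : Finset Chunk} {m i : ℕ} (h : ∀ c, (i, c) ∈ D → c < m) :
    {c : ℕ | c < m ∧ (i, c) ∈ D}.ncard = cnt D i := by
  have : {c : ℕ | c < m ∧ (i, c) ∈ D} = ((D.filter fun j => j.1 = i).image Prod.snd : Finset ℕ) := by
    ext c
    rw [Set.mem_ofPred_eq, Finset.mem_coe, Finset.mem_image]
    constructor
    · rintro ⟨_, h2⟩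
      exact ⟨(i, c), Finset.mem_filter.2 ⟨h2, rfl⟩, rfl⟩
    · rintro ⟨⟨i', c'⟩, h2, h3⟩
      obtain ⟨h5, h4⟩ := Finset.mem_filter.1 h2
      obtain rfl : c' = c := h3
      obtain rfl : i' = i := h4
      exact ⟨h _ h5, h5⟩
  rw [this, Set.ncard_coe_finset, Finset.card_image_of_injOn]
  · rfl
  · rintro ⟨a, b⟩ h1 ⟨a', b'⟩ h2 (h3 : b = b')
    simp only [Finset.coe_filter, Set.mem_ofPred_eq] at h1 h2
    rw [h3, h1.2, h2.2]

lemma cnt_insert {D : Finset Chunk} {j : Chunk} (h : j ∉ D) (i : ℕ) :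
    cnt (insert j D) i = cnt D i + if j.1 = i then 1 else 0 := by
  unfold cnt
  rw [Finset.filter_insert]
  split_ifs with h1
  · rw [Finset.card_insert_of_notMem (by simp [h])]
  · rfl

lemma sum_cnt {D : Finset Chunk} {R : Finset ℕ} (h : ∀ j ∈ D, j.1 ∈ R) :
    ∑ i ∈ R, cnt D i = D.card :=
  (Finset.card_eq_sum_card_fiberwise h).symm

/-- Turns the infimum over a continuum of times into a finite minimum, over sets of `k` chunks, of
the last finish in the set. Attainment and measurability follow at once. -/
lemma complTime_eq_inf (r : Requests) (s : Chunk → ℝ≥0∞) (x : Chunk → ℝ) (i : ℕ) :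
    complTime r s x i = ((Finset.range (r.n i)).powersetCard (r.k i)).inf
      fun Q => Q.sup fun c => finish s x (i, c) := by
  have key : ∀ t, {c : ℕ | c < r.n i ∧ finish s x (i, c) ≤ t} =
      ((Finset.range (r.n i)).filter fun c => finish s x (i, c) ≤ t : Finset ℕ) := by
    intro t
    ext c
    simp
  refine le_antisymm ?_ ?_
  · refine Finset.le_inf fun Q hQ => sInf_le ?_
    rw [Finset.mem_powersetCard] at hQ
    rw [Set.mem_ofPred_eq, key, Set.ncard_coe_finset, ← hQ.2]
    refine Finset.card_le_card fun c hc => ?_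
    rw [Finset.mem_filter]
    exact ⟨hQ.1 hc, Finset.le_sup (f := fun c => finish s x (i, c)) hc⟩
  · refine le_sInf fun t ht => ?_
    rw [Set.mem_ofPred_eq, key, Set.ncard_coe_finset] at ht
    obtain ⟨Q, hQ, hc⟩ := Finset.exists_subset_card_eq ht
    refine (Finset.inf_le (b := Q) ?_).trans (Finset.sup_le fun c hc => ?_)
    · rw [Finset.mem_powersetCard]
      exact ⟨hQ.trans (Finset.filter_subset _ _), hc⟩
    · exact (Finset.mem_filter.1 (hQ hc)).2

/-- The hypothesis matters at `t = ⊤`: with too few chunks the completion time is `⊤`, while the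
count stays below `r.k i`. -/
lemma complTime_le_iff {r : Requests} {s : Chunk → ℝ≥0∞} {x : Chunk → ℝ} {i : ℕ}
    (hk : r.k i ≤ r.n i) {t : ℝ≥0∞} :
    complTime r s x i ≤ t ↔
      r.k i ≤ ((Finset.range (r.n i)).filter fun c => finish s x (i, c) ≤ t).card := by
  rw [complTime_eq_inf]
  constructor
  · intro h
    obtain ⟨Q, hQ, h2⟩ := Finset.exists_mem_eq_inf ((Finset.range (r.n i)).powersetCard (r.k i))
      (Finset.powersetCard_nonempty.2 (by rwa [Finset.card_range]))
      (fun Q : Finset ℕ => Q.sup fun c => finish s x (i, c))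
    rw [h2, Finset.sup_le_iff] at h
    rw [Finset.mem_powersetCard] at hQ
    rw [← hQ.2]
    exact Finset.card_le_card fun c hc => Finset.mem_filter.2 ⟨hQ.1 hc, h c hc⟩
  · intro h
    obtain ⟨Q, hQ, hc⟩ := Finset.exists_subset_card_eq h
    refine (Finset.inf_le (b := Q) ?_).trans (Finset.sup_le fun c hc => ?_)
    · rw [Finset.mem_powersetCard]
      exact ⟨hQ.trans (Finset.filter_subset _ _), hc⟩
    · exact (Finset.mem_filter.1 (hQ hc)).2

/-- For `r.k i = 0` the completion time is `0`, and the strict inequality fails at `t = 0` although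
the count condition is void. -/
lemma complTime_lt_iff {r : Requests} {s : Chunk → ℝ≥0∞} {x : Chunk → ℝ} {i : ℕ}
    (hk : 1 ≤ r.k i) {t : ℝ≥0∞} :
    complTime r s x i < t ↔
      r.k i ≤ ((Finset.range (r.n i)).filter fun c => finish s x (i, c) < t).card := by
  rw [complTime_eq_inf]
  constructor
  · intro h
    rw [Finset.inf_lt_iff] at h
    obtain ⟨Q, hQ, h2⟩ := h
    rw [Finset.sup_lt_iff (by exact bot_lt_of_lt h2)] at h2
    rw [Finset.mem_powersetCard] at hQ
    rw [← hQ.2]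
    exact Finset.card_le_card fun c hc => Finset.mem_filter.2 ⟨hQ.1 hc, h2 c hc⟩
  · intro h
    obtain ⟨Q, hQ, hc⟩ := Finset.exists_subset_card_eq h
    have h1 : ∀ c ∈ Q, finish s x (i, c) < t := fun c hc => (Finset.mem_filter.1 (hQ hc)).2
    refine (Finset.inf_le (b := Q) ?_).trans_lt ?_
    · rw [Finset.mem_powersetCard]
      exact ⟨hQ.trans (Finset.filter_subset _ _), hc⟩
    · obtain ⟨c, hc'⟩ := Finset.card_pos.1 (by omega : 0 < Q.card)
      rw [Finset.sup_lt_iff (bot_lt_of_lt (h1 c hc'))]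
      exact h1

/-! ### The state of the system just before and at a given time -/

open Classical in
/-- The chunks started before time `t`. -/
noncomputable def startedBefore (r : Requests) (N : ℕ) (s : Chunk → ℝ≥0∞) (t : ℝ≥0∞) :
    Finset Chunk :=
  (chunks r N).filter fun j => s j < t

open Classical in
/-- The chunks downloaded before time `t`. -/
noncomputable def doneBefore (r : Requests) (N : ℕ) (s : Chunk → ℝ≥0∞) (x : Chunk → ℝ)
    (t : ℝ≥0∞) : Finset Chunk :=
  (chunks r N).filter fun j => finish s x j < t ∧ finish s x j ≤ complTime r s x j.1

open Classical in
/-- The chunks under service just before time `t`. -/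
noncomputable def servedBefore (r : Requests) (N : ℕ) (s : Chunk → ℝ≥0∞) (x : Chunk → ℝ)
    (t : ℝ≥0∞) : Finset Chunk :=
  (chunks r N).filter fun j => s j < t ∧ t ≤ finish s x j ∧ t ≤ complTime r s x j.1

open Classical in
/-- The chunks downloaded by time `t`. -/
noncomputable def doneBy (r : Requests) (N : ℕ) (s : Chunk → ℝ≥0∞) (x : Chunk → ℝ)
    (t : ℝ≥0∞) : Finset Chunk :=
  (chunks r N).filter fun j => finish s x j ≤ t ∧ finish s x j ≤ complTime r s x j.1

open Classical in
/-- The chunks under service at time `t`, before the decisions of that time. -/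
noncomputable def servedPre (r : Requests) (N : ℕ) (s : Chunk → ℝ≥0∞) (x : Chunk → ℝ)
    (t : ℝ≥0∞) : Finset Chunk :=
  (chunks r N).filter fun j => s j < t ∧ t < finish s x j ∧ t < complTime r s x j.1

open Classical in
/-- The chunks under service at time `t`, after the decisions of that time. -/
noncomputable def servedAt (r : Requests) (N : ℕ) (s : Chunk → ℝ≥0∞) (x : Chunk → ℝ)
    (t : ℝ≥0∞) : Finset Chunk :=
  (chunks r N).filter fun j => s j ≤ t ∧ t < finish s x j ∧ t < complTime r s x j.1

section States

variable {r : Requests} {N : ℕ} {s : Chunk → ℝ≥0∞} {x : Chunk → ℝ} {t : ℝ≥0∞}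

/-- Discarding the terminated downloads loses none of the finishes that count: the chunks finished
by the completion time already number at least `r.k i`. -/
lemma cnt_doneBefore_lt_iff (hr : r.Valid N) {i : ℕ} (hi : i < N) :
    cnt (doneBefore r N s x t) i < r.k i ↔ t ≤ complTime r s x i := by
  classical
  have hi' : (i : ℕ∞) < N := by exact_mod_cast hi
  unfold doneBefore
  rw [cnt_filter_chunks hi, ← not_le, ← not_lt (a := complTime r s x i), not_iff_not]
  constructor
  · intro h
    rw [complTime_lt_iff (hr.one_le_k i hi')]
    refine h.trans (Finset.card_le_card fun c hc => ?_)
    simp only [Finset.mem_filter] at hc ⊢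
    exact ⟨hc.1, hc.2.1⟩
  · intro h
    refine ((complTime_le_iff (s := s) (x := x) (hr.k_le_n i hi')).1 le_rfl).trans
      (Finset.card_le_card fun c hc => ?_)
    simp only [Finset.mem_filter] at hc ⊢
    exact ⟨hc.1, hc.2.trans_lt h, hc.2⟩

lemma cnt_doneBy_lt_iff (hr : r.Valid N) {i : ℕ} (hi : i < N) :
    cnt (doneBy r N s x t) i < r.k i ↔ t < complTime r s x i := by
  classical
  have hi' : (i : ℕ∞) < N := by exact_mod_cast hi
  unfold doneBy
  rw [cnt_filter_chunks hi, ← not_le, ← not_le (a := complTime r s x i),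
    not_iff_not]
  constructor
  · intro h
    rw [complTime_le_iff (hr.k_le_n i hi')]
    refine h.trans (Finset.card_le_card fun c hc => ?_)
    simp only [Finset.mem_filter] at hc ⊢
    exact ⟨hc.1, hc.2.1⟩
  · intro h
    refine ((complTime_le_iff (s := s) (x := x) (hr.k_le_n i hi')).1 le_rfl).trans
      (Finset.card_le_card fun c hc => ?_)
    simp only [Finset.mem_filter] at hc ⊢
    exact ⟨hc.1, hc.2.trans h, hc.2⟩

/-- The service set is a function of the started and the downloaded chunks, so systems that agree on
these two sets agree in their whole state. -/
lemma mem_servedBefore_iff (hr : r.Valid N) {j : Chunk} :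
    j ∈ servedBefore r N s x t ↔ j ∈ startedBefore r N s t ∧ j ∉ doneBefore r N s x t ∧
      cnt (doneBefore r N s x t) j.1 < r.k j.1 := by
  classical
  by_cases hj : j ∈ chunks r N
  · rw [cnt_doneBefore_lt_iff hr (mem_chunks.1 hj).1]
    simp only [servedBefore, startedBefore, doneBefore, Finset.mem_filter, hj, true_and, not_and,
      not_le]
    constructor
    · rintro ⟨h1, h2, h3⟩
      exact ⟨h1, fun h => absurd h (not_lt.2 h2), h3⟩
    · rintro ⟨h1, h2, h3⟩
      refine ⟨h1, ?_, h3⟩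
      by_contra! h
      exact absurd (h2 h) (not_lt.2 (h.le.trans h3))
  · simp [servedBefore, startedBefore, hj]

lemma mem_servedPre_iff (hr : r.Valid N) {j : Chunk} :
    j ∈ servedPre r N s x t ↔ j ∈ startedBefore r N s t ∧ j ∉ doneBy r N s x t ∧
      cnt (doneBy r N s x t) j.1 < r.k j.1 := by
  classical
  by_cases hj : j ∈ chunks r N
  · rw [cnt_doneBy_lt_iff hr (mem_chunks.1 hj).1]
    simp only [servedPre, startedBefore, doneBy, Finset.mem_filter, hj, true_and, not_and,
      not_le]
    constructor
    · rintro ⟨h1, h2, h3⟩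
      exact ⟨h1, fun h => absurd h (not_le.2 h2), h3⟩
    · rintro ⟨h1, h2, h3⟩
      refine ⟨h1, ?_, h3⟩
      by_contra! h
      exact absurd (h2 h) (not_lt.2 (h.trans h3.le))
  · simp [servedPre, startedBefore, hj]

end States

/-! ### Feasible schedules -/

section Feas

variable {L : ℕ} {r : Requests} {N : ℕ} {s : Chunk → ℝ≥0∞} {x : Chunk → ℝ}

lemma Feasible.mem_chunks (h : Feasible L r N x s) {j : Chunk} (hj : s j ≠ ⊤) : j ∈ chunks r N :=
  MDSQueue.mem_chunks.2 ⟨(h.start j hj).1, (h.start j hj).2.1⟩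

lemma lt_finish (hx : ∀ j, 0 < x j) {j : Chunk} (hj : s j ≠ ⊤) : s j < finish s x j :=
  ENNReal.lt_add_right hj (by simpa using hx j)

lemma le_finish (j : Chunk) : s j ≤ finish s x j := le_self_add

lemma start_ne_top_of_finish {j : Chunk} {t : ℝ≥0} (h : finish s x j ≤ t) : s j ≠ ⊤ :=
  ne_top_of_le_ne_top ENNReal.coe_ne_top ((le_finish j).trans h)

lemma coe_doneBy (h : Feasible L r N x s) (t : ℝ≥0) :
    (doneBy r N s x t : Set Chunk) = downloaded r s x t := by
  ext j
  simp only [doneBy, Finset.coe_filter, Set.mem_ofPred_eq, downloaded]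
  exact ⟨fun hj => hj.2, fun hj => ⟨h.mem_chunks (start_ne_top_of_finish hj.1), hj⟩⟩

lemma coe_servedAt (h : Feasible L r N x s) (t : ℝ≥0) :
    (servedAt r N s x t : Set Chunk) = inService r s x t := by
  ext j
  simp only [servedAt, Finset.coe_filter, Set.mem_ofPred_eq, inService]
  exact ⟨fun hj => hj.2, fun hj =>
    ⟨h.mem_chunks (ne_top_of_le_ne_top ENNReal.coe_ne_top hj.1), hj⟩⟩

lemma coe_servedPre (h : Feasible L r N x s) (t : ℝ≥0) :
    (servedPre r N s x t : Set Chunk) = inServicePre r s x t := by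
  ext j
  simp only [servedPre, Finset.coe_filter, Set.mem_ofPred_eq, inServicePre]
  exact ⟨fun hj => hj.2, fun hj => ⟨h.mem_chunks (ne_top_of_lt hj.1), hj⟩⟩

lemma Feasible.card_servedAt_le (h : Feasible L r N x s) (t : ℝ≥0) :
    (servedAt r N s x t).card ≤ L := by
  have := h.threads t
  rw [← coe_servedAt h, Set.encard_coe_eq_coe_finsetCard] at this
  exact_mod_cast this

end Feas

/-! ### Two situations in which the same downloads are over at the same times -/

section Agree

variable {r : Requests} {N : ℕ} {s s' : Chunk → ℝ≥0∞} {x x' : Chunk → ℝ} {t : ℝ≥0∞}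

lemma complTime_lt_iff_of_agree (h1 : ∀ i, i < N → 1 ≤ r.k i) {i : ℕ} (hi : i < N)
    (h : ∀ j ∈ chunks r N, (finish s x j < t ↔ finish s' x' j < t)) :
    complTime r s x i < t ↔ complTime r s' x' i < t := by
  rw [complTime_lt_iff (h1 i hi), complTime_lt_iff (h1 i hi)]
  suffices ∀ c ∈ Finset.range (r.n i), (finish s x (i, c) < t ↔ finish s' x' (i, c) < t) by
    rw [Finset.filter_congr this]
  intro c hc
  exact h _ (mem_chunks.2 ⟨hi, Finset.mem_range.1 hc⟩)

/-- If the downloads that are over before `t` are over at the same times, the same chunks have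
been downloaded before `t`. -/
lemma doneBefore_congr (hr : r.Valid N)
    (h : ∀ j ∈ chunks r N, finish s x j < t ∨ finish s' x' j < t → finish s x j = finish s' x' j) :
    doneBefore r N s x t = doneBefore r N s' x' t := by
  classical
  have h1 : ∀ i, i < N → 1 ≤ r.k i := fun i hi => hr.one_le_k i (by exact_mod_cast hi)
  unfold doneBefore
  refine Finset.filter_congr fun j hj => ?_
  -- Whether a download is terminated depends only on the finishes strictly before its own, and
  -- these agree in both situations.
  have key : finish s x j < t → finish s x j = finish s' x' j →
      (finish s x j ≤ complTime r s x j.1 ↔ finish s x j ≤ complTime r s' x' j.1) := by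
    intro h2 h3
    rw [← not_lt, ← not_lt, complTime_lt_iff_of_agree h1 (mem_chunks.1 hj).1]
    intro l hl
    constructor
    · intro h4
      rwa [← h l hl (Or.inl (h4.trans h2))]
    · intro h4
      rwa [h l hl (Or.inr (h4.trans h2))]
  constructor
  · rintro ⟨h2, h3⟩
    have h4 := h j hj (Or.inl h2)
    rw [key h2 h4, h4] at h3
    exact ⟨h4 ▸ h2, h3⟩
  · rintro ⟨h2, h3⟩
    have h4 := h j hj (Or.inr h2)
    rw [← h4] at h2 h3
    exact ⟨h2, (key h2 h4).2 h3⟩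

/-- If the downloads that are over by time `t` are over at the same times, the same chunks have
been downloaded by time `t`. -/
lemma doneBy_congr (hr : r.Valid N)
    (h : ∀ j ∈ chunks r N, finish s x j ≤ t ∨ finish s' x' j ≤ t → finish s x j = finish s' x' j) :
    doneBy r N s x t = doneBy r N s' x' t := by
  classical
  have h1 : ∀ i, i < N → 1 ≤ r.k i := fun i hi => hr.one_le_k i (by exact_mod_cast hi)
  unfold doneBy
  refine Finset.filter_congr fun j hj => ?_
  have key : finish s x j ≤ t → finish s x j = finish s' x' j →
      (finish s x j ≤ complTime r s x j.1 ↔ finish s x j ≤ complTime r s' x' j.1) := by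
    intro h2 h3
    rw [← not_lt, ← not_lt, complTime_lt_iff_of_agree h1 (mem_chunks.1 hj).1]
    intro l hl
    constructor
    · intro h4
      rwa [← h l hl (Or.inl (h4.le.trans h2))]
    · intro h4
      rwa [h l hl (Or.inr (h4.le.trans h2))]
  constructor
  · rintro ⟨h2, h3⟩
    have h4 := h j hj (Or.inl h2)
    rw [key h2 h4, h4] at h3
    exact ⟨h4 ▸ h2, h3⟩
  · rintro ⟨h2, h3⟩
    have h4 := h j hj (Or.inr h2)
    rw [← h4] at h2 h3
    exact ⟨h2, (key h2 h4).2 h3⟩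

end Agree

/-! ### Independent exponential downloading times -/

section Resample

variable {ι : Type*} [DecidableEq ι]

/-- In a product measure, one coordinate can be replaced by an independent copy. -/
lemma map_update_infinitePi (m : ι → Measure ℝ) [∀ i, IsProbabilityMeasure (m i)] (j : ι) :
    ((Measure.infinitePi m).prod (m j)).map (fun p : (ι → ℝ) × ℝ => Function.update p.1 j p.2) =
      Measure.infinitePi m := by
  have hmeas : Measurable (fun p : (ι → ℝ) × ℝ => Function.update p.1 j p.2) := by
    refine measurable_pi_iff.2 fun i => ?_
    by_cases h : i = j
    · subst h
      simpa using measurable_snd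
    · simpa [Function.update_of_ne h] using! (measurable_pi_apply i).comp measurable_fst
  refine Measure.eq_infinitePi m fun S t ht => ?_
  rw [Measure.map_apply hmeas (MeasurableSet.pi S.countable_toSet fun i hi => ht i)]
  have : (fun p : (ι → ℝ) × ℝ => Function.update p.1 j p.2) ⁻¹' (Set.pi S t) =
      (Set.pi (S.erase j : Finset ι) t) ×ˢ (if j ∈ S then t j else Set.univ) := by
    ext p
    simp only [Set.mem_preimage, Set.mem_pi, Finset.mem_coe, Set.mem_prod, Finset.mem_erase]
    constructor
    · intro h
      refine ⟨fun i hi => ?_, ?_⟩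
      · have := h i hi.2
        rwa [Function.update_of_ne hi.1] at this
      · split_ifs with hj
        · simpa using h j hj
        · trivial
    · rintro ⟨h1, h2⟩ i hi
      by_cases h : i = j
      · subst h
        simpa [hi] using h2
      · rw [Function.update_of_ne h]
        exact h1 i ⟨h, hi⟩
  rw [this, Measure.prod_prod, Measure.infinitePi_pi _ (fun i _ => ht i)]
  split_ifs with hj
  · rw [mul_comm, Finset.mul_prod_erase S (fun i => m i (t i)) hj]
  · rw [measure_univ, mul_one, Finset.erase_eq_of_notMem hj]

/-- This is how independence is exploited: the downloading time of one chunk is integrated out with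
all the others frozen. -/
lemma lintegral_resample (m : ι → Measure ℝ) [∀ i, IsProbabilityMeasure (m i)] (j : ι)
    {F : (ι → ℝ) → ℝ≥0∞} (hF : Measurable F) :
    ∫⁻ x, F x ∂(Measure.infinitePi m) =
      ∫⁻ x, ∫⁻ y, F (Function.update x j y) ∂(m j) ∂(Measure.infinitePi m) := by
  have hmeas : Measurable (fun p : (ι → ℝ) × ℝ => Function.update p.1 j p.2) := by
    refine measurable_pi_iff.2 fun i => ?_
    by_cases h : i = j
    · subst h
      simpa using measurable_snd
    · simpa [Function.update_of_ne h] using! (measurable_pi_apply i).comp measurable_fst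
  conv_lhs => rw [← map_update_infinitePi m j]
  rw [lintegral_map hF hmeas]
  exact lintegral_prod _ (hF.comp hmeas).aemeasurable

end Resample

/-! ### The exponential law and its constant hazard rate -/

section Exp

variable {μ : ℝ}

instance nullSingletonClass_expMeasure : NullSingletonClass (expMeasure μ) where
  measure_singleton x :=
    withDensity_absolutelyContinuous volume (gammaPDF 1 μ) (measure_singleton x)

lemma expMeasure_Ici (hμ : 0 < μ) {v : ℝ} (hv : 0 ≤ v) :
    expMeasure μ (Set.Ici v) = ENNReal.ofReal (Real.exp (-(μ * v))) := by
  have := isProbabilityMeasure_expMeasure hμ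
  have h1 : expMeasure μ (Set.Iic v) = ENNReal.ofReal (1 - Real.exp (-(μ * v))) := by
    rw [← ofReal_cdf, cdf_expMeasure_eq hμ, if_pos hv]
  rw [← measure_congr Ioi_ae_eq_Ici, ← Set.compl_Iic, prob_compl_eq_one_sub measurableSet_Iic, h1,
    ← ENNReal.ofReal_one, ← ENNReal.ofReal_sub]
  · simp
  · rw [sub_nonneg, Real.exp_le_one_iff, neg_nonpos]
    positivity

lemma expMeasure_Iic_zero (hμ : 0 < μ) : expMeasure μ (Set.Iic 0) = 0 := by
  have := isProbabilityMeasure_expMeasure hμ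
  rw [← ofReal_cdf, cdf_expMeasure_eq hμ]
  simp

/-- The density at `v` is `μ` times the probability of `Set.Ici v`. Tonelli therefore replaces the
value of `g` at the random time by the integral of `μ * g` up to that time. -/
lemma lintegral_expMeasure_eq_tail (hμ : 0 < μ) {g : ℝ → ℝ≥0∞} (hg : Measurable g) :
    ∫⁻ y, g y ∂(expMeasure μ) =
      ∫⁻ y, ∫⁻ v in Set.Ioi (0 : ℝ), (Set.Iic y).indicator (fun v => ENNReal.ofReal μ * g v) v
        ∂volume ∂(expMeasure μ) := by
  have := isProbabilityMeasure_expMeasure hμ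
  rw [lintegral_lintegral_swap]
  · have h1 : ∀ v ∈ Set.Ioi (0 : ℝ),
        ∫⁻ y, (Set.Iic y).indicator (fun v => ENNReal.ofReal μ * g v) v ∂(expMeasure μ) =
          ENNReal.ofReal (μ * Real.exp (-(μ * v))) * g v := by
      intro v hv
      have : ∀ y, (Set.Iic y).indicator (fun v => ENNReal.ofReal μ * g v) v =
          (Set.Ici v).indicator (fun _ => ENNReal.ofReal μ * g v) y := by
        intro y
        simp [Set.indicator_apply]
      simp_rw [this]
      rw [lintegral_indicator_const measurableSet_Ici, expMeasure_Ici hμ (le_of_lt hv),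
        ENNReal.ofReal_mul hμ.le]
      ring
    rw [setLIntegral_congr_fun measurableSet_Ioi h1]
    have h2 : expMeasure μ = volume.withDensity (exponentialPDF μ) := rfl
    have h3 : Measurable (exponentialPDF μ) :=
      (measurable_exponentialPDFReal μ).ennreal_ofReal
    rw [h2, lintegral_withDensity_eq_lintegral_mul _ h3 hg, ← lintegral_indicator measurableSet_Ioi]
    -- At `v = 0` the density is positive although `Set.Ioi 0` excludes this point.
    have h4 : ∀ᵐ v : ℝ, v ≠ 0 := by
      rw [ae_iff]
      simp
    refine lintegral_congr_ae ?_
    filter_upwards [h4] with v hv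
    rw [Pi.mul_apply, exponentialPDF_eq]
    rcases lt_or_gt_of_ne hv with hv | hv
    · simp [hv.not_ge, hv.le]
    · simp [hv, hv.le]
  · refine Measurable.aemeasurable ?_
    have : (Function.uncurry fun (y v : ℝ) =>
        (Set.Iic y).indicator (fun v => ENNReal.ofReal μ * g v) v) =
        {p : ℝ × ℝ | p.2 ≤ p.1}.indicator fun p => ENNReal.ofReal μ * g p.2 := by
      ext p
      simp [Set.indicator_apply, Function.uncurry]
    rw [this]
    exact (measurable_const.mul (hg.comp measurable_snd)).indicator
      (measurableSet_le measurable_snd measurable_fst)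

end Exp

/-! ### The intensity of a single download -/

section Compensator

variable {ι : Type*} [DecidableEq ι]

/-- The compensator of a download: the download of a chunk `j` that is started at time `st` has
the intensity `μ` while it goes on. The integrand `h` is predictable, that is, `h x t`
does not depend on `x j` as long as the download is not over before `t`. -/
lemma lintegral_compensator [Countable ι] {μ : ℝ} (hμ : 0 < μ) (j : ι)
    {st : (ι → ℝ) → ℝ≥0∞} (hst : Measurable st)
    {h : (ι → ℝ) → ℝ → ℝ≥0∞} (hh : Measurable (Function.uncurry h))
    (st_eq : ∀ x x' : ι → ℝ, (∀ i, 0 < x i) → (∀ i, 0 < x' i) → (∀ i, i ≠ j → x i = x' i) →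
      st x = st x')
    (h_eq : ∀ x x' : ι → ℝ, (∀ i, 0 < x i) → (∀ i, 0 < x' i) → (∀ i, i ≠ j → x i = x' i) →
      ∀ t : ℝ, ENNReal.ofReal t ≤ st x + ENNReal.ofReal (x j) →
        ENNReal.ofReal t ≤ st x' + ENNReal.ofReal (x' j) → h x t = h x' t) :
    ∫⁻ x, {x | st x ≠ ⊤}.indicator (fun x => h x ((st x).toReal + x j)) x
        ∂(Measure.infinitePi fun _ : ι => expMeasure μ) =
      ∫⁻ x, ∫⁻ t in Set.Ioi (0 : ℝ), {t : ℝ | st x < ENNReal.ofReal t ∧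
        ENNReal.ofReal t ≤ st x + ENNReal.ofReal (x j)}.indicator
          (fun t => ENNReal.ofReal μ * h x t) t ∂volume
        ∂(Measure.infinitePi fun _ : ι => expMeasure μ) := by
  have hprob := isProbabilityMeasure_expMeasure hμ
  set ν := Measure.infinitePi fun _ : ι => expMeasure μ with hν
  have hpos : ∀ᵐ x ∂ν, ∀ i, 0 < x i := by
    rw [ae_all_iff]
    intro i
    rw [ae_iff]
    have : {x : ι → ℝ | ¬ 0 < x i} = (fun x : ι → ℝ => x i) ⁻¹' Set.Iic 0 := by
      ext x
      simp
    rw [this, ← Measure.map_apply (measurable_pi_apply i) measurableSet_Iic, hν,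
      Measure.infinitePi_map_eval, expMeasure_Iic_zero hμ]
  have hpos' : ∀ᵐ y ∂(expMeasure μ), 0 < y := by
    rw [ae_iff]
    simpa [Set.Iic] using expMeasure_Iic_zero hμ
  have hl : Measurable fun x : ι → ℝ =>
      {x | st x ≠ ⊤}.indicator (fun x => h x ((st x).toReal + x j)) x := by
    refine Measurable.indicator ?_ (measurableSet_eq_fun hst measurable_const).compl
    exact hh.comp (measurable_id.prodMk (hst.ennreal_toReal.add (measurable_pi_apply j)))
  have hr : Measurable fun x : ι → ℝ => ∫⁻ t in Set.Ioi (0 : ℝ),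
      {t : ℝ | st x < ENNReal.ofReal t ∧ ENNReal.ofReal t ≤ st x + ENNReal.ofReal (x j)}.indicator
          (fun t => ENNReal.ofReal μ * h x t) t := by
    refine Measurable.lintegral_prod_right' (f := fun p : (ι → ℝ) × ℝ =>
      {t : ℝ | st p.1 < ENNReal.ofReal t ∧
        ENNReal.ofReal t ≤ st p.1 + ENNReal.ofReal (p.1 j)}.indicator
          (fun t => ENNReal.ofReal μ * h p.1 t) p.2) ?_
    have : (fun p : (ι → ℝ) × ℝ => {t : ℝ | st p.1 < ENNReal.ofReal t ∧
        ENNReal.ofReal t ≤ st p.1 + ENNReal.ofReal (p.1 j)}.indicator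
          (fun t => ENNReal.ofReal μ * h p.1 t) p.2) =
        {p : (ι → ℝ) × ℝ | st p.1 < ENNReal.ofReal p.2 ∧
          ENNReal.ofReal p.2 ≤ st p.1 + ENNReal.ofReal (p.1 j)}.indicator
          (fun p => ENNReal.ofReal μ * h p.1 p.2) := by
      ext p
      simp [Set.indicator_apply]
    rw [this]
    refine (measurable_const.mul hh).indicator (MeasurableSet.inter ?_ ?_)
    · exact measurableSet_lt (hst.comp measurable_fst) measurable_snd.ennreal_ofReal
    · exact measurableSet_le measurable_snd.ennreal_ofReal ((hst.comp measurable_fst).add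
        ((measurable_pi_apply j).comp measurable_fst).ennreal_ofReal)
  -- With the other coordinates frozen the start of `j` is a constant, and only the exponential time
  -- of `j` remains random.
  rw [lintegral_resample _ j hl, lintegral_resample _ j hr]
  refine lintegral_congr_ae ?_
  filter_upwards [hpos] with x hx
  have hupd : ∀ y : ℝ, 0 < y → ∀ i, 0 < Function.update x j y i := by
    intro y hy i
    by_cases h : i = j
    · subst h
      simpa using hy
    · simpa [Function.update_of_ne h] using hx i
  have hne : ∀ y y' : ℝ, ∀ i, i ≠ j → Function.update x j y i = Function.update x j y' i := by
    intro y y' i hi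
    rw [Function.update_of_ne hi, Function.update_of_ne hi]
  have hst' : ∀ y : ℝ, 0 < y → st (Function.update x j y) = st x := fun y hy =>
    st_eq _ _ (hupd y hy) hx fun i hi => Function.update_of_ne hi _ _
  by_cases htop : st x = ⊤
  · refine lintegral_congr_ae ?_
    filter_upwards [hpos'] with y hy
    simp [hst' y hy, htop]
  · set σ := (st x).toReal with hσ
    have hσ0 : 0 ≤ σ := ENNReal.toReal_nonneg
    have hstσ : st x = ENNReal.ofReal σ := (ENNReal.ofReal_toReal htop).symm
    have hg : Measurable fun y => h (Function.update x j y) (σ + y) := by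
      refine hh.comp (Measurable.prodMk ?_ (measurable_const.add measurable_id))
      exact measurable_update x
    rw [lintegral_congr_ae (g := fun y => h (Function.update x j y) (σ + y)),
      lintegral_expMeasure_eq_tail hμ hg]
    · refine lintegral_congr_ae ?_
      filter_upwards [hpos'] with y hy
      rw [hst' y hy, ← lintegral_indicator measurableSet_Ioi,
        ← lintegral_indicator measurableSet_Ioi]
      -- Time is counted from the start `σ`, so that `v` is the age of the download.
      conv_rhs => rw [← lintegral_add_left_eq_self _ σ]
      refine lintegral_congr fun v => ?_
      rw [hstσ, Function.update_self, ← ENNReal.ofReal_add hσ0 hy.le]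
      by_cases hv : 0 < v
      · have h0 : 0 < σ + v := by positivity
        rw [Set.indicator_of_mem (Set.mem_Ioi.2 hv), Set.indicator_of_mem (Set.mem_Ioi.2 h0)]
        simp only [Set.indicator_apply, Set.mem_Iic, Set.mem_ofPred_eq]
        have e1 : (ENNReal.ofReal σ < ENNReal.ofReal (σ + v) ∧
            ENNReal.ofReal (σ + v) ≤ ENNReal.ofReal (σ + y)) ↔ v ≤ y := by
          rw [ENNReal.ofReal_lt_ofReal_iff h0, ENNReal.ofReal_le_ofReal_iff (by positivity)]
          constructor
          · rintro ⟨_, h2⟩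
            linarith
          · intro h2
            exact ⟨by linarith, by linarith⟩
        simp only [e1]
        split_ifs with hvy
        · congr 1
          -- One side has downloading time `v`, the other `y ≥ v`; in both cases the download is not
          -- over before `σ + v`, so predictability applies.
          refine h_eq _ _ (hupd v hv) (hupd y hy) (hne v y) _ ?_ ?_
          · rw [hst' v hv, hstσ, Function.update_self, ← ENNReal.ofReal_add hσ0 hv.le]
          · rw [hst' y hy, hstσ, Function.update_self, ← ENNReal.ofReal_add hσ0 hy.le]
            exact ENNReal.ofReal_le_ofReal (by linarith)
        · rfl
      · rw [Set.indicator_of_notMem (by simpa using hv)]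
        by_cases h0 : 0 < σ + v
        · rw [Set.indicator_of_mem (Set.mem_Ioi.2 h0), Set.indicator_of_notMem]
          rintro ⟨h1, -⟩
          rw [ENNReal.ofReal_lt_ofReal_iff h0] at h1
          linarith
        · rw [Set.indicator_of_notMem (by simpa using h0)]
    · filter_upwards [hpos'] with y hy
      rw [Set.indicator_of_mem (by simpa [hst' y hy] using htop), hst' y hy, Function.update_self]

end Compensator

lemma ae_pos_infinitePi {μ : ℝ} (hμ : 0 < μ) :
    ∀ᵐ x ∂(Measure.infinitePi fun _ : Chunk => expMeasure μ), ∀ j, 0 < x j := by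
  have hprob := isProbabilityMeasure_expMeasure hμ
  rw [ae_all_iff]
  intro i
  rw [ae_iff]
  have : {x : Chunk → ℝ | ¬ 0 < x i} = (fun x : Chunk → ℝ => x i) ⁻¹' Set.Iic 0 := by
    ext x
    simp
  rw [this, ← Measure.map_apply (measurable_pi_apply i) measurableSet_Iic,
    Measure.infinitePi_map_eval, expMeasure_Iic_zero hμ]

/-! ### Measurability of the state -/

section Measurability

/-- The states are finite sets of chunks, hence countably many: a quantity is measurable once each
state is a measurable event, with no condition on its dependence on the state. -/
lemma measurable_comp_discrete {α β γ : Type*} [MeasurableSpace α] [MeasurableSpace γ]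
    [Countable β] {f : α → β} (hf : ∀ b, MeasurableSet {a | f a = b}) {G : β → α → γ}
    (hG : ∀ b, Measurable (G b)) : Measurable fun a => G (f a) a := by
  intro S hS
  have : (fun a => G (f a) a) ⁻¹' S = ⋃ b, {a | f a = b} ∩ G b ⁻¹' S := by
    ext a
    simp
  rw [this]
  exact MeasurableSet.iUnion fun b => (hf b).inter (hG b hS)

lemma measurableSet_filter_eq {α β : Type*} [MeasurableSpace α] (C : Finset β)
    (p : α → β → Prop) [∀ a, DecidablePred (p a)] (hp : ∀ j ∈ C, MeasurableSet {a | p a j})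
    (A : Finset β) : MeasurableSet {a | C.filter (p a) = A} := by
  classical
  by_cases hA : A ⊆ C
  · have : {a | C.filter (p a) = A} = ⋂ j ∈ C, {a | p a j ↔ j ∈ A} := by
      ext a
      simp only [Set.mem_ofPred_eq, Set.mem_iInter]
      constructor
      · rintro rfl j hj
        simp [hj]
      · intro h
        ext j
        rw [Finset.mem_filter]
        exact ⟨fun h1 => (h j h1.1).1 h1.2, fun h1 => ⟨hA h1, (h j (hA h1)).2 h1⟩⟩
    rw [this]
    refine C.measurableSet_biInter fun j hj => ?_
    by_cases hjA : j ∈ A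
    · simpa [hjA] using hp j hj
    · have : {a | p a j ↔ j ∈ A} = {a | p a j}ᶜ := by
        ext a
        simp [hjA]
      rw [this]
      exact (hp j hj).compl
  · have : {a | C.filter (p a) = A} = ∅ := by
      ext a
      simp only [Set.mem_ofPred_eq, Set.mem_empty_iff_false, iff_false]
      rintro rfl
      exact hA (Finset.filter_subset _ _)
    rw [this]
    exact MeasurableSet.empty

variable {α : Type*} [MeasurableSpace α] {r : Requests} {N : ℕ} {s : α → Chunk → ℝ≥0∞}
  {x : α → Chunk → ℝ} {t : α → ℝ≥0∞}

lemma measurable_finish (hs : ∀ j, Measurable fun a => s a j) (hx : ∀ j, Measurable fun a => x a j)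
    (j : Chunk) : Measurable fun a => finish (s a) (x a) j :=
  (hs j).add (hx j).ennreal_ofReal

lemma measurable_complTime (hs : ∀ j, Measurable fun a => s a j)
    (hx : ∀ j, Measurable fun a => x a j) (i : ℕ) :
    Measurable fun a => complTime r (s a) (x a) i := by
  simp_rw [complTime_eq_inf, Finset.inf_eq_iInf, Finset.sup_eq_iSup]
  refine Measurable.iInf fun Q => Measurable.iInf fun _ => Measurable.iSup fun c =>
    Measurable.iSup fun _ => measurable_finish hs hx _

lemma measurableSet_doneBefore_eq (hs : ∀ j, Measurable fun a => s a j)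
    (hx : ∀ j, Measurable fun a => x a j) (ht : Measurable t) (A : Finset Chunk) :
    MeasurableSet {a | doneBefore r N (s a) (x a) (t a) = A} := by
  classical
  refine measurableSet_filter_eq _ _ (fun j _ => ?_) A
  exact (measurableSet_lt (measurable_finish hs hx j) ht).inter
    (measurableSet_le (measurable_finish hs hx j) (measurable_complTime hs hx _))

lemma measurableSet_servedBefore_eq (hs : ∀ j, Measurable fun a => s a j)
    (hx : ∀ j, Measurable fun a => x a j) (ht : Measurable t) (A : Finset Chunk) :
    MeasurableSet {a | servedBefore r N (s a) (x a) (t a) = A} := by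
  classical
  refine measurableSet_filter_eq _ _ (fun j _ => ?_) A
  exact (measurableSet_lt (hs j) ht).inter
    ((measurableSet_le ht (measurable_finish hs hx j)).inter
      (measurableSet_le ht (measurable_complTime hs hx _)))

lemma measurableSet_doneBy_eq (hs : ∀ j, Measurable fun a => s a j)
    (hx : ∀ j, Measurable fun a => x a j) (ht : Measurable t) (A : Finset Chunk) :
    MeasurableSet {a | doneBy r N (s a) (x a) (t a) = A} := by
  classical
  refine measurableSet_filter_eq _ _ (fun j _ => ?_) A
  exact (measurableSet_le (measurable_finish hs hx j) ht).inter
    (measurableSet_le (measurable_finish hs hx j) (measurable_complTime hs hx _))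

lemma measurableSet_servedPre_eq (hs : ∀ j, Measurable fun a => s a j)
    (hx : ∀ j, Measurable fun a => x a j) (ht : Measurable t) (A : Finset Chunk) :
    MeasurableSet {a | servedPre r N (s a) (x a) (t a) = A} := by
  classical
  refine measurableSet_filter_eq _ _ (fun j _ => ?_) A
  exact (measurableSet_lt (hs j) ht).inter
    ((measurableSet_lt ht (measurable_finish hs hx j)).inter
      (measurableSet_lt ht (measurable_complTime hs hx _)))

/-- A function of the time and of the state just before this time is measurable. -/
lemma measurable_state {γ : Type*} [MeasurableSpace γ] (hs : ∀ j, Measurable fun a => s a j)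
    (hx : ∀ j, Measurable fun a => x a j) (ht : Measurable t)
    {G : α → Finset Chunk → Finset Chunk → γ} (hG : ∀ D V, Measurable fun a => G a D V) :
    Measurable fun a => G a (doneBefore r N (s a) (x a) (t a))
      (servedBefore r N (s a) (x a) (t a)) := by
  refine measurable_comp_discrete (f := fun a => (doneBefore r N (s a) (x a) (t a),
    servedBefore r N (s a) (x a) (t a))) (G := fun b a => G a b.1 b.2) ?_ fun b => hG _ _
  rintro ⟨D, V⟩
  simp only [Prod.mk.injEq]
  exact (measurableSet_doneBefore_eq hs hx ht D).inter (measurableSet_servedBefore_eq hs hx ht V)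

end Measurability

/-! ### Schedules that do not anticipate -/

/-- The schedules that an online policy gives for fixed request parameters and a fixed seed. -/
structure Adapted (L : ℕ) (r : Requests) (N : ℕ) (S : (Chunk → ℝ) → Chunk → ℝ≥0∞) : Prop where
  measurable : ∀ j, Measurable fun x => S x j
  feasible : ∀ x, (∀ j, 0 < x j) → Feasible L r N x (S x)
  nonanticipating : ∀ (t : ℝ≥0) (x x' : Chunk → ℝ), (∀ j, 0 < x j) → (∀ j, 0 < x' j) →
    SameHistory t r N x (S x) r N x' (S x') → ∀ j, S x j ≤ t ↔ S x' j ≤ t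

lemma OnlinePolicy.adapted {L : ℕ} (π : OnlinePolicy L) (u : unitInterval) {r : Requests} {N : ℕ}
    (hr : r.Valid N) : Adapted L r N (π.start u r N) where
  measurable j := (π.measurable r N hr j).comp measurable_prodMk_left
  feasible x hx := π.feasible u r N x hr hx
  nonanticipating t x x' hx hx' h := π.nonanticipating u t r r N N x x' hr hr hx hx' h

/-- The chunks that are ever downloaded. -/
noncomputable def everDone (r : Requests) (N : ℕ) (s : Chunk → ℝ≥0∞) (x : Chunk → ℝ) :
    Finset Chunk := by
  classical
  exact (chunks r N).filter fun j => s j ≠ ⊤ ∧ finish s x j ≤ complTime r s x j.1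

lemma mem_everDone {r : Requests} {N : ℕ} {s : Chunk → ℝ≥0∞} {x : Chunk → ℝ} {j : Chunk} :
    j ∈ everDone r N s x ↔ j ∈ chunks r N ∧ s j ≠ ⊤ ∧ finish s x j ≤ complTime r s x j.1 := by
  classical
  rw [everDone, Finset.mem_filter]

/-! ### Predictability of the state and intensity of the downloads -/

namespace Adapted

variable {L : ℕ} {r : Requests} {N : ℕ} {S : (Chunk → ℝ) → Chunk → ℝ≥0∞} {j : Chunk}
  {x x' : Chunk → ℝ}

/-- While the download of `j` is not over, no decision depends on its downloading time. -/
lemma start_agree (hr : r.Valid N) (hS : Adapted L r N S) (hx : ∀ l, 0 < x l)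
    (hx' : ∀ l, 0 < x' l) (hne : ∀ l, l ≠ j → x l = x' l) (l : Chunk) (hl : S x l ≠ S x' l) :
    min (finish (S x) x j) (finish (S x') x' j) ≤ min (S x l) (S x' l) := by
  classical
  by_contra! hlt
  set m := min (finish (S x) x j) (finish (S x') x' j) with hm
  have hmem : ∀ l, S x l ≠ S x' l → l ∈ chunks r N := by
    intro l hl
    by_cases h : S x l = ⊤
    · exact (hS.feasible x' hx').mem_chunks fun h' => hl (h.trans h'.symm)
    · exact (hS.feasible x hx).mem_chunks h
  -- Take the earliest start at which the schedules differ. Up to that time all finishes coincide,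
  -- so the histories are the same and the decision cannot differ.
  obtain ⟨l₀, hl₀, hmin⟩ := Finset.exists_min_image
    ((chunks r N).filter fun l => S x l ≠ S x' l) (fun l => min (S x l) (S x' l))
    ⟨l, Finset.mem_filter.2 ⟨hmem l hl, hl⟩⟩
  have hl₀' := (Finset.mem_filter.1 hl₀).2
  have hlt₀ : min (S x l₀) (S x' l₀) < m :=
    (hmin l (Finset.mem_filter.2 ⟨hmem l hl, hl⟩)).trans_lt hlt
  obtain ⟨t, ht⟩ : ∃ t : ℝ≥0, (t : ℝ≥0∞) = min (S x l₀) (S x' l₀) :=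
    ⟨_, ENNReal.coe_toNNReal (ne_top_of_lt hlt₀)⟩
  have hagree : ∀ l, S x l < t ∨ S x' l < t → S x l = S x' l := by
    intro l hl
    by_contra h
    have h1 := hmin l (Finset.mem_filter.2 ⟨hmem l h, h⟩)
    rw [← ht, ← min_lt_iff] at *
    exact absurd hl (not_lt.2 h1)
  have hfin : ∀ l, finish (S x) x l ≤ t ∨ finish (S x') x' l ≤ t →
      finish (S x) x l = finish (S x') x' l := by
    intro l hl
    have h1 : l ≠ j := by
      rintro rfl
      rw [← min_le_iff, ← hm] at hl
      exact absurd (hl.trans_lt (ht ▸ hlt₀)) (lt_irrefl _)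
    have h2 : S x l = S x' l := by
      refine hagree l ?_
      rcases hl with hl | hl
      · exact Or.inl ((lt_finish hx (start_ne_top_of_finish hl)).trans_le hl)
      · exact Or.inr ((lt_finish hx' (start_ne_top_of_finish hl)).trans_le hl)
    rw [finish, finish, h2, hne l h1]
  have hhist : SameHistory t r N x (S x) r N x' (S x') := by
    refine ⟨fun i => Iff.rfl, fun i _ _ => ⟨rfl, rfl, rfl⟩, fun τ hτ => ?_⟩
    rw [← coe_doneBy (hS.feasible x hx), ← coe_doneBy (hS.feasible x' hx')]
    have hτ' : (τ : ℝ≥0∞) ≤ t := by exact_mod_cast hτ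
    rw [doneBy_congr hr fun l _ hl => hfin l (hl.imp (fun h => h.trans hτ') fun h => h.trans hτ')]
  have h3 := hS.nonanticipating t x x' hx hx' hhist l₀
  rcases le_total (S x l₀) (S x' l₀) with h | h
  · rw [min_eq_left h] at ht
    exact hl₀' (le_antisymm h ((h3.1 ht.ge).trans ht.le))
  · rw [min_eq_right h] at ht
    exact hl₀' (le_antisymm ((h3.2 ht.ge).trans ht.le) h)

/-- A chunk starts before it finishes, so a difference in the start of `j` would precede both
finishes of `j`, against `start_agree`. -/
lemma start_self (hr : r.Valid N) (hS : Adapted L r N S) (hx : ∀ l, 0 < x l)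
    (hx' : ∀ l, 0 < x' l) (hne : ∀ l, l ≠ j → x l = x' l) : S x j = S x' j := by
  by_contra h
  have h1 := start_agree hr hS hx hx' hne j h
  have h2 : min (S x j) (S x' j) < min (finish (S x) x j) (finish (S x') x' j) := by
    rcases lt_or_gt_of_ne h with h | h
    · rw [min_eq_left h.le]
      exact lt_min (lt_finish hx (ne_top_of_lt h)) (h.trans_le (le_finish j))
    · rw [min_eq_right h.le]
      exact lt_min (h.trans_le (le_finish j)) (lt_finish hx' (ne_top_of_lt h))
  exact absurd h1 (not_le.2 h2)

lemma started_iff (hr : r.Valid N) (hS : Adapted L r N S) (hx : ∀ l, 0 < x l)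
    (hx' : ∀ l, 0 < x' l) (hne : ∀ l, l ≠ j → x l = x' l) {t : ℝ≥0∞}
    (ht : t ≤ finish (S x) x j) (ht' : t ≤ finish (S x') x' j) (l : Chunk)
    (hl : S x l < t ∨ S x' l < t) : S x l = S x' l := by
  by_contra h
  have h1 := (le_min ht ht').trans (start_agree hr hS hx hx' hne l h)
  rw [le_min_iff] at h1
  rcases hl with hl | hl
  · exact absurd hl (not_lt.2 h1.1)
  · exact absurd hl (not_lt.2 h1.2)

/-- With `servedBefore_eq` this makes the left-limit state predictable for the download of `j`. The
left limit matters: the state at the finish itself may depend on `x j`. -/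
lemma doneBefore_eq (hr : r.Valid N) (hS : Adapted L r N S) (hx : ∀ l, 0 < x l)
    (hx' : ∀ l, 0 < x' l) (hne : ∀ l, l ≠ j → x l = x' l) {t : ℝ≥0∞}
    (ht : t ≤ finish (S x) x j) (ht' : t ≤ finish (S x') x' j) :
    doneBefore r N (S x) x t = doneBefore r N (S x') x' t := by
  refine doneBefore_congr hr fun l _ hl => ?_
  have h1 : l ≠ j := by
    rintro rfl
    rcases hl with hl | hl
    · exact absurd hl (not_lt.2 ht)
    · exact absurd hl (not_lt.2 ht')
  rw [finish, finish, hne l h1, started_iff hr hS hx hx' hne ht ht' l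
    (hl.imp (fun h => (le_finish l).trans_lt h) fun h => (le_finish l).trans_lt h)]

lemma servedBefore_eq (hr : r.Valid N) (hS : Adapted L r N S) (hx : ∀ l, 0 < x l)
    (hx' : ∀ l, 0 < x' l) (hne : ∀ l, l ≠ j → x l = x' l) {t : ℝ≥0∞}
    (ht : t ≤ finish (S x) x j) (ht' : t ≤ finish (S x') x' j) :
    servedBefore r N (S x) x t = servedBefore r N (S x') x' t := by
  classical
  ext l
  rw [mem_servedBefore_iff hr, mem_servedBefore_iff hr, doneBefore_eq hr hS hx hx' hne ht ht']
  have : l ∈ startedBefore r N (S x) t ↔ l ∈ startedBefore r N (S x') t := by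
    simp only [startedBefore, Finset.mem_filter]
    refine and_congr_right fun _ => ⟨fun h => ?_, fun h => ?_⟩
    · rwa [← started_iff hr hS hx hx' hne ht ht' l (Or.inl h)]
    · rwa [started_iff hr hS hx hx' hne ht ht' l (Or.inr h)]
  rw [this]

/-- While chunk `j` is under service it is downloaded at rate `μ`. -/
lemma lintegral_single {μ : ℝ} (hμ : 0 < μ) (hr : r.Valid N) (hS : Adapted L r N S)
    (hj : j ∈ chunks r N) {G : ℝ → Finset Chunk → Finset Chunk → ℝ≥0∞}
    (hG : ∀ D V, Measurable fun t => G t D V) :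
    Measurable (fun p : (Chunk → ℝ) × ℝ => if j ∈ servedBefore r N (S p.1) p.1 (ENNReal.ofReal p.2)
      then ENNReal.ofReal μ * G p.2 (doneBefore r N (S p.1) p.1 (ENNReal.ofReal p.2))
          (servedBefore r N (S p.1) p.1 (ENNReal.ofReal p.2)) else 0) ∧
    Measurable (fun x => if j ∈ everDone r N (S x) x then G (finish (S x) x j).toReal
        (doneBefore r N (S x) x (finish (S x) x j)) (servedBefore r N (S x) x (finish (S x) x j))
        else 0) ∧
    ∫⁻ x, (if j ∈ everDone r N (S x) x then G (finish (S x) x j).toReal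
        (doneBefore r N (S x) x (finish (S x) x j)) (servedBefore r N (S x) x (finish (S x) x j))
        else 0) ∂(Measure.infinitePi fun _ : Chunk => expMeasure μ) =
      ∫⁻ x, ∫⁻ t in Set.Ioi (0 : ℝ), (if j ∈ servedBefore r N (S x) x (ENNReal.ofReal t) then
        ENNReal.ofReal μ * G t (doneBefore r N (S x) x (ENNReal.ofReal t))
          (servedBefore r N (S x) x (ENNReal.ofReal t)) else 0) ∂volume
        ∂(Measure.infinitePi fun _ : Chunk => expMeasure μ) := by
  classical
  have hs1 : ∀ j, Measurable fun p : (Chunk → ℝ) × ℝ => S p.1 j :=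
    fun j => (hS.measurable j).comp measurable_fst
  have hx1 : ∀ j, Measurable fun p : (Chunk → ℝ) × ℝ => p.1 j :=
    fun j => (measurable_pi_apply j).comp measurable_fst
  have hx2 : ∀ j, Measurable fun x : Chunk → ℝ => x j := fun j => measurable_pi_apply j
  refine ⟨?_, ?_, ?_⟩
  · exact measurable_state (G := fun p D V => if j ∈ V then ENNReal.ofReal μ * G p.2 D V else 0)
      hs1 hx1 measurable_snd.ennreal_ofReal fun D V => by
        split_ifs
        · exact measurable_const.mul ((hG D V).comp measurable_snd)
        · exact measurable_const
  · simp_rw [mem_everDone]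
    refine Measurable.ite ?_ ?_ measurable_const
    · simp only [hj, true_and]
      exact (measurableSet_eq_fun (hS.measurable j) measurable_const).compl.inter
        (measurableSet_le (measurable_finish hS.measurable hx2 j)
          (measurable_complTime hS.measurable hx2 _))
    · exact measurable_state (G := fun x D V => G (finish (S x) x j).toReal D V)
        hS.measurable hx2 (measurable_finish hS.measurable hx2 j)
        fun D V => (hG D V).comp (measurable_finish hS.measurable hx2 j).ennreal_toReal
  -- The compensator identity concerns the uninterrupted download. Termination by the completion of
  -- the request is therefore built into the integrand, where it is predictable.
  let H : (Chunk → ℝ) → ℝ → ℝ≥0∞ := fun x t =>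
    if ENNReal.ofReal t ≤ complTime r (S x) x j.1 then
      G t (doneBefore r N (S x) x (ENNReal.ofReal t))
        (servedBefore r N (S x) x (ENNReal.ofReal t)) else 0
  have hHmeas : Measurable (Function.uncurry H) := by
    refine Measurable.ite ?_ ?_ measurable_const
    · exact measurableSet_le measurable_snd.ennreal_ofReal (measurable_complTime hs1 hx1 _)
    · exact measurable_state (G := fun p D V => G p.2 D V) hs1 hx1 measurable_snd.ennreal_ofReal
        fun D V => (hG D V).comp measurable_snd
  have hcomp := lintegral_compensator hμ j (hS.measurable j) hHmeas
    (fun x x' hx hx' hne => start_self hr hS hx hx' hne)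
    (fun x x' hx hx' hne t ht ht' => by
      have e1 := doneBefore_eq hr hS hx hx' hne ht ht'
      simp only [H, ← cnt_doneBefore_lt_iff hr (mem_chunks.1 hj).1, e1,
        servedBefore_eq hr hS hx hx' hne ht ht'])
  calc _ = ∫⁻ x, {x | S x j ≠ ⊤}.indicator (fun x => H x ((S x j).toReal + x j)) x
        ∂(Measure.infinitePi fun _ : Chunk => expMeasure μ) := by
        refine lintegral_congr_ae ?_
        filter_upwards [ae_pos_infinitePi hμ] with x hx
        simp only [mem_everDone]
        by_cases htop : S x j = ⊤
        · simp [htop]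
        · have h1 : (finish (S x) x j).toReal = (S x j).toReal + x j := by
            rw [finish, ENNReal.toReal_add htop ENNReal.ofReal_ne_top,
              ENNReal.toReal_ofReal (hx j).le]
          have h2 : ENNReal.ofReal (finish (S x) x j).toReal = finish (S x) x j :=
            ENNReal.ofReal_toReal (by simp [finish, htop])
          rw [Set.indicator_of_mem (by exact htop), ← h1]
          simp only [H, h2, ne_eq, htop, not_false_eq_true, true_and, hj]
    _ = _ := hcomp
    _ = _ := by
        refine lintegral_congr fun x => lintegral_congr fun t => ?_
        simp only [Set.indicator_apply, H, Set.mem_ofPred_eq]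
        have e : j ∈ servedBefore r N (S x) x (ENNReal.ofReal t) ↔ (S x j < ENNReal.ofReal t ∧
            ENNReal.ofReal t ≤ S x j + ENNReal.ofReal (x j)) ∧
            ENNReal.ofReal t ≤ complTime r (S x) x j.1 := by
          rw [servedBefore, Finset.mem_filter, finish]
          tauto
        simp only [e]
        split_ifs with h1 h2 h3 h4 h5 <;> first | rfl | (exfalso; tauto) | simp

/-- Every chunk under service is downloaded at rate `μ`. -/
lemma lintegral_sum_everDone {μ : ℝ} (hμ : 0 < μ) (hr : r.Valid N) (hS : Adapted L r N S)
    {G : Chunk → ℝ → Finset Chunk → Finset Chunk → ℝ≥0∞}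
    (hG : ∀ j D V, Measurable fun t => G j t D V) :
    ∫⁻ x, ∑ j ∈ everDone r N (S x) x, G j (finish (S x) x j).toReal
        (doneBefore r N (S x) x (finish (S x) x j)) (servedBefore r N (S x) x (finish (S x) x j))
        ∂(Measure.infinitePi fun _ : Chunk => expMeasure μ) =
      ∫⁻ x, ∫⁻ t in Set.Ioi (0 : ℝ), ∑ j ∈ servedBefore r N (S x) x (ENNReal.ofReal t),
        ENNReal.ofReal μ * G j t (doneBefore r N (S x) x (ENNReal.ofReal t))
          (servedBefore r N (S x) x (ENNReal.ofReal t)) ∂volume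
        ∂(Measure.infinitePi fun _ : Chunk => expMeasure μ) := by
  have hprob := isProbabilityMeasure_expMeasure hμ
  have hsum : ∀ (C : Finset Chunk) (g : Chunk → ℝ≥0∞), C ⊆ chunks r N →
      ∑ j ∈ C, g j = ∑ j ∈ chunks r N, if j ∈ C then g j else 0 := by
    intro C g hC
    rw [← Finset.sum_filter, Finset.filter_mem_eq_inter, Finset.inter_eq_right.2 hC]
  have h1 : ∀ x, everDone r N (S x) x ⊆ chunks r N := fun x j hj => (mem_everDone.1 hj).1
  have h2 : ∀ x t, servedBefore r N (S x) x t ⊆ chunks r N := fun x t j hj => by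
    classical
    exact (Finset.mem_filter.1 hj).1
  let A : Chunk → (Chunk → ℝ) → ℝ≥0∞ := fun j x =>
    if j ∈ everDone r N (S x) x then G j (finish (S x) x j).toReal
        (doneBefore r N (S x) x (finish (S x) x j)) (servedBefore r N (S x) x (finish (S x) x j))
        else 0
  let B : Chunk → (Chunk → ℝ) → ℝ → ℝ≥0∞ := fun j x t =>
    if j ∈ servedBefore r N (S x) x (ENNReal.ofReal t) then
        ENNReal.ofReal μ * G j t (doneBefore r N (S x) x (ENNReal.ofReal t))
          (servedBefore r N (S x) x (ENNReal.ofReal t)) else 0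
  have hB : ∀ j ∈ chunks r N, Measurable fun p : (Chunk → ℝ) × ℝ => B j p.1 p.2 :=
    fun j hj => (lintegral_single hμ hr hS hj (hG j)).1
  have hA : ∀ j ∈ chunks r N, Measurable (A j) :=
    fun j hj => (lintegral_single hμ hr hS hj (hG j)).2.1
  have hAB : ∀ j ∈ chunks r N, ∫⁻ x, A j x ∂(Measure.infinitePi fun _ : Chunk => expMeasure μ) =
      ∫⁻ x, ∫⁻ t in Set.Ioi (0 : ℝ), B j x t ∂volume
        ∂(Measure.infinitePi fun _ : Chunk => expMeasure μ) :=
    fun j hj => (lintegral_single hμ hr hS hj (hG j)).2.2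
  calc _ = ∫⁻ x, ∑ j ∈ chunks r N, A j x ∂(Measure.infinitePi fun _ : Chunk => expMeasure μ) :=
        lintegral_congr fun x => hsum _ _ (h1 x)
    _ = ∑ j ∈ chunks r N, ∫⁻ x, A j x ∂(Measure.infinitePi fun _ : Chunk => expMeasure μ) :=
        lintegral_finsetSum _ hA
    _ = ∑ j ∈ chunks r N, ∫⁻ x, ∫⁻ t in Set.Ioi (0 : ℝ), B j x t ∂volume
        ∂(Measure.infinitePi fun _ : Chunk => expMeasure μ) := Finset.sum_congr rfl hAB
    _ = ∫⁻ x, ∑ j ∈ chunks r N, ∫⁻ t in Set.Ioi (0 : ℝ), B j x t ∂volume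
        ∂(Measure.infinitePi fun _ : Chunk => expMeasure μ) :=
        (lintegral_finsetSum _ fun j hj => (hB j hj).lintegral_prod_right').symm
    _ = ∫⁻ x, ∫⁻ t in Set.Ioi (0 : ℝ), ∑ j ∈ chunks r N, B j x t ∂volume
        ∂(Measure.infinitePi fun _ : Chunk => expMeasure μ) :=
        lintegral_congr fun x =>
          (lintegral_finsetSum _ fun j hj => (hB j hj).comp measurable_prodMk_left).symm
    _ = _ := lintegral_congr fun x => lintegral_congr fun t => (hsum _ _ (h2 x _)).symm

/-- Almost surely no two downloads are over at the same time. -/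
lemma ae_finish_ne {μ : ℝ} (hμ : 0 < μ) (hr : r.Valid N) (hS : Adapted L r N S) :
    ∀ᵐ x ∂(Measure.infinitePi fun _ : Chunk => expMeasure μ), ∀ j l, j ≠ l →
      S x j ≠ ⊤ → finish (S x) x j ≠ finish (S x) x l := by
  have hprob := isProbabilityMeasure_expMeasure hμ
  have hx1 : ∀ j, Measurable fun p : (Chunk → ℝ) × ℝ => p.1 j :=
    fun j => (measurable_pi_apply j).comp measurable_fst
  have hs1 : ∀ j, Measurable fun p : (Chunk → ℝ) × ℝ => S p.1 j :=
    fun j => (hS.measurable j).comp measurable_fst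
  rw [ae_all_iff]
  intro j
  rw [ae_all_iff]
  intro l
  by_cases hjl : j = l
  · simp [hjl]
  -- The condition `S x l < t` makes this indicator predictable for `j`: a start of `l` before `t`
  -- does not depend on `x j` while the download of `j` is not over.
  let H : (Chunk → ℝ) → ℝ → ℝ≥0∞ := fun x t =>
    if S x l < ENNReal.ofReal t ∧ finish (S x) x l = ENNReal.ofReal t then 1 else 0
  have hHmeas : Measurable (Function.uncurry H) := by
    refine Measurable.ite ?_ measurable_const measurable_const
    exact (measurableSet_lt (hs1 l) measurable_snd.ennreal_ofReal).inter
      (measurableSet_eq_fun (measurable_finish hs1 hx1 l) measurable_snd.ennreal_ofReal)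
  have hcomp := lintegral_compensator hμ j (hS.measurable j) hHmeas
    (fun x x' hx hx' hne => start_self hr hS hx hx' hne)
    (fun x x' hx hx' hne t ht ht' => by
      have e1 := started_iff hr hS hx hx' hne ht ht' l
      have e2 : S x l < ENNReal.ofReal t ∧ finish (S x) x l = ENNReal.ofReal t ↔
          S x' l < ENNReal.ofReal t ∧ finish (S x') x' l = ENNReal.ofReal t := by
        constructor
        · rintro ⟨h1, h2⟩
          have h3 := e1 (Or.inl h1)
          refine ⟨h3 ▸ h1, ?_⟩
          rw [← h2, finish, finish, h3, hne l (Ne.symm hjl)]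
        · rintro ⟨h1, h2⟩
          have h3 := e1 (Or.inr h1)
          refine ⟨h3 ▸ h1, ?_⟩
          rw [← h2, finish, finish, h3, hne l (Ne.symm hjl)]
      simp only [H, e2])
  -- For each outcome the indicator is supported on a single time, so the time integral vanishes,
  -- and with it the probability of a tie at the finish of `j`.
  have hzero : ∀ x, ∫⁻ t in Set.Ioi (0 : ℝ), {t : ℝ | S x j < ENNReal.ofReal t ∧
      ENNReal.ofReal t ≤ S x j + ENNReal.ofReal (x j)}.indicator
        (fun t => ENNReal.ofReal μ * H x t) t = 0 := by
    intro x
    rw [← lintegral_zero (μ := volume.restrict (Set.Ioi (0 : ℝ)))]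
    refine lintegral_congr_ae ?_
    have : ∀ᵐ t : ℝ ∂(volume.restrict (Set.Ioi 0)), t ≠ (finish (S x) x l).toReal := by
      refine ae_restrict_of_ae ?_
      rw [ae_iff]
      simp
    filter_upwards [this, ae_restrict_mem measurableSet_Ioi] with t ht ht0
    have : H x t = 0 := by
      simp only [H]
      rw [if_neg]
      rintro ⟨-, h2⟩
      exact ht (by rw [h2, ENNReal.toReal_ofReal (le_of_lt ht0)])
    simp [Set.indicator_apply, this]
  simp_rw [hzero] at hcomp
  rw [lintegral_zero, lintegral_eq_zero_iff] at hcomp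
  · filter_upwards [hcomp, ae_pos_infinitePi hμ] with x hx hpos _ htop heq
    have h1 : (finish (S x) x j).toReal = (S x j).toReal + x j := by
      rw [finish, ENNReal.toReal_add htop ENNReal.ofReal_ne_top,
        ENNReal.toReal_ofReal (hpos j).le]
    have h2 : ENNReal.ofReal (finish (S x) x j).toReal = finish (S x) x j :=
      ENNReal.ofReal_toReal (by simp [finish, htop])
    have h3 : S x l ≠ ⊤ := by
      intro h
      rw [finish, finish, h, top_add] at heq
      simp [htop] at heq
    have h4 := lt_finish hpos h3
    rw [Pi.zero_apply, Set.indicator_of_mem (by exact htop), ← h1] at hx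
    rw [heq] at h2
    simp only [H, heq, h2, h4, and_self, if_true, one_ne_zero] at hx
  · refine Measurable.indicator ?_
      (measurableSet_eq_fun (hS.measurable j) measurable_const).compl
    exact hHmeas.comp
      (measurable_id.prodMk ((hS.measurable j).ennreal_toReal.add (measurable_pi_apply j)))

end Adapted

/-! ### Levels

`E` and `A` are sets of requests, request `i` still needs `α i` chunks and is served by `δ i`
threads. -/

section Level

variable {α α' δ δ' : ℕ → ℕ} {E A E' A' : Finset ℕ}

/-- The chunks that the requests in `E ∪ Q` still need, plus the threads that serve requests
in `A \ Q`. -/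
def cost (α δ : ℕ → ℕ) (E A Q : Finset ℕ) : ℕ := ∑ i ∈ E, α i + ∑ i ∈ Q, α i + ∑ i ∈ A \ Q, δ i

/-- The minimal cost over all `q`-subsets of `A`. -/
noncomputable def level (α δ : ℕ → ℕ) (E A : Finset ℕ) (q : ℕ) : ℕ∞ :=
  (A.powersetCard q).inf fun Q => (cost α δ E A Q : ℕ∞)

/-- Bounds between levels are obtained by sending each competing set to one whose cost is smaller by
`c`. -/
lemma level_add_le {c q q' : ℕ}
    (h : ∀ Q ⊆ A, Q.card = q → ∃ Q' ⊆ A', Q'.card = q' ∧ cost α' δ' E' A' Q' + c ≤ cost α δ E A Q) :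
    level α' δ' E' A' q' + c ≤ level α δ E A q := by
  refine Finset.le_inf fun Q hQ => ?_
  rw [Finset.mem_powersetCard] at hQ
  obtain ⟨Q', hQ', hc, hle⟩ := h Q hQ.1 hQ.2
  have h1 : level α' δ' E' A' q' ≤ cost α' δ' E' A' Q' :=
    Finset.inf_le (f := fun Q => (cost α' δ' E' A' Q : ℕ∞)) (Finset.mem_powersetCard.2 ⟨hQ', hc⟩)
  calc level α' δ' E' A' q' + c ≤ (cost α' δ' E' A' Q' : ℕ∞) + c := by gcongr
    _ ≤ cost α δ E A Q := by exact_mod_cast hle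

lemma level_le {q q' : ℕ}
    (h : ∀ Q ⊆ A, Q.card = q → ∃ Q' ⊆ A', Q'.card = q' ∧ cost α' δ' E' A' Q' ≤ cost α δ E A Q) :
    level α' δ' E' A' q' ≤ level α δ E A q := by
  simpa using level_add_le (c := 0) (by simpa using h)

lemma level_le_add {c q q' : ℕ}
    (h : ∀ Q ⊆ A, Q.card = q → ∃ Q' ⊆ A', Q'.card = q' ∧ cost α' δ' E' A' Q' ≤ cost α δ E A Q + c) :
    level α' δ' E' A' q' ≤ level α δ E A q + c := by
  rcases (A.powersetCard q).eq_empty_or_nonempty with h0 | h0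
  · simp [level, h0]
  obtain ⟨Q, hQ, heq⟩ := Finset.exists_mem_eq_inf _ h0 fun Q => (cost α δ E A Q : ℕ∞)
  rw [Finset.mem_powersetCard] at hQ
  obtain ⟨Q', hQ', hc, hle⟩ := h Q hQ.1 hQ.2
  have h1 : level α' δ' E' A' q' ≤ cost α' δ' E' A' Q' :=
    Finset.inf_le (f := fun Q => (cost α' δ' E' A' Q : ℕ∞)) (Finset.mem_powersetCard.2 ⟨hQ', hc⟩)
  rw [level, level, heq] at *
  exact h1.trans (by exact_mod_cast hle)

lemma level_zero : level α δ E A 0 = (∑ i ∈ E, α i + ∑ i ∈ A, δ i : ℕ) := by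
  simp [level, cost]

/-- An optimal set can be chosen to contain a request with minimal `α - δ`. -/
lemma exists_cost_le_mem {w : ℕ} (hw : w ∈ A) (hmin : ∀ i ∈ A, α w + δ i ≤ α i + δ w)
    {Q : Finset ℕ} (hQ : Q ⊆ A) (h0 : 1 ≤ Q.card) :
    ∃ Q' ⊆ A, w ∈ Q' ∧ Q'.card = Q.card ∧ cost α δ E A Q' ≤ cost α δ E A Q := by
  by_cases hwQ : w ∈ Q
  · exact ⟨Q, hQ, hwQ, rfl, le_rfl⟩
  obtain ⟨i, hi⟩ := Finset.card_pos.1 h0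
  have hwQ' : w ∉ Q.erase i := fun h => hwQ (Finset.mem_of_mem_erase h)
  -- Exchanging any `i ∈ Q` for `w` changes the cost by `(α w - δ w) - (α i - δ i)`, which is not
  -- positive.
  refine ⟨insert w (Q.erase i), ?_, Finset.mem_insert_self _ _, ?_, ?_⟩
  · exact Finset.insert_subset hw ((Finset.erase_subset _ _).trans hQ)
  · rw [Finset.card_insert_of_notMem hwQ', Finset.card_erase_of_mem hi]
    omega
  · have h1 : A \ insert w (Q.erase i) = insert i ((A \ Q).erase w) := by
      ext l
      simp only [Finset.mem_sdiff, Finset.mem_insert, Finset.mem_erase]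
      constructor
      · rintro ⟨h1, h2⟩
        by_cases h3 : l = i
        · exact Or.inl h3
        · exact Or.inr ⟨fun h => h2 (Or.inl h), h1, fun h => h2 (Or.inr ⟨h3, h⟩)⟩
      · rintro (rfl | ⟨h1, h2, h3⟩)
        · exact ⟨hQ hi, by rintro (rfl | h) <;> simp_all⟩
        · exact ⟨h2, by rintro (rfl | h) <;> simp_all⟩
    have h2 : i ∉ (A \ Q).erase w := by simp [hi]
    have h3 := Finset.add_sum_erase Q α hi
    have h4 := Finset.add_sum_erase (A \ Q) δ (Finset.mem_sdiff.2 ⟨hw, hwQ⟩)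
    have h5 := hmin i (hQ hi)
    rw [cost, cost, h1, Finset.sum_insert hwQ', Finset.sum_insert h2]
    omega

/-- A thread is assigned to a request with minimal `α - δ`, which stays available. -/
lemma level_assign_stay {w : ℕ} (hw : w ∈ A) (hmin : ∀ i ∈ A, α w + δ i ≤ α i + δ w)
    (hδ : ∀ i, i ≠ w → δ' i = δ i) {q : ℕ} (hq : 1 ≤ q) :
    level α δ' E A q ≤ level α δ E A q := by
  refine level_le fun Q hQ hc => ?_
  -- Once `w` lies in the set, `δ w` does not enter the cost. For `q = 0` there is no such set, and
  -- the level may indeed rise.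
  obtain ⟨Q', hQ', hwQ', hc', hle⟩ := exists_cost_le_mem (E := E) hw hmin hQ (by omega)
  refine ⟨Q', hQ', by omega, le_trans (le_of_eq ?_) hle⟩
  rw [cost, cost]
  congr 1
  refine Finset.sum_congr rfl fun i hi => hδ i ?_
  rintro rfl
  exact (Finset.mem_sdiff.1 hi).2 hwQ'

/-- A request with minimal `α - δ` moves from `A` to `E`. -/
lemma level_move {w c : ℕ} (hw : w ∈ A) (hwE : w ∉ E)
    (hmin : ∀ i ∈ A, α w + δ i ≤ α i + δ w) (hδ : ∀ i, i ≠ w → δ' i = δ i)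
    (hα : ∀ i, i ≠ w → α' i = α i) (hc : α' w + c ≤ α w) (q : ℕ) :
    level α' δ' (insert w E) (A.erase w) q + c ≤ level α δ E A (q + 1) := by
  refine level_add_le fun Q hQ hcard => ?_
  obtain ⟨Q', hQ', hwQ', hc', hle⟩ := exists_cost_le_mem (E := E) hw hmin hQ (by omega)
  refine ⟨Q'.erase w, Finset.erase_subset_erase _ hQ', ?_, le_trans ?_ hle⟩
  · rw [Finset.card_erase_of_mem hwQ']
    omega
  · have h1 : A.erase w \ Q'.erase w = A \ Q' := by
      ext l
      simp only [Finset.mem_sdiff, Finset.mem_erase]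
      constructor
      · rintro ⟨⟨h1, h2⟩, h3⟩
        exact ⟨h2, fun h => h3 ⟨h1, h⟩⟩
      · rintro ⟨h1, h2⟩
        exact ⟨⟨fun h => h2 (h ▸ hwQ'), h1⟩, fun h => h2 h.2⟩
    have h2 : ∑ i ∈ A \ Q', δ' i = ∑ i ∈ A \ Q', δ i :=
      Finset.sum_congr rfl fun i hi => hδ i fun h => (Finset.mem_sdiff.1 hi).2 (h ▸ hwQ')
    have h3 : ∑ i ∈ Q'.erase w, α' i = ∑ i ∈ Q'.erase w, α i :=
      Finset.sum_congr rfl fun i hi => hα i (Finset.ne_of_mem_erase hi)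
    have h4 : ∑ i ∈ E, α' i = ∑ i ∈ E, α i :=
      Finset.sum_congr rfl fun i hi => hα i fun h => hwE (h ▸ hi)
    have h5 := Finset.add_sum_erase Q' α hwQ'
    rw [cost, cost, h1, h2, Finset.sum_insert hwE, h3, h4]
    omega

/-- A chunk of a request in `E` has been downloaded. -/
lemma level_download_left {i : ℕ} (hi : i ∈ E) (hiA : i ∉ A) (hα : ∀ l, l ≠ i → α' l = α l)
    (hδ : ∀ l, l ≠ i → δ' l = δ l) (hc : α' i + 1 ≤ α i) (q : ℕ) :
    level α' δ' E A q + 1 ≤ level α δ E A q := by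
  refine level_add_le (c := 1) fun Q hQ hcard => ⟨Q, hQ, hcard, ?_⟩
  have h1 : ∑ l ∈ A \ Q, δ' l = ∑ l ∈ A \ Q, δ l :=
    Finset.sum_congr rfl fun l hl => hδ l fun h => hiA (h ▸ (Finset.mem_sdiff.1 hl).1)
  have h2 : ∑ l ∈ Q, α' l = ∑ l ∈ Q, α l :=
    Finset.sum_congr rfl fun l hl => hα l fun h => hiA (h ▸ hQ hl)
  have h3 : ∑ l ∈ E.erase i, α' l = ∑ l ∈ E.erase i, α l :=
    Finset.sum_congr rfl fun l hl => hα l (Finset.ne_of_mem_erase hl)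
  have h4 := Finset.add_sum_erase E α hi
  have h5 := Finset.add_sum_erase E α' hi
  rw [cost, cost, h1, h2]
  omega

/-- A chunk of a request in `A` has been downloaded. -/
lemma level_download_right {i : ℕ} (hi : i ∈ A) (hiE : i ∉ E) (hα : ∀ l, l ≠ i → α' l = α l)
    (hδ : ∀ l, l ≠ i → δ' l = δ l) (hc : α' i + 1 ≤ α i) (hc' : δ' i + 1 ≤ δ i) (q : ℕ) :
    level α' δ' E A q + 1 ≤ level α δ E A q := by
  refine level_add_le (c := 1) fun Q hQ hcard => ⟨Q, hQ, hcard, ?_⟩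
  have h1 : ∑ l ∈ E, α' l = ∑ l ∈ E, α l :=
    Finset.sum_congr rfl fun l hl => hα l fun h => hiE (h ▸ hl)
  by_cases hiQ : i ∈ Q
  · have h2 : ∑ l ∈ A \ Q, δ' l = ∑ l ∈ A \ Q, δ l :=
      Finset.sum_congr rfl fun l hl => hδ l fun h => (Finset.mem_sdiff.1 hl).2 (h ▸ hiQ)
    have h3 : ∑ l ∈ Q.erase i, α' l = ∑ l ∈ Q.erase i, α l :=
      Finset.sum_congr rfl fun l hl => hα l (Finset.ne_of_mem_erase hl)
    have h4 := Finset.add_sum_erase Q α hiQ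
    have h5 := Finset.add_sum_erase Q α' hiQ
    rw [cost, cost, h1, h2]
    omega
  · have h2 : ∑ l ∈ Q, α' l = ∑ l ∈ Q, α l :=
      Finset.sum_congr rfl fun l hl => hα l fun h => hiQ (h ▸ hl)
    have h3 : ∑ l ∈ (A \ Q).erase i, δ' l = ∑ l ∈ (A \ Q).erase i, δ l :=
      Finset.sum_congr rfl fun l hl => hδ l (Finset.ne_of_mem_erase hl)
    have h4 := Finset.add_sum_erase (A \ Q) δ (Finset.mem_sdiff.2 ⟨hi, hiQ⟩)
    have h5 := Finset.add_sum_erase (A \ Q) δ' (Finset.mem_sdiff.2 ⟨hi, hiQ⟩)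
    rw [cost, cost, h1, h2]
    omega

/-- A request `l` arrives. -/
lemma level_arrival {l : ℕ} (hl : δ l = 0) (q : ℕ) :
    level α δ E (insert l A) q ≤ level α δ E A q := by
  refine level_le fun Q hQ hcard => ⟨Q, hQ.trans (Finset.subset_insert _ _), hcard, ?_⟩
  rw [cost, cost]
  gcongr 1
  by_cases h : l ∈ A \ Q
  · rw [Finset.insert_eq_self.2 (Finset.mem_sdiff.1 h).1]
  · by_cases h1 : l ∈ Q
    · rw [Finset.insert_sdiff_of_mem _ h1]
    · rw [Finset.insert_sdiff_of_notMem _ h1, Finset.sum_insert h, hl, zero_add]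

lemma level_arrival_succ {l : ℕ} (hlA : l ∉ A) (q : ℕ) :
    level α δ E (insert l A) (q + 1) ≤ level α δ E A q + α l := by
  refine level_le_add fun Q hQ hcard => ⟨insert l Q, Finset.insert_subset_insert _ hQ, ?_, ?_⟩
  · rw [Finset.card_insert_of_notMem fun h => hlA (hQ h), hcard]
  · have h1 : insert l A \ insert l Q = A \ Q := by
      ext m
      simp only [Finset.mem_sdiff, Finset.mem_insert]
      constructor
      · tauto
      · rintro ⟨h1, h2⟩
        refine ⟨Or.inr h1, ?_⟩
        rintro (rfl | h)
        · exact hlA h1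
        · exact h2 h
    rw [cost, cost, h1, Finset.sum_insert fun h => hlA (hQ h)]
    omega

end Level

/-! ### Profiles -/

/-- The profile of a request sequence with levels `y` when there are `e` requests that have as
many threads as they need. -/
def profile (L e : ℕ) (y : ℕ → ℕ∞) (p : ℕ) : ℕ∞ := if p ≤ e then 0 else y (p - e) - L

section Profile

variable {L e : ℕ} {y y' : ℕ → ℕ∞}

lemma le_sub_of_add_one_le {a b : ℕ∞} (h : a + 1 ≤ b) : a ≤ b - 1 :=
  ENat.le_sub_of_add_le_right (by simp) h

/-- Only `q ≥ 1` is required, since the level at `0` is hidden behind the value `0` at `p = e`; an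
assignment may raise that level. -/
lemma profile_mono (h : ∀ q, 1 ≤ q → y' q ≤ y q) (p : ℕ) :
    profile L e y' p ≤ profile L e y p := by
  unfold profile
  split_ifs with hp
  · exact le_rfl
  · exact tsub_le_tsub_right (h _ (by omega)) _

lemma profile_sub_one (h : ∀ q, 1 ≤ q → y' q + 1 ≤ y q) (p : ℕ) :
    profile L e y' p ≤ profile L e y p - 1 := by
  unfold profile
  split_ifs with hp
  · exact zero_le
  · rw [tsub_right_comm]
    exact tsub_le_tsub_right (le_sub_of_add_one_le (h _ (by omega))) _

/-- The shift of the levels and the increase of `e` compensate each other, so each `p` keeps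
referring to a group of the same size. -/
lemma profile_move (h : ∀ q, y' q ≤ y (q + 1)) (p : ℕ) :
    profile L (e + 1) y' p ≤ profile L e y p := by
  unfold profile
  split_ifs with hp hp' hp'
  · exact le_rfl
  · exact zero_le
  · omega
  · have := h (p - (e + 1))
    rw [show p - (e + 1) + 1 = p - e by omega] at this
    exact tsub_le_tsub_right this _

lemma profile_move_sub_one (h : ∀ q, y' q + 1 ≤ y (q + 1)) (p : ℕ) :
    profile L (e + 1) y' p ≤ profile L e y p - 1 := by
  unfold profile
  split_ifs with hp hp' hp'
  · exact zero_le
  · exact zero_le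
  · omega
  · have := h (p - (e + 1))
    rw [show p - (e + 1) + 1 = p - e by omega] at this
    rw [tsub_right_comm]
    exact tsub_le_tsub_right (le_sub_of_add_one_le this) _

end Profile

/-- The effect on a profile of the arrival of a request that needs `k` chunks. -/
noncomputable def arrive (k : ℕ) (S : ℕ → ℕ∞) : ℕ → ℕ∞
  | 0 => S 0
  | p + 1 => min (S (p + 1)) (S p + k)

lemma arrive_mono (k : ℕ) : Monotone (arrive k) := by
  intro S S' h p
  cases p with
  | zero => exact h 0
  | succ p => exact min_le_min (h _) (add_le_add_left (h _) _)

/-- The delicate position is `p = e + 1`, where the old profile at `e` was set to `0`. There `y 0 ≤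
L` ensures that after subtracting `L` at most `k` remains. -/
lemma profile_arrive {L e k : ℕ} {y y' : ℕ → ℕ∞} (h0 : y 0 ≤ L) (h : ∀ q, y' q ≤ y q)
    (h' : ∀ q, y' (q + 1) ≤ y q + k) : profile L e y' ≤ arrive k (profile L e y) := by
  intro p
  cases p with
  | zero => simp [profile, arrive]
  | succ p =>
    refine le_min (profile_mono (fun q _ => h q) _) ?_
    unfold profile
    split_ifs with hp hp' hp'
    · exact zero_le
    · omega
    · obtain rfl : p = e := by omega
      rw [zero_add, tsub_le_iff_right]
      have := h' 0
      simp only [Nat.add_sub_cancel_left, zero_add] at this ⊢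
      refine this.trans ?_
      rw [add_comm]
      gcongr
    · have := h' (p - e)
      rw [show p - e + 1 = p + 1 - e by omega] at this
      rw [tsub_le_iff_right]
      refine this.trans ?_
      rw [add_right_comm]
      gcongr
      exact le_tsub_add

/-! ### The potential -/

section Potential

/-- A bound for the mean time until a group of requests is completed when it still needs `m`
chunks (in units of the mean downloading time). -/
noncomputable def harm (d L m : ℕ) : ℝ := ∑ j ∈ Finset.range m, 1 / (min L (j + d) : ℝ)

/-- Divided by `μ` this is the additive error of the theorem. The summand `1` pays for the terms of
`harm` that are equal to `1 / L`. -/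
noncomputable def bound (d L : ℕ) : ℝ := 1 + ∑ l ∈ Finset.Ico d L, 1 / (l : ℝ)

/-- The contribution of the level `y` to the potential. -/
noncomputable def ups (d L : ℕ) (y : ℕ∞) : ℝ := if y ≤ L then harm d L y.toNat - bound d L else 0

variable {d L : ℕ}

lemma harm_nonneg (m : ℕ) : 0 ≤ harm d L m :=
  Finset.sum_nonneg fun j _ => by positivity

lemma harm_mono : Monotone (harm d L) := by
  refine monotone_nat_of_le_succ fun m => ?_
  rw [harm, harm, Finset.sum_range_succ]
  have : 0 ≤ 1 / (min L (m + d) : ℝ) := by positivity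
  linarith

/-- The terms with `j + d < L` are reciprocals `1 / l` of distinct `l` with `d ≤ l < L`; the others
number at most `L` and equal `1 / L`. -/
lemma harm_le_bound (hd : 1 ≤ d) : harm d L L ≤ bound d L := by
  have key : ∀ m ≤ L, harm d L m ≤ ∑ l ∈ Finset.Ico d (min L (m + d)), 1 / (l : ℝ) + m / L := by
    intro m
    induction m with
    | zero => simp [harm]
    | succ m ih =>
      intro hm
      have ih' := ih (by omega)
      have hL : (0 : ℝ) < L := by exact_mod_cast (by omega : 0 < L)
      have hstep : harm d L (m + 1) = harm d L m + 1 / (min L (m + d) : ℝ) :=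
        Finset.sum_range_succ _ _
      have hdiv : ((m + 1 : ℕ) : ℝ) / L = m / L + 1 / L := by
        push_cast
        ring
      have hpos : (0 : ℝ) ≤ 1 / L := by positivity
      rw [hstep, hdiv]
      rcases le_or_gt L (m + d) with h | h
      · rw [min_eq_left (by exact_mod_cast h)]
        rw [min_eq_left (by omega)] at ih' ⊢
        linarith
      · rw [min_eq_right (by exact_mod_cast h.le)]
        rw [min_eq_right h.le] at ih'
        rw [min_eq_right (by omega), show m + 1 + d = m + d + 1 by omega,
          Finset.sum_Ico_succ_top (by omega)]
        push_cast
        linarith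
  have h := key L le_rfl
  rw [min_eq_left (by omega)] at h
  have : (L : ℝ) / L ≤ 1 := div_self_le_one _
  rw [bound]
  linarith

/-- Up to `L` this is the monotonicity of `harm`; across the threshold it is `harm_le_bound`. The
normalisation by `bound` makes large and infinite levels contribute `0`, so that new requests bring
no potential with them. -/
lemma ups_mono (hd : 1 ≤ d) : Monotone (ups d L) := by
  intro y y' h
  unfold ups
  split_ifs with h1 h2 h2
  · have : y.toNat ≤ y'.toNat := ENat.toNat_le_toNat h (ne_top_of_le_ne_top (by simp) h2)
    have := harm_mono (d := d) (L := L) this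
    linarith
  · have : y.toNat ≤ L := by
      have := ENat.toNat_le_toNat h1 (by simp)
      simpa using this
    have := harm_mono (d := d) (L := L) this
    have := harm_le_bound (L := L) hd
    linarith
  · exact absurd (h.trans h2) h1
  · exact le_rfl

lemma ups_nonpos (hd : 1 ≤ d) (y : ℕ∞) : ups d L y ≤ 0 := by
  have := ups_mono (L := L) hd (le_top : y ≤ ⊤)
  simpa [ups] using this

lemma bound_nonneg : 0 ≤ bound d L := by
  have : 0 ≤ ∑ l ∈ Finset.Ico d L, 1 / (l : ℝ) := Finset.sum_nonneg fun j _ => by positivity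
  rw [bound]
  linarith

lemma neg_bound_le_ups (y : ℕ∞) : -bound d L ≤ ups d L y := by
  unfold ups
  have h1 := bound_nonneg (d := d) (L := L)
  have h2 := harm_nonneg (d := d) (L := L) y.toNat
  split_ifs <;> linarith

lemma ups_drop {m : ℕ} (hm : m + 1 ≤ L) :
    ups d L m + 1 / (min L (m + d) : ℝ) = ups d L (m + 1 : ℕ) := by
  have h1 : ((m : ℕ) : ℕ∞) ≤ L := by exact_mod_cast (by omega : m ≤ L)
  have h2 : ((m + 1 : ℕ) : ℕ∞) ≤ L := by exact_mod_cast hm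
  rw [ups, ups, if_pos h1, if_pos h2, ENat.toNat_natCast, ENat.toNat_natCast, harm, harm,
    Finset.sum_range_succ]
  ring

/-- Each term of `harm` is at least `1 / L`, so every level at most `L` pays this amount per
download; nothing is asked of the levels above `L`. -/
lemma ups_drop_le (hd : 1 ≤ d) {y y' : ℕ∞} (h : y' + 1 ≤ y) :
    ups d L y' + (if y ≤ L then 1 / (L : ℝ) else 0) ≤ ups d L y := by
  split_ifs with hy
  · obtain ⟨m, rfl⟩ : ∃ m : ℕ, y = m := ⟨y.toNat, (ENat.natCast_toNat (ne_top_of_le_ne_top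
      (by simp) hy)).symm⟩
    obtain ⟨m', rfl⟩ : ∃ m : ℕ, y' = m := ⟨y'.toNat, (ENat.natCast_toNat (ne_top_of_le_ne_top
      (by simp) (le_self_add.trans h))).symm⟩
    have h1 : m' + 1 ≤ m := by exact_mod_cast h
    have h2 : m ≤ L := by exact_mod_cast hy
    have h3 : ups d L m' ≤ ups d L (m - 1 : ℕ) := ups_mono hd (by exact_mod_cast (by omega))
    have h4 := ups_drop (d := d) (L := L) (m := m - 1) (by omega)
    rw [show m - 1 + 1 = m by omega] at h4
    have h5 : 1 / (L : ℝ) ≤ 1 / (min L ((m - 1 : ℕ) + d) : ℝ) := by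
      apply one_div_le_one_div_of_le
      · have : (0 : ℝ) < L := by exact_mod_cast (by omega : 0 < L)
        have : (0 : ℝ) < d := by exact_mod_cast hd
        positivity
      · exact min_le_left _ _
    linarith
  · rw [add_zero]
    exact ups_mono hd (le_self_add.trans h)

/-- The potential of the levels `y`, where the requests `i` in `E` need `α i` chunks. -/
noncomputable def potential (d L N : ℕ) (α : ℕ → ℕ) (E : Finset ℕ) (y : ℕ → ℕ∞) : ℝ :=
  ∑ i ∈ E, ups d L (α i) + ∑ q ∈ Finset.range N, ups d L (y (q + 1))

lemma potential_mono (hd : 1 ≤ d) {N : ℕ} {α α' : ℕ → ℕ} {E : Finset ℕ} {y y' : ℕ → ℕ∞}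
    (hα : ∀ i ∈ E, α' i ≤ α i) (hy : ∀ q, 1 ≤ q → y' q ≤ y q) :
    potential d L N α' E y' ≤ potential d L N α E y := by
  unfold potential
  gcongr with i hi q hq
  · exact ups_mono hd (by exact_mod_cast hα i hi)
  · exact ups_mono hd (hy _ (by omega))

lemma sum_indicator_level {N : ℕ} (y : ℕ → ℕ∞) :
    ∑ q ∈ Finset.range N, (if y (q + 1) ≤ L then 1 / (L : ℝ) else 0) =
      ((Finset.range N).filter fun q => y (q + 1) ≤ L).card / (L : ℝ) := by
  rw [← Finset.sum_filter, Finset.sum_const, nsmul_eq_mul]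
  ring

lemma potential_drop (hd : 1 ≤ d) {N : ℕ} {α α' : ℕ → ℕ} {E : Finset ℕ} {y y' : ℕ → ℕ∞}
    (hy : ∀ q, 1 ≤ q → y' q + 1 ≤ y q) :
    potential d L N α' E y' + ((Finset.range N).filter fun q => y (q + 1) ≤ L).card / (L : ℝ) +
      ∑ i ∈ E, (ups d L (α i) - ups d L (α' i)) ≤ potential d L N α E y := by
  unfold potential
  rw [← sum_indicator_level, Finset.sum_sub_distrib]
  have : ∑ q ∈ Finset.range N, ups d L (y' (q + 1)) +
      ∑ q ∈ Finset.range N, (if y (q + 1) ≤ L then 1 / (L : ℝ) else 0) ≤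
      ∑ q ∈ Finset.range N, ups d L (y (q + 1)) := by
    rw [← Finset.sum_add_distrib]
    exact Finset.sum_le_sum fun q _ => ups_drop_le hd (hy _ (by omega))
  linarith

/-- The moved request takes over the contribution of the first level, and the other levels shift by
one index. The term with index `N + 1` that enters is nonpositive. -/
lemma potential_move (hd : 1 ≤ d) {N w : ℕ} {α α' : ℕ → ℕ} {E : Finset ℕ} {y y' : ℕ → ℕ∞}
    (hwE : w ∉ E) (hα : ∀ i ∈ E, α' i = α i) (hw : α' w ≤ y 1)
    (hy : ∀ q, 1 ≤ q → y' q ≤ y (q + 1)) :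
    potential d L N α' (insert w E) y' ≤ potential d L N α E y := by
  unfold potential
  rw [Finset.sum_insert hwE, Finset.sum_congr rfl fun i hi => by rw [hα i hi]]
  have h1 : ups d L (α' w) ≤ ups d L (y 1) := ups_mono hd hw
  have h2 : ∑ q ∈ Finset.range N, ups d L (y' (q + 1)) ≤
      ∑ q ∈ Finset.range N, ups d L (y (q + 1 + 1)) :=
    Finset.sum_le_sum fun q _ => ups_mono hd (hy _ (by omega))
  have h3 : ∑ q ∈ Finset.range N, ups d L (y (q + 1 + 1)) + ups d L (y (0 + 1)) =
      ∑ q ∈ Finset.range N, ups d L (y (q + 1)) + ups d L (y (N + 1)) := by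
    rw [← Finset.sum_range_succ' (fun q => ups d L (y (q + 1))), Finset.sum_range_succ]
  have h4 := ups_nonpos (L := L) hd (y (N + 1))
  rw [zero_add] at h3
  linarith

lemma potential_move_drop (hd : 1 ≤ d) {N w : ℕ} {α α' : ℕ → ℕ} {E : Finset ℕ} {y y' : ℕ → ℕ∞}
    (hwE : w ∉ E) (hα : ∀ i ∈ E, α' i = α i) (hw : (α' w : ℕ∞) + 1 ≤ y 1)
    (hy : ∀ q, 1 ≤ q → y' q + 1 ≤ y (q + 1)) :
    potential d L N α' (insert w E) y' +
      ((Finset.range N).filter fun q => y (q + 1) ≤ L).card / (L : ℝ) ≤ potential d L N α E y := by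
  unfold potential
  rw [Finset.sum_insert hwE, Finset.sum_congr rfl fun i hi => by rw [hα i hi],
    ← sum_indicator_level]
  have h1 := ups_drop_le (L := L) hd hw
  have h2 : ∑ q ∈ Finset.range N, ups d L (y' (q + 1)) +
      ∑ q ∈ Finset.range N, (if y (q + 1 + 1) ≤ L then 1 / (L : ℝ) else 0) ≤
      ∑ q ∈ Finset.range N, ups d L (y (q + 1 + 1)) := by
    rw [← Finset.sum_add_distrib]
    exact Finset.sum_le_sum fun q _ => ups_drop_le hd (hy _ (by omega))
  have h3 : ∑ q ∈ Finset.range N, ups d L (y (q + 1 + 1)) + ups d L (y (0 + 1)) =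
      ∑ q ∈ Finset.range N, ups d L (y (q + 1)) + ups d L (y (N + 1)) := by
    rw [← Finset.sum_range_succ' (fun q => ups d L (y (q + 1))), Finset.sum_range_succ]
  have h5 : ∑ q ∈ Finset.range N, (if y (q + 1 + 1) ≤ L then 1 / (L : ℝ) else 0) +
      (if y (0 + 1) ≤ L then 1 / (L : ℝ) else 0) =
      ∑ q ∈ Finset.range N, (if y (q + 1) ≤ L then 1 / (L : ℝ) else 0) +
      (if y (N + 1) ≤ L then 1 / (L : ℝ) else 0) := by
    rw [← Finset.sum_range_succ' (fun q => if y (q + 1) ≤ L then 1 / (L : ℝ) else 0),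
      Finset.sum_range_succ]
  have h4 := ups_nonpos (L := L) hd (y (N + 1))
  have h6 : 0 ≤ (if y (N + 1) ≤ L then 1 / (L : ℝ) else 0) := by
    split_ifs <;> positivity
  rw [zero_add] at h3 h5
  linarith

end Potential

/-! ### States

`R` is the set of the requests that have arrived, `D` and `V` are the sets of the chunks that
have been downloaded and that are under service. -/

/-- The unfinished requests with a chunk that is neither downloaded nor under service. -/
def avail (r : Requests) (R : Finset ℕ) (D V : Finset Chunk) : Finset ℕ :=
  R.filter fun i => cnt D i < r.k i ∧ cnt D i + cnt V i < r.n i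

/-- The finished requests and those without a chunk that could be started. -/
def exh (r : Requests) (R : Finset ℕ) (D V : Finset Chunk) : Finset ℕ :=
  R.filter fun i => ¬ (cnt D i < r.k i ∧ cnt D i + cnt V i < r.n i)

/-- The number of chunks that request `i` still needs. -/
def rem (r : Requests) (D : Finset Chunk) (i : ℕ) : ℕ := r.k i - cnt D i

noncomputable def lev (r : Requests) (R : Finset ℕ) (D V : Finset Chunk) : ℕ → ℕ∞ :=
  level (rem r D) (cnt V) (exh r R D V) (avail r R D V)

/-- Subtracting `L` absorbs the needs of the exhausted requests and the threads on the requests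
outside the chosen group, which together never exceed `L`. -/
noncomputable def prof (L : ℕ) (r : Requests) (R : Finset ℕ) (D V : Finset Chunk) : ℕ → ℕ∞ :=
  profile L (exh r R D V).card (lev r R D V)

noncomputable def pot (d L N : ℕ) (r : Requests) (R : Finset ℕ) (D V : Finset Chunk) : ℝ :=
  potential d L N (rem r D) (exh r R D V) (lev r R D V)

/-- A lower bound for the loss of potential when chunk `j` is downloaded. -/
noncomputable def loss (L N : ℕ) (r : Requests) (R : Finset ℕ) (D V : Finset Chunk) (j : Chunk) :
    ℝ :=
  (if j.1 ∈ exh r R D V then 1 / (cnt V j.1 : ℝ) else 0) +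
    ((Finset.range N).filter fun q => lev r R D V (q + 1) ≤ L).card / (L : ℝ)

/-- Properties of the states that SEDPT-R leads to. -/
structure Inv (L : ℕ) (r : Requests) (R : Finset ℕ) (D V : Finset Chunk) : Prop where
  params : ∀ i ∈ R, 1 ≤ r.k i ∧ r.k i ≤ r.n i
  mem : ∀ j ∈ V, j.1 ∈ R
  card_le : ∀ i ∈ R, cnt D i + cnt V i ≤ r.n i
  finished : ∀ i ∈ R, r.k i ≤ cnt D i → cnt V i = 0
  busy : V.card ≤ L
  -- At most one available request has as many threads as it needs: it has the smallest `α - δ` and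
  -- receives all further threads until it is exhausted or finished.
  uniq : ∀ i ∈ avail r R D V, rem r D i ≤ cnt V i → ∀ i' ∈ avail r R D V, i' ≠ i →
    cnt V i' < rem r D i'

/-! ### Effect of assignments, downloads and arrivals on profile and potential -/

section Transitions

variable {d L N : ℕ} {r : Requests} {R : Finset ℕ} {D V D' V' : Finset Chunk}

lemma mem_avail {i : ℕ} : i ∈ avail r R D V ↔
    i ∈ R ∧ cnt D i < r.k i ∧ cnt D i + cnt V i < r.n i := Finset.mem_filter

lemma mem_exh {i : ℕ} : i ∈ exh r R D V ↔
    i ∈ R ∧ ¬ (cnt D i < r.k i ∧ cnt D i + cnt V i < r.n i) := Finset.mem_filter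

lemma Inv.cnt_le (h : Inv L r R D V) (i : ℕ) : cnt V i ≤ L :=
  (Finset.card_filter_le _ _).trans h.busy

lemma Inv.cnt_of_exh (h : Inv L r R D V) {i : ℕ} (hi : i ∈ exh r R D V) (hk : cnt D i < r.k i) :
    cnt D i + cnt V i = r.n i := by
  obtain ⟨h1, h2⟩ := mem_exh.1 hi
  have := h.card_le i h1
  omega

/-- An unfinished exhausted request has all its `n - cnt D` missing chunks under service and needs
only `k - cnt D` of them. -/
lemma Inv.rem_le_of_exh (h : Inv L r R D V) {i : ℕ} (hi : i ∈ exh r R D V) :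
    rem r D i ≤ cnt V i := by
  obtain ⟨h1, h2⟩ := mem_exh.1 hi
  have := h.card_le i h1
  have := h.params i h1
  rw [rem]
  omega

lemma sum_exh_add_sum_avail (f : ℕ → ℕ) :
    ∑ i ∈ exh r R D V, f i + ∑ i ∈ avail r R D V, f i = ∑ i ∈ R, f i := by
  rw [add_comm]
  exact Finset.sum_filter_add_sum_filter_not R _ f

/-- The needs of the exhausted requests are covered by their own threads, so this level is at most
the number of busy threads. -/
lemma Inv.lev_zero_le (h : Inv L r R D V) : lev r R D V 0 ≤ L := by
  rw [lev, level_zero]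
  have h1 : ∑ i ∈ exh r R D V, rem r D i ≤ ∑ i ∈ exh r R D V, cnt V i :=
    Finset.sum_le_sum fun i hi => h.rem_le_of_exh hi
  have h2 := sum_exh_add_sum_avail (r := r) (R := R) (D := D) (V := V) (cnt V)
  rw [sum_cnt h.mem] at h2
  have := h.busy
  exact_mod_cast (by omega)

lemma inv_empty : Inv L r ∅ ∅ ∅ := by
  constructor <;> simp [avail]

/-- An idle thread is assigned to chunk `j`. -/
lemma Inv.assign (hd : 1 ≤ d) (h : Inv L r R D V) {j : Chunk} (hjV : j ∉ V)
    (hw : j.1 ∈ avail r R D V) (hlt : V.card < L)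
    (hmin : ∀ i ∈ avail r R D V, rem r D j.1 + cnt V i ≤ rem r D i + cnt V j.1) :
    Inv L r R D (insert j V) ∧ prof L r R D (insert j V) ≤ prof L r R D V ∧
      pot d L N r R D (insert j V) ≤ pot d L N r R D V := by
  obtain ⟨w, c⟩ := j
  simp only at hw hmin
  have hcnt : ∀ i, cnt (insert (w, c) V) i = cnt V i + if w = i then 1 else 0 :=
    fun i => cnt_insert hjV i
  have hw' := mem_avail.1 hw
  have hne : ∀ i, i ≠ w → cnt (insert (w, c) V) i = cnt V i := fun i hi => by
    rw [hcnt, if_neg (Ne.symm hi), add_zero]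
  have hself : cnt (insert (w, c) V) w = cnt V w + 1 := by rw [hcnt, if_pos rfl]
  have hsub : ∀ i, i ∈ avail r R D (insert (w, c) V) → i ∈ avail r R D V := by
    intro i hi
    rw [mem_avail] at hi ⊢
    have : cnt V i ≤ cnt (insert (w, c) V) i := cnt_mono (Finset.subset_insert _ _) i
    exact ⟨hi.1, hi.2.1, by omega⟩
  have hwE : w ∉ exh r R D V := fun h => (mem_exh.1 h).2 hw'.2
  refine ⟨⟨h.params, ?_, ?_, ?_, ?_, ?_⟩, ?_⟩
  · intro j hj
    rcases Finset.mem_insert.1 hj with rfl | hj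
    · exact hw'.1
    · exact h.mem j hj
  · intro i hi
    have := h.card_le i hi
    by_cases hiw : i = w
    · subst hiw
      omega
    · rw [hne i hiw]
      exact this
  · intro i hi hk
    have := h.finished i hi hk
    by_cases hiw : i = w
    · subst hiw
      omega
    · rwa [hne i hiw]
  · rw [Finset.card_insert_of_notMem hjV]
    omega
  · intro i hi hle i' hi' hne'
    have hi0 := hsub i hi
    have hi0' := hsub i' hi'
    have h1 := hmin i hi0
    have h2 := hmin i' hi0'
    -- If the new thread brings `w` to `α = δ`, the smallest `α - δ` was `1` and all others are
    -- still short. If another request already had `α ≤ δ`, then `w` would not have been chosen.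
    by_cases hiw : i = w
    · subst hiw
      rw [hne i' hne']
      by_cases h3 : rem r D i ≤ cnt V i
      · exact h.uniq i hi0 h3 i' hi0' hne'
      · omega
    · rw [hne i hiw] at hle
      have h3 := h.uniq i hi0 hle w hw (Ne.symm hiw)
      omega
  -- Either `w` keeps a chunk that can be started, or its last one has been assigned and it moves to
  -- `exh`.
  · by_cases hstay : cnt D w + cnt V w + 1 < r.n w
    · have hA : avail r R D (insert (w, c) V) = avail r R D V := by
        refine Finset.Subset.antisymm (fun i hi => hsub i hi) fun i hi => ?_
        rw [mem_avail] at hi ⊢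
        by_cases hiw : i = w
        · subst hiw
          exact ⟨hi.1, hi.2.1, by omega⟩
        · rw [hne i hiw]
          exact hi
      have hE : exh r R D (insert (w, c) V) = exh r R D V := by
        ext i
        have : i ∈ avail r R D (insert (w, c) V) ↔ i ∈ avail r R D V := by rw [hA]
        rw [mem_avail, mem_avail] at this
        rw [mem_exh, mem_exh]
        tauto
      have hlev : ∀ q, 1 ≤ q → lev r R D (insert (w, c) V) q ≤ lev r R D V q := by
        intro q hq
        rw [lev, lev, hA, hE]
        exact level_assign_stay hw hmin hne hq
      refine ⟨fun p => ?_, ?_⟩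
      · rw [prof, prof, hE]
        exact profile_mono hlev p
      · rw [pot, pot, hE]
        exact potential_mono hd (fun _ _ => le_rfl) hlev
    · have hA : avail r R D (insert (w, c) V) = (avail r R D V).erase w := by
        ext i
        rw [Finset.mem_erase, mem_avail, mem_avail]
        by_cases hiw : i = w
        · subst hiw
          omega
        · rw [hne i hiw]
          tauto
      have hE : exh r R D (insert (w, c) V) = insert w (exh r R D V) := by
        ext i
        rw [Finset.mem_insert, mem_exh, mem_exh]
        by_cases hiw : i = w
        · subst hiw
          simp only [true_or, iff_true]
          exact ⟨hw'.1, by omega⟩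
        · rw [hne i hiw]
          tauto
      have hlev : ∀ q, lev r R D (insert (w, c) V) q ≤ lev r R D V (q + 1) := by
        intro q
        rw [lev, lev, hA, hE]
        have := level_move (α := rem r D) (α' := rem r D) (c := 0) hw hwE hmin hne
          (fun _ _ => rfl) (by omega) q
        simpa using this
      have hcard : (exh r R D (insert (w, c) V)).card = (exh r R D V).card + 1 := by
        rw [hE, Finset.card_insert_of_notMem hwE]
      refine ⟨fun p => ?_, ?_⟩
      · rw [prof, prof, hcard]
        exact profile_move hlev p
      · rw [pot, pot, hE]
        refine potential_move hd hwE (fun _ _ => rfl) ?_ fun q _ => hlev q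
        -- After the move `w` is one of the summands of the new level at `0`, which is bounded by
        -- the old level at `1`.
        refine le_trans ?_ (hlev 0)
        rw [lev, level_zero, hE, Finset.sum_insert hwE]
        exact_mod_cast (by omega)

/-- Chunk `j` is downloaded, and its request is completed if no further chunk is needed. -/
lemma Inv.download (hd : 1 ≤ d) (hdn : ∀ i ∈ R, d ≤ r.n i - r.k i + 1)
    (h : Inv L r R D V) {j : Chunk} (hjV : j ∈ V) (hjD : j ∉ D) (hsubV : V' ⊆ V)
    (hne : ∀ i, i ≠ j.1 → cnt V' i = cnt V i)
    (hself : cnt V' j.1 = if cnt D j.1 + 1 < r.k j.1 then cnt V j.1 - 1 else 0) :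
    Inv L r R (insert j D) V' ∧ (∀ p, prof L r R (insert j D) V' p ≤ prof L r R D V p - 1) ∧
      pot d L N r R (insert j D) V' + loss L N r R D V j ≤ pot d L N r R D V := by
  obtain ⟨w, c⟩ := j
  simp only at hself hne
  have hwR : w ∈ R := h.mem _ hjV
  have hV1 : 1 ≤ cnt V w := Finset.card_pos.2 ⟨(w, c), Finset.mem_filter.2 ⟨hjV, rfl⟩⟩
  have hk : cnt D w < r.k w := by
    by_contra hk
    have := h.finished w hwR (by omega)
    omega
  have hcnt : ∀ i, cnt (insert (w, c) D) i = cnt D i + if w = i then 1 else 0 :=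
    fun i => cnt_insert hjD i
  have hneD : ∀ i, i ≠ w → cnt (insert (w, c) D) i = cnt D i := fun i hi => by
    rw [hcnt, if_neg (Ne.symm hi), add_zero]
  have hselfD : cnt (insert (w, c) D) w = cnt D w + 1 := by rw [hcnt, if_pos rfl]
  have hremne : ∀ i, i ≠ w → rem r (insert (w, c) D) i = rem r D i := fun i hi => by
    rw [rem, rem, hneD i hi]
  have hremself : rem r (insert (w, c) D) w + 1 = rem r D w := by
    rw [rem, rem, hselfD]
    omega
  have hself1 : cnt D w + 1 < r.k w → cnt V' w + 1 = cnt V w := fun h1 => by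
    rw [hself, if_pos h1]
    omega
  have hself2 : ¬ cnt D w + 1 < r.k w → cnt V' w = 0 := fun h1 => by
    rw [hself, if_neg h1]
  have hsub : ∀ i, i ∈ avail r R (insert (w, c) D) V' → i ∈ avail r R D V := by
    intro i hi
    rw [mem_avail] at hi ⊢
    by_cases hiw : i = w
    · subst hiw
      refine ⟨hwR, hk, ?_⟩
      by_cases h1 : cnt D i + 1 < r.k i
      · have := hself1 h1
        omega
      · omega
    · rwa [hneD i hiw, hne i hiw] at hi
  have hcard := h.card_le w hwR
  have hparw := h.params w hwR
  refine ⟨⟨h.params, fun j hj => h.mem j (hsubV hj), ?_, ?_,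
    (Finset.card_le_card hsubV).trans h.busy, ?_⟩, ?_⟩
  · intro i hi
    have := h.card_le i hi
    by_cases hiw : i = w
    · subst hiw
      omega
    · rw [hne i hiw, hneD i hiw]
      exact this
  · intro i hi hk'
    by_cases hiw : i = w
    · subst hiw
      omega
    · rw [hne i hiw]
      rw [hneD i hiw] at hk'
      exact h.finished i hi hk'
  · intro i hi hle i' hi' hne'
    have hi0 := hsub i hi
    have hi0' := hsub i' hi'
    have e1 := mem_avail.1 hi
    have e2 := mem_avail.1 hi'
    by_cases hiw : i = w
    · subst hiw
      rw [hne i' hne', hremne i' hne']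
      refine h.uniq i hi0 ?_ i' hi0' hne'
      omega
    · rw [hne i hiw, hremne i hiw] at hle
      have h3 := h.uniq i hi0 hle i' hi0' hne'
      by_cases hiw' : i' = w
      · subst hiw'
        omega
      · rwa [hne i' hiw', hremne i' hiw']
  -- The split into `exh` and `avail` changes only if the download completes an available request.
  · by_cases hmove : w ∈ avail r R D V ∧ ¬ cnt D w + 1 < r.k w
    · obtain ⟨hwA, hlast⟩ := hmove
      have hwA' := mem_avail.1 hwA
      have hwE : w ∉ exh r R D V := fun h => (mem_exh.1 h).2 hwA'.2
      have hA : avail r R (insert (w, c) D) V' = (avail r R D V).erase w := by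
        ext i
        rw [Finset.mem_erase, mem_avail, mem_avail]
        by_cases hiw : i = w
        · subst hiw
          omega
        · rw [hne i hiw, hneD i hiw]
          tauto
      have hE : exh r R (insert (w, c) D) V' = insert w (exh r R D V) := by
        ext i
        rw [Finset.mem_insert, mem_exh, mem_exh]
        by_cases hiw : i = w
        · subst hiw
          simp only [true_or, iff_true]
          exact ⟨hwR, by omega⟩
        · rw [hne i hiw, hneD i hiw]
          tauto
      have hrem1 : rem r D w = 1 := by
        rw [rem]
        omega
      -- Here `α = 1 ≤ δ` for `w`, so by `uniq` every other available request has a larger `α - δ`,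
      -- and the exchange argument applies to `w`.
      have hmin : ∀ i ∈ avail r R D V, rem r D w + cnt V i ≤ rem r D i + cnt V w := by
        intro i hi
        by_cases hiw : i = w
        · rw [hiw]
        · have := h.uniq w hwA (by omega) i hi hiw
          omega
      have hlev : ∀ q, lev r R (insert (w, c) D) V' q + 1 ≤ lev r R D V (q + 1) := by
        intro q
        rw [lev, lev, hA, hE]
        exact level_move (c := 1) hwA hwE hmin hne hremne (by omega) q
      have hcard' : (exh r R (insert (w, c) D) V').card = (exh r R D V).card + 1 := by
        rw [hE, Finset.card_insert_of_notMem hwE]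
      refine ⟨fun p => ?_, ?_⟩
      · rw [prof, prof, hcard']
        exact profile_move_sub_one hlev p
      · rw [pot, pot, hE, loss, if_neg hwE, zero_add]
        refine potential_move_drop hd hwE (fun i hi => hremne i fun h => hwE (h ▸ hi)) ?_
          fun q _ => hlev q
        refine le_trans ?_ (hlev 0)
        rw [show rem r (insert (w, c) D) w = 0 by omega]
        simp
    · have hA : avail r R (insert (w, c) D) V' = avail r R D V := by
        refine Finset.Subset.antisymm (fun i hi => hsub i hi) fun i hi => ?_
        by_cases hiw : i = w
        · subst hiw
          rw [mem_avail]
          have h1 := mem_avail.1 hi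
          have h2 : cnt D i + 1 < r.k i := by
            by_contra h2
            exact hmove ⟨hi, h2⟩
          have := hself1 h2
          exact ⟨hwR, by omega⟩
        · rw [mem_avail] at hi ⊢
          rwa [hneD i hiw, hne i hiw]
      have hE : exh r R (insert (w, c) D) V' = exh r R D V := by
        ext i
        have : i ∈ avail r R (insert (w, c) D) V' ↔ i ∈ avail r R D V := by rw [hA]
        rw [mem_avail, mem_avail] at this
        rw [mem_exh, mem_exh]
        tauto
      have hlev : ∀ q, lev r R (insert (w, c) D) V' q + 1 ≤ lev r R D V q := by
        intro q
        rw [lev, lev, hA, hE]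
        by_cases hwA : w ∈ avail r R D V
        · have h2 : cnt D w + 1 < r.k w := by
            by_contra h2
            exact hmove ⟨hwA, h2⟩
          have hwE : w ∉ exh r R D V := fun h => (mem_exh.1 h).2 (mem_avail.1 hwA).2
          exact level_download_right hwA hwE hremne hne (by omega) (by
            have := hself1 h2
            omega) q
        · have hwE : w ∈ exh r R D V := by
            rw [mem_avail] at hwA
            rw [mem_exh]
            tauto
          exact level_download_left hwE hwA hremne hne (by omega) q
      refine ⟨fun p => ?_, ?_⟩
      · rw [prof, prof, hE]
        exact profile_sub_one (fun q _ => hlev q) p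
      · have hmain := potential_drop (L := L) hd (N := N) (α := rem r D)
          (α' := rem r (insert (w, c) D)) (E := exh r R D V) fun q _ => hlev q
        rw [pot, pot, hE]
        refine le_trans ?_ hmain
        rw [loss, add_assoc]
        gcongr 1
        rw [add_comm]
        gcongr 1
        have hterm : ∀ i ∈ exh r R D V, (0 : ℝ) ≤
            ups d L (rem r D i) - ups d L (rem r (insert (w, c) D) i) := by
          intro i hi
          rw [sub_nonneg]
          refine ups_mono hd ?_
          by_cases hiw : i = w
          · subst hiw
            exact_mod_cast (by omega)
          · rw [hremne i hiw]
        split_ifs with hwE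
        · refine le_trans ?_ (Finset.single_le_sum hterm hwE)
          have h1 : cnt D w + cnt V w = r.n w := h.cnt_of_exh hwE hk
          have h2 : rem r D w ≤ cnt V w := h.rem_le_of_exh hwE
          have h3 := h.cnt_le w
          have h4 := ups_drop (d := d) (L := L) (m := rem r (insert (w, c) D) w) (by omega)
          rw [hremself] at h4
          rw [← h4, add_sub_cancel_left]
          have h5 := hdn w hwR
          -- All missing chunks are under service, and they number `(α - 1) + (n - k + 1)`: this is
          -- where the minimum distance enters.
          have h6 : rem r (insert (w, c) D) w + d ≤ cnt V w := by
            have h7 : rem r (insert (w, c) D) w = r.k w - (cnt D w + 1) := by rw [rem, hselfD]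
            omega
          apply one_div_le_one_div_of_le
          · have : (0 : ℝ) < d := by exact_mod_cast hd
            have : (0 : ℝ) < L := by exact_mod_cast (by omega : 0 < L)
            positivity
          · exact (min_le_right _ _).trans (by exact_mod_cast h6)
        · exact Finset.sum_nonneg hterm

/-- Request `l` arrives. -/
lemma Inv.arrival (hd : 1 ≤ d) (h : Inv L r R D V) {l : ℕ} (hl : l ∉ R)
    (hD : cnt D l = 0) (hV : cnt V l = 0) (hk : 1 ≤ r.k l) (hn : r.k l ≤ r.n l) :
    Inv L r (insert l R) D V ∧ prof L r (insert l R) D V ≤ arrive (r.k l) (prof L r R D V) ∧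
      pot d L N r (insert l R) D V ≤ pot d L N r R D V := by
  have hA : avail r (insert l R) D V = insert l (avail r R D V) := by
    ext i
    rw [Finset.mem_insert, mem_avail, mem_avail, Finset.mem_insert]
    by_cases hil : i = l
    · subst hil
      simp only [true_or, true_and, iff_true]
      omega
    · simp [hil]
  have hE : exh r (insert l R) D V = exh r R D V := by
    ext i
    rw [mem_exh, mem_exh, Finset.mem_insert]
    by_cases hil : i = l
    · subst hil
      simp only [true_or, true_and, hl, false_and, iff_false]
      omega
    · simp [hil]
  have hlA : l ∉ avail r R D V := fun h => hl (mem_avail.1 h).1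
  have hrem : rem r D l = r.k l := by rw [rem, hD, Nat.sub_zero]
  have hlev : ∀ q, lev r (insert l R) D V q ≤ lev r R D V q := by
    intro q
    rw [lev, lev, hA, hE]
    exact level_arrival hV q
  have hlev' : ∀ q, lev r (insert l R) D V (q + 1) ≤ lev r R D V q + r.k l := by
    intro q
    rw [lev, lev, hA, hE, ← hrem]
    exact level_arrival_succ hlA q
  refine ⟨⟨?_, fun j hj => Finset.mem_insert_of_mem (h.mem j hj), ?_, ?_, h.busy, ?_⟩, ?_, ?_⟩
  · intro i hi
    rcases Finset.mem_insert.1 hi with rfl | hi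
    · exact ⟨hk, hn⟩
    · exact h.params i hi
  · intro i hi
    rcases Finset.mem_insert.1 hi with rfl | hi
    · omega
    · exact h.card_le i hi
  · intro i hi
    rcases Finset.mem_insert.1 hi with rfl | hi
    · exact fun _ => hV
    · exact h.finished i hi
  · rw [hA]
    intro i hi hle i' hi' hne
    rcases Finset.mem_insert.1 hi with rfl | hi
    · omega
    · rcases Finset.mem_insert.1 hi' with rfl | hi'
      · omega
      · exact h.uniq i hi hle i' hi' hne
  · rw [prof, prof, hE]
    exact profile_arrive h.lev_zero_le hlev hlev'
  · rw [pot, pot, hE]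
    exact potential_mono hd (fun _ _ => le_rfl) fun q _ => hlev q

/-- The mean rate at which potential is lost is at least the difference between the number of
zeros in the profile and the number of completed requests. -/
lemma Inv.card_zeros_le (h : Inv L r R D V) (hL : 1 ≤ L)
    (hbusy : avail r R D V = ∅ ∨ V.card = L) :
    (((Finset.range N).filter fun p => prof L r R D V (p + 1) = 0).card : ℝ) ≤
      (R.filter fun i => r.k i ≤ cnt D i).card + ∑ j ∈ V, loss L N r R D V j := by
  set Z := (Finset.range N).filter fun q => lev r R D V (q + 1) ≤ L with hZ
  have hLpos : (0 : ℝ) < L := by exact_mod_cast hL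
  -- A zero is either one of the first `exh.card` entries or stems from a level that is at most `L`.
  have h1 : ((Finset.range N).filter fun p => prof L r R D V (p + 1) = 0).card ≤
      (exh r R D V).card + Z.card := by
    have hsub : ((Finset.range N).filter fun p => prof L r R D V (p + 1) = 0) ⊆
        Finset.range (exh r R D V).card ∪ Z.image fun q => q + (exh r R D V).card := by
      intro p hp
      rw [Finset.mem_filter, Finset.mem_range] at hp
      rw [Finset.mem_union, Finset.mem_range, Finset.mem_image]
      rcases lt_or_ge p (exh r R D V).card with hlt | hge
      · exact Or.inl hlt
      · refine Or.inr ⟨p - (exh r R D V).card, ?_, by omega⟩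
        rw [hZ, Finset.mem_filter, Finset.mem_range]
        refine ⟨by omega, ?_⟩
        have := hp.2
        rw [prof, profile, if_neg (by omega), tsub_eq_zero_iff_le] at this
        rwa [show p - (exh r R D V).card + 1 = p + 1 - (exh r R D V).card by omega]
    refine (Finset.card_le_card hsub).trans ((Finset.card_union_le _ _).trans ?_)
    rw [Finset.card_range]
    exact Nat.add_le_add_left Finset.card_image_le _
  have h2 : (exh r R D V).card ≤ (R.filter fun i => r.k i ≤ cnt D i).card +
      ((exh r R D V).filter fun i => cnt D i < r.k i).card := by
    rw [← Finset.card_filter_add_card_filter_not (s := exh r R D V) fun i => r.k i ≤ cnt D i]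
    simp only [not_le]
    refine Nat.add_le_add_right (Finset.card_le_card ?_) _
    exact Finset.filter_subset_filter _ (Finset.filter_subset _ _)
  -- The threads of one unfinished exhausted request contribute `1 / cnt V i` each, hence `1`
  -- together; there is at least one of them since `cnt D i < k ≤ n`.
  have h3 : (((exh r R D V).filter fun i => cnt D i < r.k i).card : ℝ) ≤
      ∑ j ∈ V, (if j.1 ∈ exh r R D V then 1 / (cnt V j.1 : ℝ) else 0) := by
    have hfib := Finset.sum_fiberwise_of_maps_to h.mem
      (fun j => (if j.1 ∈ exh r R D V then 1 / (cnt V j.1 : ℝ) else 0))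
    rw [← hfib]
    have hfib' : ∀ i ∈ R, ∑ j ∈ V.filter (fun j => j.1 = i),
        (if j.1 ∈ exh r R D V then 1 / (cnt V j.1 : ℝ) else 0) =
        if i ∈ exh r R D V then (cnt V i : ℝ) * (1 / (cnt V i : ℝ)) else 0 := by
      intro i _
      rw [Finset.sum_congr rfl (g := fun _ =>
        if i ∈ exh r R D V then 1 / (cnt V i : ℝ) else 0)]
      · rw [Finset.sum_const, nsmul_eq_mul]
        split_ifs
        · rfl
        · simp
      · intro j hj
        rw [(Finset.mem_filter.1 hj).2]
    rw [Finset.sum_congr rfl hfib', ← Finset.sum_filter, Finset.card_eq_sum_ones, Nat.cast_sum]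
    refine le_trans (Finset.sum_le_sum fun i hi => ?_) (Finset.sum_le_sum_of_subset_of_nonneg ?_ ?_)
    · rw [Finset.mem_filter] at hi
      have e1 := h.cnt_of_exh hi.1 hi.2
      have e2 := h.params i (mem_exh.1 hi.1).1
      have : (cnt V i : ℝ) ≠ 0 := by exact_mod_cast (by omega)
      rw [mul_one_div_cancel this]
      simp
    · intro i hi
      rw [Finset.mem_filter] at hi ⊢
      exact ⟨(mem_exh.1 hi.1).1, hi.1⟩
    · intro i _ _
      positivity
  -- Every level in `Z` contributes `1 / L` per thread. If nothing is available the levels are `⊤`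
  -- and `Z` is empty; otherwise there are `L` busy threads.
  have h4 : (Z.card : ℝ) ≤ ∑ j ∈ V, (Z.card : ℝ) / L := by
    rw [Finset.sum_const, nsmul_eq_mul]
    rcases hbusy with h0 | h0
    · have : Z = ∅ := by
        rw [hZ, Finset.filter_eq_empty_iff]
        intro q _
        rw [lev, level, h0, Finset.powersetCard_eq_empty.2 (by simp)]
        simp
      simp [this]
    · rw [h0]
      exact le_of_eq (by field_simp)
  have h5 : (((Finset.range N).filter fun p => prof L r R D V (p + 1) = 0).card : ℝ) ≤
      (R.filter fun i => r.k i ≤ cnt D i).card +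
      ((exh r R D V).filter fun i => cnt D i < r.k i).card + Z.card := by
    exact_mod_cast (by omega)
  simp only [loss]
  rw [Finset.sum_add_distrib]
  linarith

end Transitions

/-! ### Profiles that are reduced at the times of a Poisson process -/

section Poisson

/-- The profile `S` after `n` reductions. -/
noncomputable def sh (n : ℕ) (S : ℕ → ℕ∞) : ℕ → ℕ∞ := fun p => S p - n

lemma sh_zero (S : ℕ → ℕ∞) : sh 0 S = S := by
  ext p
  simp [sh]

lemma sh_sh_one (n : ℕ) (S : ℕ → ℕ∞) : sh n (sh 1 S) = sh (n + 1) S := by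
  ext p
  simp only [sh, tsub_tsub]
  push_cast
  rw [add_comm]

lemma sh_mono (n : ℕ) : Monotone (sh n) := fun _ _ h p => tsub_le_tsub_right (h p) _

lemma sh_le (n : ℕ) (S : ℕ → ℕ∞) : sh n S ≤ S := fun _ => tsub_le_self

/-- The finite values of the profile `S` are at most `M`. -/
def FiniteBy (M : ℕ) (S : ℕ → ℕ∞) : Prop := ∀ p, S p ≤ M ∨ S p = ⊤

lemma FiniteBy.sh_one {M : ℕ} {S : ℕ → ℕ∞} (h : FiniteBy M S) : FiniteBy M (sh 1 S) := by
  intro p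
  rcases h p with h | h
  · exact Or.inl (tsub_le_self.trans h)
  · right
    simp [sh, h]

/-- After `M` reductions only the values `0` and `⊤` are left. This is why the Poisson mean can be
written as a finite sum. -/
lemma FiniteBy.sh_succ {M : ℕ} {S : ℕ → ℕ∞} (h : FiniteBy M S) : sh (M + 1) S = sh M S := by
  ext p
  rcases h p with h | h
  · rw [sh, sh, tsub_eq_zero_of_le h, tsub_eq_zero_of_le (h.trans (by simp))]
  · have : ((M + 1 : ℕ) : ℕ∞) ≠ ⊤ := ENat.natCast_ne_top _
    rw [sh, sh, h, ENat.top_sub_natCast, ENat.top_sub_natCast]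

/-- The Poisson weights with mean `y`. -/
noncomputable def pois (n : ℕ) (y : ℝ) : ℝ := Real.exp (-y) * (y ^ n / n.factorial)

lemma pois_nonneg (n : ℕ) {y : ℝ} (hy : 0 ≤ y) : 0 ≤ pois n y := by
  unfold pois
  positivity

lemma sum_pois_le_one (M : ℕ) {y : ℝ} (hy : 0 ≤ y) : ∑ n ∈ Finset.range M, pois n y ≤ 1 := by
  unfold pois
  rw [← Finset.mul_sum]
  calc _ ≤ Real.exp (-y) * Real.exp y := by
        gcongr
        exact Real.sum_le_exp_of_nonneg hy M
    _ = 1 := by rw [← Real.exp_add]; simp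

lemma hasDerivAt_pois_zero (y : ℝ) : HasDerivAt (pois 0) (-pois 0 y) y := by
  have : pois 0 = fun y => Real.exp (-y) := by
    ext y
    simp [pois]
  rw [this]
  simpa using (hasDerivAt_neg y).exp

lemma hasDerivAt_pois_succ (n : ℕ) (y : ℝ) :
    HasDerivAt (pois (n + 1)) (pois n y - pois (n + 1) y) y := by
  have h1 : HasDerivAt (fun y : ℝ => Real.exp (-y)) (-Real.exp (-y)) y := by
    simpa using (hasDerivAt_neg y).exp
  have h2 : HasDerivAt (fun y : ℝ => y ^ (n + 1) / ((n + 1).factorial : ℝ))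
      (y ^ n / (n.factorial : ℝ)) y := by
    refine ((hasDerivAt_pow (n + 1) y).div_const ((n + 1).factorial : ℝ)).congr_deriv ?_
    rw [Nat.factorial_succ]
    have : (n.factorial : ℝ) ≠ 0 := by positivity
    push_cast
    field_simp
  refine (h1.mul h2).congr_deriv ?_
  simp only [pois]
  ring

/-- Summation by parts in `pois (n + 1)' = pois n - pois (n + 1)`. The boundary term disappears in
the application, where `g (M + 1) = 0`. -/
lemma hasDerivAt_sum_pois (g : ℕ → ℝ) (M : ℕ) (y : ℝ) :
    HasDerivAt (fun y => ∑ n ∈ Finset.range (M + 1), pois n y * g n)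
      (∑ n ∈ Finset.range (M + 1), pois n y * (g (n + 1) - g n) - pois M y * g (M + 1)) y := by
  induction M with
  | zero =>
    simp only [zero_add, Finset.range_one, Finset.sum_singleton]
    refine ((hasDerivAt_pois_zero y).mul_const (g 0)).congr_deriv ?_
    ring
  | succ M ih =>
    simp_rw [Finset.sum_range_succ _ (M + 1)]
    refine (ih.add ((hasDerivAt_pois_succ M y).mul_const (g (M + 1)))).congr_deriv ?_
    ring

/-- The mean value of `f` when a Poisson number, of mean `y`, of reductions is applied to `S`
(reductions beyond the `M`th do not matter). -/
noncomputable def poisMean (f : (ℕ → ℕ∞) → ℝ) (M : ℕ) (y : ℝ) (S : ℕ → ℕ∞) : ℝ :=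
  f (sh (M + 1) S) + ∑ n ∈ Finset.range (M + 1), pois n y * (f (sh n S) - f (sh (M + 1) S))

variable {f : (ℕ → ℕ∞) → ℝ} {M : ℕ} {S S' : ℕ → ℕ∞}

lemma poisMean_eq (y : ℝ) : poisMean f M y S = (1 - ∑ n ∈ Finset.range (M + 1), pois n y) *
    f (sh (M + 1) S) + ∑ n ∈ Finset.range (M + 1), pois n y * f (sh n S) := by
  simp_rw [poisMean, mul_sub, Finset.sum_sub_distrib, ← Finset.sum_mul]
  ring

lemma poisMean_zero : poisMean f M 0 S = f S := by
  rw [poisMean, Finset.sum_range_succ', Finset.sum_eq_zero]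
  · simp [pois, sh_zero]
  · intro n _
    simp [pois]

lemma poisMean_mono (hf : Monotone f) {y : ℝ} (hy : 0 ≤ y) : Monotone (poisMean f M y) := by
  intro S S' h
  rw [poisMean_eq, poisMean_eq]
  have h1 := sum_pois_le_one (M + 1) hy
  gcongr with n _
  · exact hf (sh_mono _ h)
  · exact pois_nonneg n hy
  · exact hf (sh_mono _ h)

lemma poisMean_nonneg (hf : ∀ S, 0 ≤ f S) {y : ℝ} (hy : 0 ≤ y) : 0 ≤ poisMean f M y S := by
  rw [poisMean_eq]
  have h1 := sum_pois_le_one (M + 1) hy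
  refine add_nonneg (mul_nonneg (by linarith) (hf _)) (Finset.sum_nonneg fun n _ =>
    mul_nonneg (pois_nonneg n hy) (hf _))

lemma poisMean_le {B : ℝ} (hf : ∀ S, f S ≤ B) {y : ℝ} (hy : 0 ≤ y) : poisMean f M y S ≤ B := by
  rw [poisMean_eq]
  have h1 := sum_pois_le_one (M + 1) hy
  calc _ ≤ (1 - ∑ n ∈ Finset.range (M + 1), pois n y) * B +
        ∑ n ∈ Finset.range (M + 1), pois n y * B := by
        gcongr with n _
        · exact hf _
        · exact pois_nonneg n hy
        · exact hf _
    _ = B := by rw [← Finset.sum_mul]; ring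

/-- The Kolmogorov equation of the Poisson reductions. `FiniteBy` ensures that `S` and `sh 1 S` have
the same terminal profile. -/
lemma hasDerivAt_poisMean (h : FiniteBy M S) (y : ℝ) :
    HasDerivAt (fun y => poisMean f M y S) (poisMean f M y (sh 1 S) - poisMean f M y S) y := by
  have h1 := (hasDerivAt_sum_pois (fun n => f (sh n S) - f (sh (M + 1) S)) M y).const_add
    (f (sh (M + 1) S))
  refine h1.congr_deriv ?_
  have h2 : sh (M + 1) (sh 1 S) = sh (M + 1) S := by
    rw [h.sh_one.sh_succ, sh_sh_one]
  simp only [poisMean, sub_self, mul_zero, sub_zero, h2, sh_sh_one, add_sub_add_left_eq_sub]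
  rw [← Finset.sum_sub_distrib]
  exact Finset.sum_congr rfl fun n _ => by ring

lemma continuous_poisMean : Continuous fun y => poisMean f M y S := by
  unfold poisMean pois
  fun_prop

/-- The loss of `poisMean` by one reduction. -/
noncomputable def poisLoss (f : (ℕ → ℕ∞) → ℝ) (M : ℕ) (y : ℝ) (S : ℕ → ℕ∞) : ℝ :=
  poisMean f M y S - poisMean f M y (sh 1 S)

lemma poisLoss_nonneg (hf : Monotone f) {y : ℝ} (hy : 0 ≤ y) : 0 ≤ poisLoss f M y S :=
  sub_nonneg.2 (poisMean_mono hf hy (sh_le 1 S))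

lemma continuous_poisLoss : Continuous fun y => poisLoss f M y S :=
  continuous_poisMean.sub continuous_poisMean

lemma poisMean_sub_eq_integral (h : FiniteBy M S) (lam T a b : ℝ) :
    poisMean f M (lam * (T - b)) S - poisMean f M (lam * (T - a)) S =
      ∫ t in a..b, lam * poisLoss f M (lam * (T - t)) S := by
  have hd : ∀ t : ℝ, HasDerivAt (fun t => poisMean f M (lam * (T - t)) S)
      (lam * poisLoss f M (lam * (T - t)) S) t := by
    intro t
    have h1 : HasDerivAt (fun t : ℝ => lam * (T - t)) (-lam) t := by
      simpa using ((hasDerivAt_id t).const_sub T).const_mul lam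
    have h2 := (hasDerivAt_poisMean (f := f) h (lam * (T - t))).comp t h1
    refine h2.congr_deriv ?_
    rw [poisLoss]
    ring
  rw [intervalIntegral.integral_eq_sub_of_hasDerivAt (fun t _ => hd t)]
  refine Continuous.intervalIntegrable ?_ _ _
  exact continuous_const.mul (continuous_poisLoss.comp (by fun_prop))

end Poisson

/-! ### Functions of time with finitely many jumps -/

/-- Here `v` is the left limit and `v'` the right limit of a function whose derivative is `g`,
except at the times in `E`. -/
lemma sub_eq_integral_add_sum_jumps {E : Finset ℝ} {t₀ : ℝ} (h0 : t₀ ∈ E) {v v' g : ℝ → ℝ}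
    (hg : ∀ a b, IntervalIntegrable g volume a b) (T : ℝ) (hT : t₀ ≤ T)
    (hstep : ∀ τ t, t₀ ≤ τ → τ < t → t ≤ T → (∀ e ∈ E, ¬ (τ < e ∧ e < t)) →
      v t - v' τ = ∫ u in τ..t, g u) :
    v T - v t₀ = (∫ u in t₀..T, g u) +
      ∑ e ∈ E.filter (fun e => t₀ ≤ e ∧ e < T), (v' e - v e) := by
  generalize hn : (E.filter (fun e => t₀ ≤ e ∧ e < T)).card = n
  induction n using Nat.strong_induction_on generalizing T with
  | _ n ih =>
    rcases hT.eq_or_lt with rfl | hlt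
    · rw [Finset.filter_false_of_mem]
      · simp
      · intro e _ h
        linarith [h.1, h.2]
    set F := E.filter (fun e => t₀ ≤ e ∧ e < T) with hF
    have hne : F.Nonempty := ⟨t₀, Finset.mem_filter.2 ⟨h0, le_rfl, hlt⟩⟩
    -- The induction splits at the last jump before `T`, which exists because `t₀` itself counts as
    -- one.
    set m := F.max' hne with hm
    have hmF := F.max'_mem hne
    rw [← hm] at hmF
    have hmF' := Finset.mem_filter.1 hmF
    have hFm : E.filter (fun e => t₀ ≤ e ∧ e < m) = F.erase m := by
      ext e
      simp only [Finset.mem_filter, Finset.mem_erase, hF]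
      constructor
      · rintro ⟨h1, h2, h3⟩
        exact ⟨h3.ne, h1, h2, h3.trans hmF'.2.2⟩
      · rintro ⟨h1, h2, h3, h4⟩
        refine ⟨h2, h3, lt_of_le_of_ne (F.le_max' e ?_) h1⟩
        exact Finset.mem_filter.2 ⟨h2, h3, h4⟩
    have hcard : (E.filter (fun e => t₀ ≤ e ∧ e < m)).card < n := by
      rw [hFm, ← hn]
      exact Finset.card_erase_lt_of_mem hmF
    have h1 := ih _ hcard m hmF'.2.1 (fun τ t h1 h2 h3 => hstep τ t h1 h2 (h3.trans hmF'.2.2.le))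
      rfl
    have h2 := hstep m T hmF'.2.1 hmF'.2.2 le_rfl (by
      rintro e he ⟨h3, h4⟩
      exact absurd (F.le_max' e (Finset.mem_filter.2 ⟨he, hmF'.2.1.trans h3.le, h4⟩))
        (not_le.2 h3))
    rw [hFm] at h1
    have h3 := Finset.add_sum_erase F (fun e => v' e - v e) hmF
    have h4 := intervalIntegral.integral_add_adjacent_intervals (hg t₀ m) (hg m T)
    linarith

/-- Induction along the jumps: `P` is the property just before, `P'` just after a time. -/
lemma induction_jumps {E : Finset ℝ} {t₀ : ℝ} {P P' : ℝ → Prop} (h0 : P t₀)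
    (T : ℝ) (hT : t₀ ≤ T) (hjump : ∀ t, t₀ ≤ t → t ≤ T → P t → P' t)
    (hstep : ∀ τ t, t₀ ≤ τ → τ < t → t ≤ T → (∀ e ∈ E, ¬ (τ < e ∧ e < t)) → P' τ → P t) :
    P T := by
  generalize hn : (E.filter (fun e => t₀ < e ∧ e < T)).card = n
  induction n using Nat.strong_induction_on generalizing T with
  | _ n ih =>
    rcases hT.eq_or_lt with rfl | hlt
    · exact h0
    set F := E.filter (fun e => t₀ < e ∧ e < T) with hF
    by_cases hne : F.Nonempty
    · set m := F.max' hne with hm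
      have hmF := F.max'_mem hne
      rw [← hm] at hmF
      have hmF' := Finset.mem_filter.1 hmF
      have hsub : E.filter (fun e => t₀ < e ∧ e < m) ⊂ F := by
        refine Finset.ssubset_iff_subset_ne.2 ⟨fun e he => ?_, fun h => ?_⟩
        · rw [Finset.mem_filter] at he
          exact Finset.mem_filter.2 ⟨he.1, he.2.1, he.2.2.trans hmF'.2.2⟩
        · rw [← h, Finset.mem_filter] at hmF
          exact lt_irrefl _ hmF.2.2
      have h1 := ih _ (hn ▸ Finset.card_lt_card hsub) m hmF'.2.1.le
        (fun t h1 h2 => hjump t h1 (h2.trans hmF'.2.2.le))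
        (fun τ t h1 h2 h3 => hstep τ t h1 h2 (h3.trans hmF'.2.2.le)) rfl
      refine hstep m T hmF'.2.1.le hmF'.2.2 le_rfl ?_
        (hjump m hmF'.2.1.le hmF'.2.2.le h1)
      rintro e he ⟨h3, h4⟩
      exact absurd (F.le_max' e (Finset.mem_filter.2 ⟨he, hmF'.2.1.trans h3, h4⟩)) (not_le.2 h3)
    · refine hstep t₀ T le_rfl hlt le_rfl ?_ (hjump t₀ le_rfl hlt.le h0)
      rintro e he ⟨h3, h4⟩
      exact hne ⟨e, Finset.mem_filter.2 ⟨he, h3, h4⟩⟩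

/-! ### How the state changes with time -/

section Paths

variable {L N : ℕ} {r : Requests} {s : Chunk → ℝ≥0∞} {x : Chunk → ℝ} {t τ : ℝ≥0∞} {j : Chunk}

lemma mem_servedAt_iff (hr : r.Valid N) :
    j ∈ servedAt r N s x t ↔ (j ∈ chunks r N ∧ s j ≤ t) ∧ j ∉ doneBy r N s x t ∧
      cnt (doneBy r N s x t) j.1 < r.k j.1 := by
  classical
  by_cases hj : j ∈ chunks r N
  · rw [cnt_doneBy_lt_iff hr (mem_chunks.1 hj).1]
    simp only [servedAt, doneBy, Finset.mem_filter, hj, true_and, not_and, not_le]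
    constructor
    · rintro ⟨h1, h2, h3⟩
      exact ⟨h1, fun h => absurd h (not_le.2 h2), h3⟩
    · rintro ⟨h1, h2, h3⟩
      refine ⟨h1, ?_, h3⟩
      by_contra! h
      exact absurd (h2 h) (not_lt.2 (h.trans h3.le))
  · simp [servedAt, hj]

lemma doneBefore_subset_doneBy : doneBefore r N s x t ⊆ doneBy r N s x t := by
  classical
  intro j hj
  rw [doneBefore, Finset.mem_filter] at hj
  rw [doneBy, Finset.mem_filter]
  exact ⟨hj.1, hj.2.1.le, hj.2.2⟩

lemma servedPre_eq_filter (hr : r.Valid N) :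
    servedPre r N s x t = (servedBefore r N s x t).filter fun l =>
      l ∉ doneBy r N s x t ∧ cnt (doneBy r N s x t) l.1 < r.k l.1 := by
  ext l
  rw [Finset.mem_filter, mem_servedPre_iff hr, mem_servedBefore_iff hr]
  constructor
  · rintro ⟨h1, h2, h3⟩
    exact ⟨⟨h1, fun h => h2 (doneBefore_subset_doneBy h),
      (cnt_mono doneBefore_subset_doneBy _).trans_lt h3⟩, h2, h3⟩
  · rintro ⟨⟨h1, -⟩, h2, h3⟩
    exact ⟨h1, h2, h3⟩

/-! Between two events the state does not change. -/

lemma doneBefore_eq_doneBy (h : τ < t)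
    (hno : ∀ j ∈ chunks r N, ¬ (τ < finish s x j ∧ finish s x j < t)) :
    doneBefore r N s x t = doneBy r N s x τ := by
  classical
  unfold doneBefore doneBy
  refine Finset.filter_congr fun j hj => and_congr_left fun _ => ⟨fun h1 => ?_, fun h1 => ?_⟩
  · by_contra! h2
    exact hno j hj ⟨h2, h1⟩
  · exact h1.trans_lt h

lemma servedBefore_eq_servedAt (hr : r.Valid N) (h : τ < t)
    (hno : ∀ j ∈ chunks r N, ¬ (τ < finish s x j ∧ finish s x j < t))
    (hno' : ∀ j ∈ chunks r N, ¬ (τ < s j ∧ s j < t)) :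
    servedBefore r N s x t = servedAt r N s x τ := by
  classical
  ext j
  rw [mem_servedBefore_iff hr, mem_servedAt_iff hr, doneBefore_eq_doneBy h hno]
  refine and_congr_left fun _ => ?_
  rw [startedBefore, Finset.mem_filter]
  refine and_congr_right fun hj => ⟨fun h1 => ?_, fun h1 => h1.trans_lt h⟩
  by_contra! h2
  exact hno' j hj ⟨h2, h1⟩

/-! At the time of a download. -/

lemma doneBy_eq_insert (hties : ∀ j l, j ≠ l → s j ≠ ⊤ → finish s x j ≠ finish s x l)
    (hj : j ∈ everDone r N s x) :
    doneBy r N s x (finish s x j) = insert j (doneBefore r N s x (finish s x j)) := by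
  classical
  obtain ⟨h1, h2, h3⟩ := mem_everDone.1 hj
  ext l
  rw [Finset.mem_insert, doneBy, doneBefore, Finset.mem_filter, Finset.mem_filter]
  constructor
  · rintro ⟨h4, h5, h6⟩
    by_cases hlj : l = j
    · exact Or.inl hlj
    · exact Or.inr ⟨h4, lt_of_le_of_ne h5 (hties j l (Ne.symm hlj) h2).symm, h6⟩
  · rintro (rfl | ⟨h4, h5, h6⟩)
    · exact ⟨h1, le_rfl, h3⟩
    · exact ⟨h4, h5.le, h6⟩

lemma notMem_doneBefore_finish : j ∉ doneBefore r N s x (finish s x j) := by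
  classical
  rw [doneBefore, Finset.mem_filter]
  exact fun h => lt_irrefl _ h.2.1

lemma mem_servedBefore_finish (hx : ∀ j, 0 < x j) (hj : j ∈ everDone r N s x) :
    j ∈ servedBefore r N s x (finish s x j) := by
  classical
  obtain ⟨h1, h2, h3⟩ := mem_everDone.1 hj
  rw [servedBefore, Finset.mem_filter]
  exact ⟨h1, lt_finish hx h2, le_rfl, h3⟩

lemma doneBy_eq_doneBefore (ht : t ≠ ⊤) (h : ∀ j ∈ everDone r N s x, finish s x j ≠ t) :
    doneBy r N s x t = doneBefore r N s x t := by
  classical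
  refine Finset.Subset.antisymm (fun j hj => ?_) doneBefore_subset_doneBy
  rw [doneBy, Finset.mem_filter] at hj
  rw [doneBefore, Finset.mem_filter]
  refine ⟨hj.1, lt_of_le_of_ne hj.2.1 (h j (mem_everDone.2 ⟨hj.1, ?_, hj.2.2⟩)), hj.2.2⟩
  exact ne_top_of_le_ne_top ht ((le_finish j).trans hj.2.1)

lemma servedPre_eq_servedBefore (hr : r.Valid N) (ht : t ≠ ⊤)
    (h : ∀ j ∈ everDone r N s x, finish s x j ≠ t) :
    servedPre r N s x t = servedBefore r N s x t := by
  rw [servedPre_eq_filter hr, doneBy_eq_doneBefore ht h]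
  refine Finset.filter_true_of_mem fun l hl => ?_
  exact ((mem_servedBefore_iff hr).1 hl).2

lemma cnt_servedPre_ne (hr : r.Valid N)
    (hD : doneBy r N s x t = insert j (doneBefore r N s x t)) (hjD : j ∉ doneBefore r N s x t)
    {i : ℕ} (hi : i ≠ j.1) : cnt (servedPre r N s x t) i = cnt (servedBefore r N s x t) i := by
  unfold cnt
  congr 1
  ext l
  rw [Finset.mem_filter, Finset.mem_filter, servedPre_eq_filter hr, Finset.mem_filter]
  constructor
  · rintro ⟨⟨h1, -⟩, h2⟩
    exact ⟨h1, h2⟩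
  · rintro ⟨h1, h2⟩
    have h3 := (mem_servedBefore_iff hr).1 h1
    refine ⟨⟨h1, ?_, ?_⟩, h2⟩
    · rw [hD, Finset.mem_insert]
      rintro (rfl | h)
      · exact hi h2.symm
      · exact h3.2.1 h
    · rw [hD, cnt_insert hjD, if_neg (by rw [h2]; exact Ne.symm hi)]
      exact h3.2.2

lemma cnt_servedPre_self (hr : r.Valid N)
    (hD : doneBy r N s x t = insert j (doneBefore r N s x t)) (hjD : j ∉ doneBefore r N s x t)
    (hjV : j ∈ servedBefore r N s x t) : cnt (servedPre r N s x t) j.1 =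
      if cnt (doneBefore r N s x t) j.1 + 1 < r.k j.1 then
        cnt (servedBefore r N s x t) j.1 - 1 else 0 := by
  have hc : cnt (doneBy r N s x t) j.1 = cnt (doneBefore r N s x t) j.1 + 1 := by
    rw [hD, cnt_insert hjD, if_pos rfl]
  split_ifs with hlt
  · unfold cnt
    have hm : j ∈ (servedBefore r N s x t).filter (fun l => l.1 = j.1) :=
      Finset.mem_filter.2 ⟨hjV, rfl⟩
    rw [← Finset.card_erase_of_mem hm]
    congr 1
    ext l
    rw [Finset.mem_erase, Finset.mem_filter, Finset.mem_filter, servedPre_eq_filter hr,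
      Finset.mem_filter]
    constructor
    · rintro ⟨⟨h1, h2, h3⟩, h4⟩
      refine ⟨?_, h1, h4⟩
      rintro rfl
      rw [hD] at h2
      exact h2 (Finset.mem_insert_self _ _)
    · rintro ⟨h1, h2, h3⟩
      refine ⟨⟨h2, ?_, ?_⟩, h3⟩
      · rw [hD, Finset.mem_insert]
        rintro (h | h)
        · exact h1 h
        · exact ((mem_servedBefore_iff hr).1 h2).2.1 h
      · rw [h3, hc]
        exact hlt
  · unfold cnt
    rw [Finset.card_eq_zero, Finset.filter_eq_empty_iff]
    intro l hl h1
    rw [servedPre_eq_filter hr, Finset.mem_filter, h1, hc] at hl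
    exact hlt hl.2.2

/-! The events. -/

/-- The times at which requests arrive or downloads begin or end. -/
noncomputable def events (r : Requests) (N : ℕ) (s : Chunk → ℝ≥0∞) (x : Chunk → ℝ) : Finset ℝ :=
  (chunks r N).image (fun j => (s j).toReal) ∪ (chunks r N).image (fun j => (finish s x j).toReal) ∪
    (Finset.range N).image fun i => (r.a i : ℝ)

/-- A start or finish at `⊤` is turned into the event `0` by `toReal`. This spurious event does no
harm, since `⊤` is never below `ENNReal.ofReal b`. -/
lemma no_event_of_image {y : ℝ≥0∞} {a b : ℝ} (h : ¬ (a < y.toReal ∧ y.toReal < b)) :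
    ¬ (ENNReal.ofReal a < y ∧ y < ENNReal.ofReal b) := by
  rintro ⟨h1, h2⟩
  have htop : y ≠ ⊤ := ne_top_of_lt h2
  rw [← ENNReal.ofReal_toReal htop] at h1 h2
  have hb : 0 < b := by
    by_contra! hb
    rw [ENNReal.ofReal_of_nonpos hb] at h2
    exact not_lt_zero h2
  refine h ⟨?_, ?_⟩
  · by_contra! h3
    exact absurd h1 (not_lt.2 (ENNReal.ofReal_le_ofReal h3))
  · exact (ENNReal.ofReal_lt_ofReal_iff hb).1 h2

lemma no_event {a b : ℝ} (h : ∀ e ∈ events r N s x, ¬ (a < e ∧ e < b)) :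
    (∀ j ∈ chunks r N, ¬ (ENNReal.ofReal a < finish s x j ∧ finish s x j < ENNReal.ofReal b)) ∧
    (∀ j ∈ chunks r N, ¬ (ENNReal.ofReal a < s j ∧ s j < ENNReal.ofReal b)) ∧
    ∀ i < N, ¬ (a < (r.a i : ℝ) ∧ (r.a i : ℝ) < b) := by
  refine ⟨fun j hj => no_event_of_image (h _ ?_), fun j hj => no_event_of_image (h _ ?_),
    fun i hi => h _ ?_⟩
  · exact Finset.mem_union_left _ (Finset.mem_union_right _ (Finset.mem_image_of_mem _ hj))
  · exact Finset.mem_union_left _ (Finset.mem_union_left _ (Finset.mem_image_of_mem _ hj))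
  · exact Finset.mem_union_right _ (Finset.mem_image.2 ⟨i, Finset.mem_range.2 hi, rfl⟩)

lemma exists_no_event (E : Finset ℝ) {b : ℝ} (hb : 0 < b) :
    ∃ a, 0 ≤ a ∧ a < b ∧ ∀ e ∈ E, ¬ (a < e ∧ e < b) := by
  have hne : (insert 0 (E.filter fun e => 0 ≤ e ∧ e < b)).Nonempty := Finset.insert_nonempty _ _
  set F := insert 0 (E.filter fun e => 0 ≤ e ∧ e < b) with hF
  have hm := F.max'_mem hne
  have h0 : 0 ≤ F.max' hne := F.le_max' 0 (Finset.mem_insert_self _ _)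
  refine ⟨F.max' hne, h0, ?_, ?_⟩
  · rcases Finset.mem_insert.1 hm with h | h
    · rwa [h]
    · exact (Finset.mem_filter.1 h).2.2
  · rintro e he ⟨h1, h2⟩
    exact absurd (F.le_max' e (Finset.mem_insert_of_mem (Finset.mem_filter.2
      ⟨he, h0.trans h1.le, h2⟩))) (not_le.2 h1)

lemma ofReal_lt_ofReal {a b : ℝ} (ha : 0 ≤ a) (h : a < b) : ENNReal.ofReal a < ENNReal.ofReal b :=
  (ENNReal.ofReal_lt_ofReal_iff (ha.trans_lt h)).2 h

lemma state_eq_of_no_event (hr : r.Valid N) {a b : ℝ} (ha : 0 ≤ a) (hab : a < b)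
    (h : ∀ e ∈ events r N s x, ¬ (a < e ∧ e < b)) :
    doneBefore r N s x (ENNReal.ofReal b) = doneBy r N s x (ENNReal.ofReal a) ∧
      servedBefore r N s x (ENNReal.ofReal b) = servedAt r N s x (ENNReal.ofReal a) := by
  obtain ⟨h1, h2, -⟩ := no_event h
  exact ⟨doneBefore_eq_doneBy (ofReal_lt_ofReal ha hab) h1,
    servedBefore_eq_servedAt hr (ofReal_lt_ofReal ha hab) h1 h2⟩

/-- The state just before `b` is the state after the decisions of some earlier time without events
in between, where feasibility bounds the threads. -/
lemma Feasible.card_servedBefore_le (hr : r.Valid N) (h : Feasible L r N x s) {b : ℝ} (hb : 0 < b) :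
    (servedBefore r N s x (ENNReal.ofReal b)).card ≤ L := by
  obtain ⟨a, ha, hab, hno⟩ := exists_no_event (events r N s x) hb
  rw [(state_eq_of_no_event hr ha hab hno).2]
  exact h.card_servedAt_le a.toNNReal

/-- The requests that arrive before time `t`. -/
noncomputable def arrivedBefore (r : Requests) (N : ℕ) (t : ℝ) : Finset ℕ :=
  (Finset.range N).filter fun i => (r.a i : ℝ) < t

/-- The requests that arrive by time `t`. -/
noncomputable def arrivedBy (r : Requests) (N : ℕ) (t : ℝ) : Finset ℕ :=
  (Finset.range N).filter fun i => (r.a i : ℝ) ≤ t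

lemma mem_arrivedBefore {i : ℕ} {t : ℝ} : i ∈ arrivedBefore r N t ↔ i < N ∧ (r.a i : ℝ) < t := by
  simp [arrivedBefore]

lemma mem_arrivedBy {i : ℕ} {t : ℝ} : i ∈ arrivedBy r N t ↔ i < N ∧ (r.a i : ℝ) ≤ t := by
  simp [arrivedBy]

lemma arrivedBefore_eq_of_no_event {a b : ℝ} (hab : a < b)
    (h : ∀ e ∈ events r N s x, ¬ (a < e ∧ e < b)) : arrivedBefore r N b = arrivedBy r N a := by
  obtain ⟨-, -, h3⟩ := no_event h
  unfold arrivedBefore arrivedBy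
  refine Finset.filter_congr fun i hi => ⟨fun h1 => ?_, fun h1 => h1.trans_lt hab⟩
  by_contra! h2
  exact h3 i (Finset.mem_range.1 hi) ⟨h2, h1⟩

lemma Feasible.arrival_lt (h : Feasible L r N x s) {t : ℝ} (hj : s j < ENNReal.ofReal t) :
    (r.a j.1 : ℝ) < t := by
  have h1 := (h.start j (ne_top_of_lt hj)).2.2.1.trans_lt hj
  rwa [← ENNReal.ofReal_coe_nnreal, ENNReal.ofReal_lt_ofReal_iff_of_nonneg (by positivity)] at h1

lemma cnt_eq_zero_iff {D : Finset Chunk} {i : ℕ} : cnt D i = 0 ↔ ∀ j ∈ D, j.1 ≠ i := by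
  rw [cnt, Finset.card_eq_zero, Finset.filter_eq_empty_iff]

lemma Feasible.cnt_before_eq_zero (h : Feasible L r N x s) {t : ℝ} {i : ℕ}
    (hi : t ≤ (r.a i : ℝ)) : cnt (doneBefore r N s x (ENNReal.ofReal t)) i = 0 ∧
      cnt (servedBefore r N s x (ENNReal.ofReal t)) i = 0 := by
  classical
  constructor
  · refine cnt_eq_zero_iff.2 fun j hj hji => ?_
    rw [doneBefore, Finset.mem_filter] at hj
    have := h.arrival_lt ((le_finish j).trans_lt hj.2.1)
    rw [hji] at this
    linarith
  · refine cnt_eq_zero_iff.2 fun j hj hji => ?_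
    rw [servedBefore, Finset.mem_filter] at hj
    have := h.arrival_lt hj.2.1
    rw [hji] at this
    linarith

/-- The number of chunks of a request. -/
lemma cnt_add_cnt_le {D V : Finset Chunk} (hD : D ⊆ chunks r N) (hV : V ⊆ chunks r N)
    (hDV : Disjoint D V) (i : ℕ) : cnt D i + cnt V i ≤ r.n i := by
  have h1 : cnt D i + cnt V i = cnt (D ∪ V) i := by
    rw [cnt, cnt, cnt, Finset.filter_union, Finset.card_union_of_disjoint]
    exact Finset.disjoint_filter_filter hDV
  rw [h1]
  refine (cnt_mono (Finset.union_subset hD hV) i).trans ?_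
  refine (Finset.card_le_card_of_injOn Prod.snd (t := Finset.range (r.n i)) ?_ ?_).trans
    (Finset.card_range _).le
  · rintro ⟨a, b⟩ hab
    obtain ⟨h3, h4⟩ := Finset.mem_filter.1 hab
    obtain rfl : a = i := h4
    simpa using (mem_chunks.1 h3).2
  · rintro ⟨a, b⟩ hab ⟨a', b'⟩ hab' (h : b = b')
    have h1 := (Finset.mem_filter.1 hab).2
    have h2 := (Finset.mem_filter.1 hab').2
    simp only at h1 h2
    rw [h1, h2, h]

lemma exists_free_chunk {D V : Finset Chunk} {i : ℕ} (h : cnt D i + cnt V i < r.n i) :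
    ∃ c < r.n i, (i, c) ∉ D ∧ (i, c) ∉ V := by
  by_contra! hno
  have h1 : Finset.range (r.n i) ⊆ ((D ∪ V).filter fun j => j.1 = i).image Prod.snd := by
    intro c hc
    refine Finset.mem_image.2 ⟨(i, c), Finset.mem_filter.2 ⟨?_, rfl⟩, rfl⟩
    rw [Finset.mem_union]
    by_cases hcD : (i, c) ∈ D
    · exact Or.inl hcD
    · exact Or.inr (hno c (Finset.mem_range.1 hc) hcD)
  have h2 := (Finset.card_le_card h1).trans Finset.card_image_le
  rw [Finset.card_range, Finset.filter_union] at h2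
  have h3 := Finset.card_union_le (D.filter fun j => j.1 = i) (V.filter fun j => j.1 = i)
  unfold cnt at h
  omega

end Paths

/-! ### Schedules that follow SEDPT-R -/

/-- The schedule `s` results from the assignment procedure SEDPT-R. -/
def IsGreedy (L : ℕ) (r : Requests) (N : ℕ) (x : Chunk → ℝ) (s : Chunk → ℝ≥0∞) : Prop :=
  ∀ t : ℝ≥0, Relation.ReflTransGen (SEDPTStep L r N s x t)
      (inServicePre r s x t) (inService r s x t) ∧
    ∀ B' : Set Chunk, ¬ SEDPTStep L r N s x t (inService r s x t) B'

section Greedy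

variable {d L N : ℕ} {r : Requests} {s : Chunk → ℝ≥0∞} {x : Chunk → ℝ}

lemma doneBy_subset_chunks {t : ℝ≥0∞} : doneBy r N s x t ⊆ chunks r N := by
  classical
  exact Finset.filter_subset _ _

lemma servedAt_subset_chunks {t : ℝ≥0∞} : servedAt r N s x t ⊆ chunks r N := by
  classical
  exact Finset.filter_subset _ _

lemma servedPre_subset_chunks {t : ℝ≥0∞} : servedPre r N s x t ⊆ chunks r N := by
  classical
  exact Finset.filter_subset _ _

lemma remaining_eq (h : Feasible L r N x s) (t : ℝ≥0) (i : ℕ) :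
    remaining r s x t i = r.k i - cnt (doneBy r N s x t) i := by
  have := ncard_eq_cnt (D := doneBy r N s x t) (m := r.n i) (i := i)
    fun c hc => (mem_chunks.1 (doneBy_subset_chunks hc)).2
  rw [remaining, ← this, ← coe_doneBy h t]
  rfl

lemma assigned_eq {V : Finset Chunk} (hV : V ⊆ chunks r N) (i : ℕ) :
    assigned (V : Set Chunk) i = cnt V i := by
  have := ncard_eq_cnt (D := V) (m := r.n i) (i := i) fun c hc => (mem_chunks.1 (hV hc)).2
  rw [assigned, ← this]
  congr 2
  ext c
  exact ⟨fun hc => ⟨(mem_chunks.1 (hV hc)).2, hc⟩, fun hc => hc.2⟩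

lemma waiting_iff (hr : r.Valid N) (h : Feasible L r N x s) {t : ℝ≥0} {V : Finset Chunk}
    {j : Chunk} : Waiting r N s x t V j ↔ j ∈ chunks r N ∧ j.1 ∈ arrivedBy r N t ∧
      cnt (doneBy r N s x t) j.1 < r.k j.1 ∧ j ∉ doneBy r N s x t ∧ j ∉ V := by
  rw [Waiting, mem_chunks, mem_arrivedBy, ← coe_doneBy h t]
  by_cases hj : j.1 < N
  · rw [cnt_doneBy_lt_iff hr hj]
    simp only [hj, true_and, Finset.mem_coe, NNReal.coe_le_coe]
  · simp [hj]

/-- With `exists_waiting` this translates between waiting chunks, in terms of which the policy is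
defined, and available requests, in terms of which levels are defined. -/
lemma avail_of_waiting (hr : r.Valid N) (h : Feasible L r N x s) {t : ℝ≥0} {V : Finset Chunk}
    (hV : V ⊆ chunks r N) (hDV : Disjoint (doneBy r N s x t) V) {j : Chunk}
    (hj : Waiting r N s x t V j) : j.1 ∈ avail r (arrivedBy r N t) (doneBy r N s x t) V := by
  obtain ⟨h1, h2, h3, h4, h5⟩ := (waiting_iff hr h).1 hj
  refine mem_avail.2 ⟨h2, h3, ?_⟩
  have h6 := cnt_add_cnt_le doneBy_subset_chunks (Finset.insert_subset h1 hV)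
    (Finset.disjoint_insert_right.2 ⟨h4, hDV⟩) j.1
  rw [cnt_insert h5, if_pos rfl] at h6
  omega

lemma exists_waiting (hr : r.Valid N) (h : Feasible L r N x s) {t : ℝ≥0} {V : Finset Chunk}
    {i : ℕ} (hi : i ∈ avail r (arrivedBy r N t) (doneBy r N s x t) V) :
    ∃ c, Waiting r N s x t V (i, c) := by
  obtain ⟨h1, h2, h3⟩ := mem_avail.1 hi
  obtain ⟨c, hc, hcD, hcV⟩ := exists_free_chunk h3
  exact ⟨c, (waiting_iff hr h).2 ⟨mem_chunks.2 ⟨(mem_arrivedBy.1 h1).1, hc⟩, h1, h2, hcD, hcV⟩⟩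

/-- The assignments preserve the invariant and do not increase profile and potential. -/
lemma inv_of_steps (hd : 1 ≤ d) (hr : r.Valid N) (h : Feasible L r N x s) {t : ℝ≥0}
    {V : Finset Chunk} (hV : V ⊆ chunks r N) (hDV : Disjoint (doneBy r N s x t) V)
    (hinv : Inv L r (arrivedBy r N t) (doneBy r N s x t) V) {B : Set Chunk}
    (hB : Relation.ReflTransGen (SEDPTStep L r N s x t) V B) :
    ∃ V' : Finset Chunk, (V' : Set Chunk) = B ∧ V' ⊆ chunks r N ∧
      Disjoint (doneBy r N s x t) V' ∧ Inv L r (arrivedBy r N t) (doneBy r N s x t) V' ∧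
      prof L r (arrivedBy r N t) (doneBy r N s x t) V' ≤
        prof L r (arrivedBy r N t) (doneBy r N s x t) V ∧
      pot d L N r (arrivedBy r N t) (doneBy r N s x t) V' ≤
        pot d L N r (arrivedBy r N t) (doneBy r N s x t) V := by
  induction hB with
  | refl => exact ⟨V, rfl, hV, hDV, hinv, le_rfl, le_rfl⟩
  | tail _ hstep ih =>
    obtain ⟨V', rfl, h1, h2, h3, h4, h5⟩ := ih
    obtain ⟨hlt, j, hj, rfl, hmin⟩ := hstep
    obtain ⟨g1, g2, g3, g4, g5⟩ := (waiting_iff hr h).1 hj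
    rw [Set.encard_coe_eq_coe_finsetCard] at hlt
    obtain ⟨e1, e2, e3⟩ := Inv.assign (N := N) hd h3 g5 (avail_of_waiting hr h h1 h2 hj)
      (by exact_mod_cast hlt) (by
        intro i hi
        obtain ⟨c, hc⟩ := exists_waiting hr h hi
        have := hmin _ hc
        rw [remaining_eq h, remaining_eq h, assigned_eq h1, assigned_eq h1] at this
        have h6 := (mem_avail.1 hi).2.1
        rw [rem, rem]
        simp only at this
        omega)
    exact ⟨insert j V', Finset.coe_insert _ _, Finset.insert_subset g1 h1,
      Finset.disjoint_insert_right.2 ⟨g4, h2⟩, e1, e2.trans h4, e3.trans h5⟩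

lemma disjoint_doneBy_servedPre (hr : r.Valid N) {t : ℝ≥0∞} :
    Disjoint (doneBy r N s x t) (servedPre r N s x t) :=
  Finset.disjoint_right.2 fun _ hl => ((mem_servedPre_iff hr).1 hl).2.1

lemma disjoint_doneBy_servedAt (hr : r.Valid N) {t : ℝ≥0∞} :
    Disjoint (doneBy r N s x t) (servedAt r N s x t) :=
  Finset.disjoint_right.2 fun _ hl => ((mem_servedAt_iff hr).1 hl).2.1

lemma IsGreedy.steps (hg : IsGreedy L r N x s) (hd : 1 ≤ d) (hr : r.Valid N)
    (h : Feasible L r N x s) {t : ℝ} (ht : 0 ≤ t)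
    (hinv : Inv L r (arrivedBy r N t) (doneBy r N s x (ENNReal.ofReal t))
      (servedPre r N s x (ENNReal.ofReal t))) :
    Inv L r (arrivedBy r N t) (doneBy r N s x (ENNReal.ofReal t))
      (servedAt r N s x (ENNReal.ofReal t)) ∧
    prof L r (arrivedBy r N t) (doneBy r N s x (ENNReal.ofReal t))
      (servedAt r N s x (ENNReal.ofReal t)) ≤
    prof L r (arrivedBy r N t) (doneBy r N s x (ENNReal.ofReal t))
      (servedPre r N s x (ENNReal.ofReal t)) ∧
    pot d L N r (arrivedBy r N t) (doneBy r N s x (ENNReal.ofReal t))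
      (servedAt r N s x (ENNReal.ofReal t)) ≤
    pot d L N r (arrivedBy r N t) (doneBy r N s x (ENNReal.ofReal t))
      (servedPre r N s x (ENNReal.ofReal t)) := by
  lift t to ℝ≥0 using ht
  rw [ENNReal.ofReal_coe_nnreal] at *
  have hst := (hg t).1
  rw [← coe_servedPre h t, ← coe_servedAt h t] at hst
  obtain ⟨V, h1, -, -, h4, h5, h6⟩ := inv_of_steps hd hr h servedPre_subset_chunks
    (disjoint_doneBy_servedPre hr) hinv hst
  rw [Finset.coe_inj.1 h1] at h4 h5 h6
  exact ⟨h4, h5, h6⟩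

/-- Either no chunk is waiting or all threads are busy. -/
lemma IsGreedy.busy (hg : IsGreedy L r N x s) (hr : r.Valid N) (h : Feasible L r N x s) {t : ℝ}
    (ht : 0 ≤ t) : avail r (arrivedBy r N t) (doneBy r N s x (ENNReal.ofReal t))
        (servedAt r N s x (ENNReal.ofReal t)) = ∅ ∨
      (servedAt r N s x (ENNReal.ofReal t)).card = L := by
  lift t to ℝ≥0 using ht
  rw [ENNReal.ofReal_coe_nnreal]
  by_contra! hno
  obtain ⟨⟨i, hi⟩, hne⟩ := hno
  have hlt : (servedAt r N s x t).card < L := lt_of_le_of_ne (h.card_servedAt_le t) hne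
  set R := avail r (arrivedBy r N t) (doneBy r N s x t) (servedAt r N s x t) with hR
  obtain ⟨w, hw, hmin⟩ := Finset.exists_min_image R
    (fun i => (r.k i : ℤ) - cnt (doneBy r N s x t) i - cnt (servedAt r N s x t) i) ⟨i, hi⟩
  obtain ⟨c, hc⟩ := exists_waiting hr h hw
  refine (hg t).2 (insert (w, c) (inService r s x t)) ?_
  rw [← coe_servedAt h t]
  refine ⟨?_, (w, c), hc, rfl, fun j hj => ?_⟩
  · rw [Set.encard_coe_eq_coe_finsetCard]
    exact_mod_cast hlt
  · have h1 := hmin _ (avail_of_waiting hr h servedAt_subset_chunks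
      (disjoint_doneBy_servedAt hr) hj)
    rwa [remaining_eq h, remaining_eq h, assigned_eq servedAt_subset_chunks,
      assigned_eq servedAt_subset_chunks]

/-- The loss of potential at the download of chunk `j`. -/
noncomputable def downloadLoss (L : ℕ) (r : Requests) (N : ℕ) (s : Chunk → ℝ≥0∞) (x : Chunk → ℝ)
    (j : Chunk) : ℝ :=
  loss L N r (arrivedBy r N (finish s x j).toReal) (doneBefore r N s x (finish s x j))
    (servedBefore r N s x (finish s x j)) j

/-- The downloads at time `t`. -/
noncomputable def doneAt (r : Requests) (N : ℕ) (s : Chunk → ℝ≥0∞) (x : Chunk → ℝ) (t : ℝ≥0∞) :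
    Finset Chunk :=
  (everDone r N s x).filter fun j => finish s x j = t

/-- One instant consists of at most one download, by the absence of ties, and then of the
assignments. The arrivals of this instant have been included beforehand, as `arrivedBy` is used on
both sides. -/
lemma IsGreedy.jump (hg : IsGreedy L r N x s) (hd : 1 ≤ d)
    (hdn : ∀ i < N, d ≤ r.n i - r.k i + 1) (hr : r.Valid N)
    (h : Feasible L r N x s) (hx : ∀ j, 0 < x j)
    (hties : ∀ j l, j ≠ l → s j ≠ ⊤ → finish s x j ≠ finish s x l) {t : ℝ} (ht : 0 ≤ t)
    (hinv : Inv L r (arrivedBy r N t) (doneBefore r N s x (ENNReal.ofReal t))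
      (servedBefore r N s x (ENNReal.ofReal t))) :
    Inv L r (arrivedBy r N t) (doneBy r N s x (ENNReal.ofReal t))
      (servedAt r N s x (ENNReal.ofReal t)) ∧
    prof L r (arrivedBy r N t) (doneBy r N s x (ENNReal.ofReal t))
      (servedAt r N s x (ENNReal.ofReal t)) ≤
    sh (doneAt r N s x (ENNReal.ofReal t)).card
      (prof L r (arrivedBy r N t) (doneBefore r N s x (ENNReal.ofReal t))
      (servedBefore r N s x (ENNReal.ofReal t))) ∧
    pot d L N r (arrivedBy r N t) (doneBy r N s x (ENNReal.ofReal t))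
      (servedAt r N s x (ENNReal.ofReal t)) +
      ∑ j ∈ doneAt r N s x (ENNReal.ofReal t), downloadLoss L r N s x j ≤
    pot d L N r (arrivedBy r N t) (doneBefore r N s x (ENNReal.ofReal t))
      (servedBefore r N s x (ENNReal.ofReal t)) := by
  rcases (doneAt r N s x (ENNReal.ofReal t)).eq_empty_or_nonempty with h0 | ⟨j, hj⟩
  · have hno : ∀ j ∈ everDone r N s x, finish s x j ≠ ENNReal.ofReal t := fun j hj hjt =>
      absurd (h0 ▸ Finset.mem_filter.2 ⟨hj, hjt⟩ : j ∈ (∅ : Finset Chunk)) (Finset.notMem_empty j)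
    rw [h0, Finset.card_empty, sh_zero, Finset.sum_empty, add_zero]
    rw [← doneBy_eq_doneBefore ENNReal.ofReal_ne_top hno,
      ← servedPre_eq_servedBefore hr ENNReal.ofReal_ne_top hno] at hinv ⊢
    exact hg.steps hd hr h ht hinv
  · obtain ⟨hjd, hjt⟩ := Finset.mem_filter.1 hj
    have hone : doneAt r N s x (ENNReal.ofReal t) = {j} := by
      refine Finset.eq_singleton_iff_unique_mem.2 ⟨hj, fun l hl => ?_⟩
      obtain ⟨hld, hlt⟩ := Finset.mem_filter.1 hl
      by_contra hne
      exact hties l j hne (mem_everDone.1 hld).2.1 (hlt.trans hjt.symm)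
    rw [hone, Finset.card_singleton, Finset.sum_singleton]
    have hloss : downloadLoss L r N s x j = loss L N r (arrivedBy r N t)
        (doneBefore r N s x (ENNReal.ofReal t)) (servedBefore r N s x (ENNReal.ofReal t)) j := by
      rw [downloadLoss, hjt, ENNReal.toReal_ofReal ht]
    have hD := doneBy_eq_insert hties hjd
    have hnD := notMem_doneBefore_finish (r := r) (N := N) (s := s) (x := x) (j := j)
    have hV := mem_servedBefore_finish hx hjd
    rw [hjt] at hD hnD hV
    have hdn' : ∀ i ∈ arrivedBy r N t, d ≤ r.n i - r.k i + 1 := fun i hi =>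
      hdn i (mem_arrivedBy.1 hi).1
    obtain ⟨e1, e2, e3⟩ := Inv.download (N := N) hd hdn' hinv hV hnD
      (servedPre_eq_filter (s := s) (x := x) hr ▸ Finset.filter_subset _ _)
      (fun i hi => cnt_servedPre_ne hr hD hnD hi) (cnt_servedPre_self hr hD hnD hV)
    rw [← hD] at e1 e2 e3
    obtain ⟨f1, f2, f3⟩ := hg.steps hd hr h ht e1
    refine ⟨f1, f2.trans fun p => (e2 p).trans_eq (by simp [sh]), ?_⟩
    rw [hloss]
    linarith

/-- Several requests arrive. -/
lemma Inv.arrivals (hd : 1 ≤ d) {R A : Finset ℕ} {D V : Finset Chunk} (h : Inv L r R D V)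
    (hA : ∀ i ∈ A, i ∉ R ∧ cnt D i = 0 ∧ cnt V i = 0 ∧ 1 ≤ r.k i ∧ r.k i ≤ r.n i) :
    Inv L r (A ∪ R) D V ∧ pot d L N r (A ∪ R) D V ≤ pot d L N r R D V := by
  induction A using Finset.induction_on with
  | empty => simpa using h
  | insert l A hl ih =>
    obtain ⟨h1, h2⟩ := ih fun i hi => hA i (Finset.mem_insert_of_mem hi)
    obtain ⟨g1, g2, g3, g4, g5⟩ := hA l (Finset.mem_insert_self _ _)
    obtain ⟨e1, -, e3⟩ := Inv.arrival (N := N) hd h1 (l := l) (by simp [hl, g1]) g2 g3 g4 g5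
    rw [Finset.insert_union]
    exact ⟨e1, e3.trans h2⟩

/-- The requests that arrive at time `t` join some of those in a set between those that arrive
before and by this time. -/
lemma inv_of_arrivedBefore (hd : 1 ≤ d) (hr : r.Valid N) (h : Feasible L r N x s) {t : ℝ}
    {R : Finset ℕ} (hR : arrivedBefore r N t ⊆ R) (hR' : R ⊆ arrivedBy r N t)
    (hinv : Inv L r (arrivedBefore r N t) (doneBefore r N s x (ENNReal.ofReal t))
      (servedBefore r N s x (ENNReal.ofReal t))) :
    Inv L r R (doneBefore r N s x (ENNReal.ofReal t)) (servedBefore r N s x (ENNReal.ofReal t)) ∧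
    pot d L N r R (doneBefore r N s x (ENNReal.ofReal t))
      (servedBefore r N s x (ENNReal.ofReal t)) ≤
    pot d L N r (arrivedBefore r N t) (doneBefore r N s x (ENNReal.ofReal t))
      (servedBefore r N s x (ENNReal.ofReal t)) := by
  have := Inv.arrivals (N := N) hd (A := R \ arrivedBefore r N t) hinv fun i hi => by
    obtain ⟨h1, h2⟩ := Finset.mem_sdiff.1 hi
    obtain ⟨h3, -⟩ := mem_arrivedBy.1 (hR' h1)
    rw [mem_arrivedBefore, not_and, not_lt] at h2
    obtain ⟨h4, h5⟩ := h.cnt_before_eq_zero (h2 h3)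
    exact ⟨(Finset.mem_sdiff.1 hi).2, h4, h5, hr.one_le_k i (by exact_mod_cast h3),
      hr.k_le_n i (by exact_mod_cast h3)⟩
  rwa [Finset.sdiff_union_of_subset hR] at this

lemma pot_empty : pot d L N r ∅ ∅ ∅ = 0 := by
  have hlev : ∀ q, lev r ∅ ∅ ∅ (q + 1) = ⊤ := fun q => by simp [lev, level, avail]
  simp [pot, potential, exh, hlev, ups]

/-- The losses of potential before time `t`. -/
lemma IsGreedy.inv_pot (hg : IsGreedy L r N x s) (hd : 1 ≤ d)
    (hdn : ∀ i < N, d ≤ r.n i - r.k i + 1) (hr : r.Valid N)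
    (h : Feasible L r N x s) (hx : ∀ j, 0 < x j)
    (hties : ∀ j l, j ≠ l → s j ≠ ⊤ → finish s x j ≠ finish s x l) {t : ℝ} (ht : 0 ≤ t) :
    Inv L r (arrivedBefore r N t) (doneBefore r N s x (ENNReal.ofReal t))
      (servedBefore r N s x (ENNReal.ofReal t)) ∧
    pot d L N r (arrivedBefore r N t) (doneBefore r N s x (ENNReal.ofReal t))
      (servedBefore r N s x (ENNReal.ofReal t)) +
      ∑ j ∈ (everDone r N s x).filter (fun j => finish s x j < ENNReal.ofReal t),
        downloadLoss L r N s x j ≤ 0 := by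
  refine induction_jumps (E := events r N s x) (t₀ := 0)
    (P := fun t => Inv L r (arrivedBefore r N t) (doneBefore r N s x (ENNReal.ofReal t))
      (servedBefore r N s x (ENNReal.ofReal t)) ∧
      pot d L N r (arrivedBefore r N t) (doneBefore r N s x (ENNReal.ofReal t))
      (servedBefore r N s x (ENNReal.ofReal t)) +
      ∑ j ∈ (everDone r N s x).filter (fun j => finish s x j < ENNReal.ofReal t),
        downloadLoss L r N s x j ≤ 0)
    (P' := fun t => Inv L r (arrivedBy r N t) (doneBy r N s x (ENNReal.ofReal t))
      (servedAt r N s x (ENNReal.ofReal t)) ∧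
      pot d L N r (arrivedBy r N t) (doneBy r N s x (ENNReal.ofReal t))
      (servedAt r N s x (ENNReal.ofReal t)) +
      ∑ j ∈ (everDone r N s x).filter (fun j => finish s x j ≤ ENNReal.ofReal t),
        downloadLoss L r N s x j ≤ 0) ?_ t ht ?_ ?_
  · have h1 : arrivedBefore r N 0 = ∅ := by
      refine Finset.filter_false_of_mem fun i _ => ?_
      exact not_lt.2 (r.a i).2
    have h2 : doneBefore r N s x (ENNReal.ofReal 0) = ∅ := by
      simp [doneBefore]
    have h3 : servedBefore r N s x (ENNReal.ofReal 0) = ∅ := by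
      simp [servedBefore]
    rw [h1, h2, h3, pot_empty]
    simpa using inv_empty
  · rintro t ht - ⟨h1, h2⟩
    obtain ⟨g1, g2⟩ := inv_of_arrivedBefore (R := arrivedBy r N t) hd hr h
      (fun i hi => mem_arrivedBy.2 ⟨(mem_arrivedBefore.1 hi).1, (mem_arrivedBefore.1 hi).2.le⟩)
      subset_rfl h1
    obtain ⟨e1, -, e3⟩ := hg.jump hd hdn hr h hx hties ht g1
    refine ⟨e1, ?_⟩
    have h4 : (everDone r N s x).filter (fun j => finish s x j ≤ ENNReal.ofReal t) =
        (everDone r N s x).filter (fun j => finish s x j < ENNReal.ofReal t) ∪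
        doneAt r N s x (ENNReal.ofReal t) := by
      rw [doneAt, ← Finset.filter_or]
      exact Finset.filter_congr fun j _ => le_iff_lt_or_eq
    rw [h4, Finset.sum_union]
    · linarith
    · exact Finset.disjoint_filter.2 fun j _ h5 => h5.ne
  · rintro τ t hτ hτt - hno ⟨h1, h2⟩
    obtain ⟨e1, e2⟩ := state_eq_of_no_event hr hτ hτt hno
    rw [e1, e2, arrivedBefore_eq_of_no_event hτt hno]
    refine ⟨h1, ?_⟩
    have h4 : (everDone r N s x).filter (fun j => finish s x j < ENNReal.ofReal t) =
        (everDone r N s x).filter (fun j => finish s x j ≤ ENNReal.ofReal τ) := by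
      refine Finset.filter_congr fun j hj => ⟨fun h5 => ?_, fun h5 =>
        h5.trans_lt (ofReal_lt_ofReal hτ hτt)⟩
      by_contra! h6
      exact (no_event hno).1 j (mem_everDone.1 hj).1 ⟨h6, h5⟩
    rwa [h4]

lemma card_exh_add_card_avail {R : Finset ℕ} {D V : Finset Chunk} :
    (exh r R D V).card + (avail r R D V).card = R.card := by
  rw [add_comm]
  exact Finset.card_filter_add_card_filter_not _

/-- A level whose index exceeds the number of available requests is `⊤` and contributes nothing, so
at most `R.card` terms remain, each at least `-bound d L`. -/
lemma neg_le_pot {R : Finset ℕ} {D V : Finset Chunk} :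
    -(bound d L * R.card) ≤ pot d L N r R D V := by
  have h1 : -(bound d L * (exh r R D V).card) ≤
      ∑ i ∈ exh r R D V, ups d L (rem r D i) := by
    calc -(bound d L * (exh r R D V).card) = ∑ i ∈ exh r R D V, -bound d L := by
          rw [Finset.sum_const, nsmul_eq_mul]
          ring
      _ ≤ _ := Finset.sum_le_sum fun i _ => neg_bound_le_ups _
  have h2 : -(bound d L * (avail r R D V).card) ≤
      ∑ q ∈ Finset.range N, ups d L (lev r R D V (q + 1)) := by
    have h3 : ∑ q ∈ Finset.range N, ups d L (lev r R D V (q + 1)) =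
        ∑ q ∈ (Finset.range N).filter (fun q => q < (avail r R D V).card),
          ups d L (lev r R D V (q + 1)) := by
      rw [Finset.sum_filter]
      refine Finset.sum_congr rfl fun q _ => ?_
      split_ifs with hq
      · rfl
      · have : lev r R D V (q + 1) = ⊤ := by
          rw [lev, level, Finset.powersetCard_eq_empty.2 (by omega), Finset.inf_empty]
        simp [this, ups]
    have h4 : ((Finset.range N).filter (fun q => q < (avail r R D V).card)).card ≤
        (avail r R D V).card := by
      refine (Finset.card_le_card fun q hq => ?_).trans (Finset.card_range _).le
      exact Finset.mem_range.2 (Finset.mem_filter.1 hq).2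
    rw [h3]
    calc -(bound d L * (avail r R D V).card) ≤ -(bound d L *
          ((Finset.range N).filter (fun q => q < (avail r R D V).card)).card) := by
          have := bound_nonneg (d := d) (L := L)
          gcongr
      _ = ∑ q ∈ (Finset.range N).filter (fun q => q < (avail r R D V).card), -bound d L := by
          rw [Finset.sum_const, nsmul_eq_mul]
          ring
      _ ≤ _ := Finset.sum_le_sum fun i _ => neg_bound_le_ups _
  have h5 : ((exh r R D V).card : ℝ) + (avail r R D V).card = R.card := by
    exact_mod_cast card_exh_add_card_avail
  rw [← h5, pot, potential]
  linarith

/-- The total loss of potential. -/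
lemma IsGreedy.sum_downloadLoss_le (hg : IsGreedy L r N x s) (hd : 1 ≤ d)
    (hdn : ∀ i < N, d ≤ r.n i - r.k i + 1) (hr : r.Valid N)
    (h : Feasible L r N x s) (hx : ∀ j, 0 < x j)
    (hties : ∀ j l, j ≠ l → s j ≠ ⊤ → finish s x j ≠ finish s x l) :
    ∑ j ∈ everDone r N s x, downloadLoss L r N s x j ≤ bound d L * N := by
  obtain ⟨T, hT⟩ := (events r N s x).exists_le
  have hT0 : 0 ≤ max T 0 + 1 := by positivity
  obtain ⟨-, h2⟩ := hg.inv_pot hd hdn hr h hx hties hT0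
  rw [Finset.filter_true_of_mem fun j hj => ?_] at h2
  · have h3 := neg_le_pot (d := d) (L := L) (N := N) (r := r) (R := arrivedBefore r N (max T 0 + 1))
      (D := doneBefore r N s x (ENNReal.ofReal (max T 0 + 1)))
      (V := servedBefore r N s x (ENNReal.ofReal (max T 0 + 1)))
    have h4 : bound d L * (arrivedBefore r N (max T 0 + 1)).card ≤ bound d L * N := by
      have := bound_nonneg (d := d) (L := L)
      gcongr
      exact (Finset.card_filter_le _ _).trans (Finset.card_range N).le
    linarith
  · obtain ⟨h3, h4, -⟩ := mem_everDone.1 hj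
    have h5 : finish s x j ≠ ⊤ := ENNReal.add_ne_top.2 ⟨h4, ENNReal.ofReal_ne_top⟩
    have h6 := hT _ (Finset.mem_union_left _ (Finset.mem_union_right _
      (Finset.mem_image_of_mem (fun j => (finish s x j).toReal) h3)) :
      (finish s x j).toReal ∈ events r N s x)
    rw [← ENNReal.ofReal_toReal h5]
    refine ofReal_lt_ofReal ENNReal.toReal_nonneg ?_
    have := le_max_left T 0
    linarith

/-- The invariant and the busyness when no request arrives at time `t`. -/
lemma IsGreedy.busy_before (hg : IsGreedy L r N x s) (hr : r.Valid N) (h : Feasible L r N x s)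
    {t : ℝ} (ht : 0 < t) :
    avail r (arrivedBefore r N t) (doneBefore r N s x (ENNReal.ofReal t))
        (servedBefore r N s x (ENNReal.ofReal t)) = ∅ ∨
      (servedBefore r N s x (ENNReal.ofReal t)).card = L := by
  obtain ⟨a, ha, hat, hno⟩ := exists_no_event (events r N s x) ht
  obtain ⟨e1, e2⟩ := state_eq_of_no_event hr ha hat hno
  rw [e1, e2, arrivedBefore_eq_of_no_event hat hno]
  exact hg.busy hr h ha

end Greedy

/-! ### Means of functions of the profile -/

section Mean

/-- The loss of the mean of `f` at time `T` by one reduction of the profile `S` at time `t`. -/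
noncomputable def lossAt (f : (ℕ → ℕ∞) → ℝ) (M : ℕ) (lam T t : ℝ) (S : ℕ → ℕ∞) : ℝ :=
  poisLoss f M (lam * max (T - t) 0) S

/-- The mean of `f` at time `T` when the profile at time `t` is `S`. -/
noncomputable def meanAt (f : (ℕ → ℕ∞) → ℝ) (M : ℕ) (lam T t : ℝ) (S : ℕ → ℕ∞) : ℝ :=
  poisMean f M (lam * max (T - t) 0) S

variable {f : (ℕ → ℕ∞) → ℝ} {B lam T t t₀ : ℝ} {M : ℕ} {S S' : ℕ → ℕ∞}

/-- Replacing `T - t` by its positive part keeps the Poisson parameter nonnegative, so that this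
holds for all times without case distinctions. -/
lemma lossAt_nonneg (hf : Monotone f) (hlam : 0 ≤ lam) : 0 ≤ lossAt f M lam T t S :=
  poisLoss_nonneg hf (by positivity)

lemma lossAt_le (hf0 : ∀ S, 0 ≤ f S) (hfB : ∀ S, f S ≤ B) (hlam : 0 ≤ lam) :
    lossAt f M lam T t S ≤ B := by
  have h1 := poisMean_le (M := M) hfB (by positivity : 0 ≤ lam * max (T - t) 0) (S := S)
  have h2 := poisMean_nonneg (M := M) hf0 (by positivity : 0 ≤ lam * max (T - t) 0) (S := sh 1 S)
  rw [lossAt, poisLoss]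
  linarith

lemma continuous_lossAt : Continuous fun t => lossAt f M lam T t S := by
  have := continuous_poisLoss (f := f) (M := M) (S := S)
  unfold lossAt
  fun_prop

lemma meanAt_self : meanAt f M lam T T S = f S := by
  rw [meanAt, sub_self, max_self, mul_zero, poisMean_zero]

lemma meanAt_nonneg (hf0 : ∀ S, 0 ≤ f S) (hlam : 0 ≤ lam) : 0 ≤ meanAt f M lam T t S :=
  poisMean_nonneg hf0 (by positivity)

lemma meanAt_mono (hf : Monotone f) (hlam : 0 ≤ lam) : Monotone (meanAt f M lam T t) :=
  poisMean_mono hf (by positivity)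

lemma meanAt_sh_one : meanAt f M lam T t (sh 1 S) + lossAt f M lam T t S = meanAt f M lam T t S := by
  rw [lossAt, poisLoss, meanAt, meanAt]
  ring

variable {L N : ℕ} {r : Requests} {s : Chunk → ℝ≥0∞} {x : Chunk → ℝ}
  {Φ : Finset Chunk → Finset Chunk → ℕ → ℕ∞}

lemma measurable_lossAt_state : Measurable fun t : ℝ =>
    lossAt f M lam T t (Φ (doneBefore r N s x (ENNReal.ofReal t))
      (servedBefore r N s x (ENNReal.ofReal t))) :=
  measurable_state (s := fun _ => s) (x := fun _ => x) (t := fun t : ℝ => ENNReal.ofReal t)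
    (G := fun t D V => lossAt f M lam T t (Φ D V)) (fun _ => measurable_const)
    (fun _ => measurable_const) ENNReal.measurable_ofReal fun _ _ => continuous_lossAt.measurable

/-- Between events the profile is constant and its Poisson mean grows at rate `lam` times the loss.
The map `Φ` is arbitrary, so that the identity serves for `prof` and for `need`. -/
lemma meanAt_sub_meanAt (hr : r.Valid N) (hf : Monotone f) (hf0 : ∀ S, 0 ≤ f S)
    (hfB : ∀ S, f S ≤ B) (hlam : 0 ≤ lam)
    (hΦ : ∀ D, ∀ V ⊆ chunks r N, FiniteBy M (Φ D V)) (ht₀ : 0 ≤ t₀) (hT : t₀ ≤ T) :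
    meanAt f M lam T T (Φ (doneBefore r N s x (ENNReal.ofReal T))
      (servedBefore r N s x (ENNReal.ofReal T))) -
    meanAt f M lam T t₀ (Φ (doneBefore r N s x (ENNReal.ofReal t₀))
      (servedBefore r N s x (ENNReal.ofReal t₀))) =
    (∫ t in t₀..T, lam * lossAt f M lam T t (Φ (doneBefore r N s x (ENNReal.ofReal t))
      (servedBefore r N s x (ENNReal.ofReal t)))) +
    ∑ e ∈ (insert t₀ (events r N s x)).filter (fun e => t₀ ≤ e ∧ e < T),
      (meanAt f M lam T e (Φ (doneBy r N s x (ENNReal.ofReal e))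
        (servedAt r N s x (ENNReal.ofReal e))) -
      meanAt f M lam T e (Φ (doneBefore r N s x (ENNReal.ofReal e))
        (servedBefore r N s x (ENNReal.ofReal e)))) := by
  refine sub_eq_integral_add_sum_jumps (E := insert t₀ (events r N s x))
    (v := fun t => meanAt f M lam T t (Φ (doneBefore r N s x (ENNReal.ofReal t))
      (servedBefore r N s x (ENNReal.ofReal t))))
    (v' := fun t => meanAt f M lam T t (Φ (doneBy r N s x (ENNReal.ofReal t))
      (servedAt r N s x (ENNReal.ofReal t)))) (Finset.mem_insert_self _ _) (fun a b => ?_) T hT ?_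
  · refine (intervalIntegrable_const (c := lam * B)).mono_fun'
      (measurable_lossAt_state.const_mul lam).aestronglyMeasurable
      (Filter.Eventually.of_forall fun t => ?_)
    have h1 := lossAt_nonneg (M := M) (T := T) (t := t) hf hlam
      (S := Φ (doneBefore r N s x (ENNReal.ofReal t)) (servedBefore r N s x (ENNReal.ofReal t)))
    have h2 := lossAt_le (M := M) (T := T) (t := t) hf0 hfB hlam
      (S := Φ (doneBefore r N s x (ENNReal.ofReal t)) (servedBefore r N s x (ENNReal.ofReal t)))
    refine (Real.norm_of_nonneg (mul_nonneg hlam h1)).trans_le ?_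
    exact mul_le_mul_of_nonneg_left h2 hlam
  · intro τ t hτ hτt htT hno
    have hτ0 := ht₀.trans hτ
    have hno' : ∀ u, τ < u → u ≤ t → doneBefore r N s x (ENNReal.ofReal u) =
        doneBy r N s x (ENNReal.ofReal τ) ∧ servedBefore r N s x (ENNReal.ofReal u) =
        servedAt r N s x (ENNReal.ofReal τ) := fun u hu hut =>
      state_eq_of_no_event hr hτ0 hu fun e he h =>
        hno e (Finset.mem_insert_of_mem he) ⟨h.1, h.2.trans_le hut⟩
    obtain ⟨e1, e2⟩ := hno' t hτt le_rfl
    have hint : ∫ u in τ..t, lam * lossAt f M lam T u (Φ (doneBefore r N s x (ENNReal.ofReal u))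
        (servedBefore r N s x (ENNReal.ofReal u))) =
        ∫ u in τ..t, lam * poisLoss f M (lam * (T - u)) (Φ (doneBy r N s x (ENNReal.ofReal τ))
        (servedAt r N s x (ENNReal.ofReal τ))) := by
      rw [intervalIntegral.integral_of_le hτt.le, intervalIntegral.integral_of_le hτt.le]
      refine setIntegral_congr_fun measurableSet_Ioc fun u hu => ?_
      obtain ⟨e3, e4⟩ := hno' u hu.1 hu.2
      rw [e3, e4, lossAt, max_eq_left (by linarith [hu.2])]
    rw [hint, e1, e2, meanAt, meanAt, max_eq_left (by linarith), max_eq_left (by linarith)]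
    exact poisMean_sub_eq_integral (hΦ _ _ servedAt_subset_chunks) lam T τ t

lemma sum_doneAt (h : Chunk → ℝ) (ht₀ : 0 ≤ t₀) :
    ∑ e ∈ (insert t₀ (events r N s x)).filter (fun e => t₀ ≤ e ∧ e < T),
      ∑ j ∈ doneAt r N s x (ENNReal.ofReal e), h j =
    ∑ j ∈ (everDone r N s x).filter
      (fun j => t₀ ≤ (finish s x j).toReal ∧ (finish s x j).toReal < T), h j := by
  rw [← Finset.sum_fiberwise_of_maps_to (g := fun j => (finish s x j).toReal)
    (t := (insert t₀ (events r N s x)).filter (fun e => t₀ ≤ e ∧ e < T))]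
  · refine Finset.sum_congr rfl fun e he => ?_
    obtain ⟨-, h1, h2⟩ := Finset.mem_filter.1 he
    congr 1
    ext j
    rw [doneAt, Finset.mem_filter, Finset.mem_filter, Finset.mem_filter]
    constructor
    · rintro ⟨h3, h4⟩
      have h5 : (finish s x j).toReal = e := by rw [h4, ENNReal.toReal_ofReal (ht₀.trans h1)]
      rw [h5]
      exact ⟨⟨h3, h1, h2⟩, rfl⟩
    · rintro ⟨⟨h3, -⟩, h4⟩
      refine ⟨h3, ?_⟩
      rw [← h4, ENNReal.ofReal_toReal]
      exact ENNReal.add_ne_top.2 ⟨(mem_everDone.1 h3).2.1, ENNReal.ofReal_ne_top⟩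
  · intro j hj
    rw [Finset.mem_filter] at hj ⊢
    refine ⟨Finset.mem_insert_of_mem ?_, hj.2⟩
    exact Finset.mem_union_left _ (Finset.mem_union_right _
      (Finset.mem_image_of_mem (fun j => (finish s x j).toReal) (mem_everDone.1 hj.1).1))

/-- The losses at the downloads between `t₀` and `T`. -/
noncomputable def lossSum (f : (ℕ → ℕ∞) → ℝ) (M : ℕ) (lam t₀ T : ℝ)
    (Φ : Finset Chunk → Finset Chunk → ℕ → ℕ∞) (r : Requests) (N : ℕ) (s : Chunk → ℝ≥0∞)
    (x : Chunk → ℝ) : ℝ≥0∞ :=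
  ∑ j ∈ everDone r N s x, if t₀ ≤ (finish s x j).toReal ∧ (finish s x j).toReal < T then
    ENNReal.ofReal (lossAt f M lam T (finish s x j).toReal
      (Φ (doneBefore r N s x (finish s x j)) (servedBefore r N s x (finish s x j)))) else 0

/-- The integral of the losses between `t₀` and `T`. -/
noncomputable def lossInt (f : (ℕ → ℕ∞) → ℝ) (M : ℕ) (lam t₀ T : ℝ)
    (Φ : Finset Chunk → Finset Chunk → ℕ → ℕ∞) (r : Requests) (N : ℕ) (s : Chunk → ℝ≥0∞)
    (x : Chunk → ℝ) : ℝ≥0∞ :=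
  ∫⁻ t in Set.Ioi (0 : ℝ), if t₀ ≤ t ∧ t < T then
    ENNReal.ofReal (lam * lossAt f M lam T t (Φ (doneBefore r N s x (ENNReal.ofReal t))
      (servedBefore r N s x (ENNReal.ofReal t)))) else 0

/-- The real form belongs to the pathwise identity; the form in `ℝ≥0∞` can be integrated over the
outcomes without integrability conditions. -/
lemma lossSum_eq (hf : Monotone f) (hlam : 0 ≤ lam) (ht₀ : 0 ≤ t₀) :
    lossSum f M lam t₀ T Φ r N s x = ENNReal.ofReal
    (∑ e ∈ (insert t₀ (events r N s x)).filter (fun e => t₀ ≤ e ∧ e < T),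
      (doneAt r N s x (ENNReal.ofReal e)).card * lossAt f M lam T e
        (Φ (doneBefore r N s x (ENNReal.ofReal e)) (servedBefore r N s x (ENNReal.ofReal e)))) := by
  have h1 : ∑ e ∈ (insert t₀ (events r N s x)).filter (fun e => t₀ ≤ e ∧ e < T),
      (doneAt r N s x (ENNReal.ofReal e)).card * lossAt f M lam T e
        (Φ (doneBefore r N s x (ENNReal.ofReal e)) (servedBefore r N s x (ENNReal.ofReal e))) =
      ∑ e ∈ (insert t₀ (events r N s x)).filter (fun e => t₀ ≤ e ∧ e < T),
      ∑ j ∈ doneAt r N s x (ENNReal.ofReal e), lossAt f M lam T (finish s x j).toReal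
        (Φ (doneBefore r N s x (finish s x j)) (servedBefore r N s x (finish s x j))) := by
    refine Finset.sum_congr rfl fun e he => ?_
    rw [← nsmul_eq_mul, ← Finset.sum_const]
    refine Finset.sum_congr rfl fun j hj => ?_
    have h2 := (Finset.mem_filter.1 hj).2
    rw [h2, ENNReal.toReal_ofReal (ht₀.trans (Finset.mem_filter.1 he).2.1)]
  rw [h1, sum_doneAt _ ht₀, lossSum, ← Finset.sum_filter,
    ENNReal.ofReal_sum_of_nonneg fun j _ => lossAt_nonneg hf hlam]

lemma lossInt_eq (hf : Monotone f) (hf0 : ∀ S, 0 ≤ f S)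
    (hfB : ∀ S, f S ≤ B) (hlam : 0 ≤ lam) (ht₀ : 0 ≤ t₀) (hT : t₀ ≤ T) :
    lossInt f M lam t₀ T Φ r N s x = ENNReal.ofReal
    (∫ t in t₀..T, lam * lossAt f M lam T t (Φ (doneBefore r N s x (ENNReal.ofReal t))
      (servedBefore r N s x (ENNReal.ofReal t)))) := by
  rw [intervalIntegral.integral_of_le hT, ofReal_integral_eq_lintegral_ofReal]
  · have h1 : lossInt f M lam t₀ T Φ r N s x = ∫⁻ t in Set.Ioi (0 : ℝ),
        (Set.Ico t₀ T).indicator (fun t => ENNReal.ofReal (lam * lossAt f M lam T t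
          (Φ (doneBefore r N s x (ENNReal.ofReal t)) (servedBefore r N s x (ENNReal.ofReal t))))) t :=
      lintegral_congr fun t => by
        by_cases h : t₀ ≤ t ∧ t < T
        · rw [if_pos h, Set.indicator_of_mem (show t ∈ Set.Ico t₀ T from h)]
        · rw [if_neg h, Set.indicator_of_notMem (show t ∉ Set.Ico t₀ T from h)]
    rw [h1, lintegral_indicator measurableSet_Ico, Measure.restrict_restrict measurableSet_Ico]
    refine setLIntegral_congr ?_
    have h2 : (Set.Ico t₀ T ∩ Set.Ioi 0 : Set ℝ) =ᵐ[volume] (Set.Ico t₀ T : Set ℝ) := by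
      rw [ae_eq_set]
      refine ⟨by simp [Set.sdiff_eq_empty.2 Set.inter_subset_left], ?_⟩
      refine measure_mono_null (t := {0}) ?_ (measure_singleton _)
      rintro y ⟨⟨h3, h3'⟩, h4⟩
      by_contra h5
      exact h4 ⟨⟨h3, h3'⟩, lt_of_le_of_ne (ht₀.trans h3) (Ne.symm h5)⟩
    exact h2.trans Ico_ae_eq_Ioc
  · refine Measure.integrableOn_of_bounded (M := lam * B) (by simp)
      (measurable_lossAt_state.const_mul lam).aestronglyMeasurable
      (Filter.Eventually.of_forall fun t => ?_)
    have h1 := lossAt_nonneg (M := M) (T := T) (t := t) hf hlam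
      (S := Φ (doneBefore r N s x (ENNReal.ofReal t)) (servedBefore r N s x (ENNReal.ofReal t)))
    have h2 := lossAt_le (M := M) (T := T) (t := t) hf0 hfB hlam
      (S := Φ (doneBefore r N s x (ENNReal.ofReal t)) (servedBefore r N s x (ENNReal.ofReal t)))
    refine (Real.norm_of_nonneg (mul_nonneg hlam h1)).trans_le ?_
    exact mul_le_mul_of_nonneg_left h2 hlam
  · exact Filter.Eventually.of_forall fun t => mul_nonneg hlam (lossAt_nonneg hf hlam)

lemma lossInt_le (hf0 : ∀ S, 0 ≤ f S) (hfB : ∀ S, f S ≤ B) (hlam : 0 ≤ lam) :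
    lossInt f M lam t₀ T Φ r N s x ≤ ENNReal.ofReal (lam * B) * ENNReal.ofReal (T - t₀) := by
  calc lossInt f M lam t₀ T Φ r N s x ≤ ∫⁻ t in Set.Ioi (0 : ℝ),
        (Set.Ico t₀ T).indicator (fun _ => ENNReal.ofReal (lam * B)) t := by
        refine lintegral_mono fun t => ?_
        by_cases h : t₀ ≤ t ∧ t < T
        · rw [if_pos h, Set.indicator_of_mem (show t ∈ Set.Ico t₀ T from h)]
          exact ENNReal.ofReal_le_ofReal (mul_le_mul_of_nonneg_left (lossAt_le hf0 hfB hlam) hlam)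
        · rw [if_neg h]
          exact zero_le
    _ ≤ ∫⁻ t, (Set.Ico t₀ T).indicator (fun _ => ENNReal.ofReal (lam * B)) t :=
        setLIntegral_le_lintegral _ _
    _ = _ := by
        rw [lintegral_indicator measurableSet_Ico, setLIntegral_const, Real.volume_Ico]

/-- The evolution when a download reduces the profile by at least one. -/
lemma mean_add_lossSum_le (hr : r.Valid N) (hf : Monotone f) (hf0 : ∀ S, 0 ≤ f S)
    (hfB : ∀ S, f S ≤ B) (hlam : 0 ≤ lam)
    (hΦ : ∀ D, ∀ V ⊆ chunks r N, FiniteBy M (Φ D V)) (ht₀ : 0 ≤ t₀) (hT : t₀ ≤ T)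
    (hone : ∀ e, (doneAt r N s x (ENNReal.ofReal e)).card ≤ 1)
    (hjump : ∀ e, t₀ ≤ e → e < T → Φ (doneBy r N s x (ENNReal.ofReal e))
      (servedAt r N s x (ENNReal.ofReal e)) ≤ sh (doneAt r N s x (ENNReal.ofReal e)).card
        (Φ (doneBefore r N s x (ENNReal.ofReal e)) (servedBefore r N s x (ENNReal.ofReal e)))) :
    ENNReal.ofReal (f (Φ (doneBefore r N s x (ENNReal.ofReal T))
      (servedBefore r N s x (ENNReal.ofReal T)))) + lossSum f M lam t₀ T Φ r N s x ≤
    ENNReal.ofReal (meanAt f M lam T t₀ (Φ (doneBefore r N s x (ENNReal.ofReal t₀))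
      (servedBefore r N s x (ENNReal.ofReal t₀)))) + lossInt f M lam t₀ T Φ r N s x := by
  have h1 := meanAt_sub_meanAt (s := s) (x := x) hr hf hf0 hfB hlam hΦ ht₀ hT
  rw [lossSum_eq hf hlam ht₀, lossInt_eq hf hf0 hfB hlam ht₀ hT,
    ← ENNReal.ofReal_add (hf0 _) (Finset.sum_nonneg fun e _ =>
      mul_nonneg (Nat.cast_nonneg _) (lossAt_nonneg hf hlam)),
    ← ENNReal.ofReal_add (meanAt_nonneg hf0 hlam) (intervalIntegral.integral_nonneg hT fun t _ =>
      mul_nonneg hlam (lossAt_nonneg hf hlam))]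
  refine ENNReal.ofReal_le_ofReal ?_
  rw [meanAt_self] at h1
  -- A download lowers the mean by at least the loss at that time; at any other event the mean does
  -- not increase.
  have h2 : ∑ e ∈ (insert t₀ (events r N s x)).filter (fun e => t₀ ≤ e ∧ e < T),
      (meanAt f M lam T e (Φ (doneBy r N s x (ENNReal.ofReal e))
        (servedAt r N s x (ENNReal.ofReal e))) -
      meanAt f M lam T e (Φ (doneBefore r N s x (ENNReal.ofReal e))
        (servedBefore r N s x (ENNReal.ofReal e)))) ≤
      ∑ e ∈ (insert t₀ (events r N s x)).filter (fun e => t₀ ≤ e ∧ e < T),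
      -((doneAt r N s x (ENNReal.ofReal e)).card * lossAt f M lam T e
        (Φ (doneBefore r N s x (ENNReal.ofReal e)) (servedBefore r N s x (ENNReal.ofReal e)))) := by
    refine Finset.sum_le_sum fun e he => ?_
    obtain ⟨-, h3, h4⟩ := Finset.mem_filter.1 he
    have h5 := meanAt_mono (M := M) (T := T) (t := e) hf hlam (hjump e h3 h4)
    rcases Nat.le_one_iff_eq_zero_or_eq_one.1 (hone e) with h6 | h6
    · rw [h6, sh_zero] at h5
      rw [h6]
      push_cast
      linarith
    · rw [h6] at h5
      have h7 := meanAt_sh_one (f := f) (M := M) (lam := lam) (T := T) (t := e)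
        (S := Φ (doneBefore r N s x (ENNReal.ofReal e)) (servedBefore r N s x (ENNReal.ofReal e)))
      rw [h6]
      push_cast
      linarith
  rw [Finset.sum_neg_distrib] at h2
  linarith

/-- The evolution when a download reduces the profile by at most one. -/
lemma mean_add_lossInt_le (hr : r.Valid N) (hf : Monotone f) (hf0 : ∀ S, 0 ≤ f S)
    (hfB : ∀ S, f S ≤ B) (hlam : 0 ≤ lam)
    (hΦ : ∀ D, ∀ V ⊆ chunks r N, FiniteBy M (Φ D V)) (ht₀ : 0 ≤ t₀) (hT : t₀ ≤ T)
    (hone : ∀ e, (doneAt r N s x (ENNReal.ofReal e)).card ≤ 1)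
    (hjump : ∀ e, t₀ ≤ e → e < T → sh (doneAt r N s x (ENNReal.ofReal e)).card
        (Φ (doneBefore r N s x (ENNReal.ofReal e)) (servedBefore r N s x (ENNReal.ofReal e))) ≤
        Φ (doneBy r N s x (ENNReal.ofReal e)) (servedAt r N s x (ENNReal.ofReal e))) :
    ENNReal.ofReal (meanAt f M lam T t₀ (Φ (doneBefore r N s x (ENNReal.ofReal t₀))
      (servedBefore r N s x (ENNReal.ofReal t₀)))) + lossInt f M lam t₀ T Φ r N s x ≤
    ENNReal.ofReal (f (Φ (doneBefore r N s x (ENNReal.ofReal T))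
      (servedBefore r N s x (ENNReal.ofReal T)))) + lossSum f M lam t₀ T Φ r N s x := by
  have h1 := meanAt_sub_meanAt (s := s) (x := x) hr hf hf0 hfB hlam hΦ ht₀ hT
  rw [lossSum_eq hf hlam ht₀, lossInt_eq hf hf0 hfB hlam ht₀ hT,
    ← ENNReal.ofReal_add (hf0 _) (Finset.sum_nonneg fun e _ =>
      mul_nonneg (Nat.cast_nonneg _) (lossAt_nonneg hf hlam)),
    ← ENNReal.ofReal_add (meanAt_nonneg hf0 hlam) (intervalIntegral.integral_nonneg hT fun t _ =>
      mul_nonneg hlam (lossAt_nonneg hf hlam))]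
  refine ENNReal.ofReal_le_ofReal ?_
  rw [meanAt_self] at h1
  have h2 : ∑ e ∈ (insert t₀ (events r N s x)).filter (fun e => t₀ ≤ e ∧ e < T),
      -((doneAt r N s x (ENNReal.ofReal e)).card * lossAt f M lam T e
        (Φ (doneBefore r N s x (ENNReal.ofReal e)) (servedBefore r N s x (ENNReal.ofReal e)))) ≤
      ∑ e ∈ (insert t₀ (events r N s x)).filter (fun e => t₀ ≤ e ∧ e < T),
      (meanAt f M lam T e (Φ (doneBy r N s x (ENNReal.ofReal e))
        (servedAt r N s x (ENNReal.ofReal e))) -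
      meanAt f M lam T e (Φ (doneBefore r N s x (ENNReal.ofReal e))
        (servedBefore r N s x (ENNReal.ofReal e)))) := by
    refine Finset.sum_le_sum fun e he => ?_
    obtain ⟨-, h3, h4⟩ := Finset.mem_filter.1 he
    have h5 := meanAt_mono (M := M) (T := T) (t := e) hf hlam (hjump e h3 h4)
    rcases Nat.le_one_iff_eq_zero_or_eq_one.1 (hone e) with h6 | h6
    · rw [h6, sh_zero] at h5
      rw [h6]
      push_cast
      linarith
    · rw [h6] at h5
      have h7 := meanAt_sh_one (f := f) (M := M) (lam := lam) (T := T) (t := e)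
        (S := Φ (doneBefore r N s x (ENNReal.ofReal e)) (servedBefore r N s x (ENNReal.ofReal e)))
      rw [h6]
      push_cast
      linarith
  rw [Finset.sum_neg_distrib] at h2
  linarith

lemma card_doneAt_le (hties : ∀ j l, j ≠ l → s j ≠ ⊤ → finish s x j ≠ finish s x l) (t : ℝ≥0∞) :
    (doneAt r N s x t).card ≤ 1 := by
  refine Finset.card_le_one.2 fun j hj l hl => ?_
  obtain ⟨h1, h2⟩ := Finset.mem_filter.1 hj
  by_contra hne
  exact hties j l hne (mem_everDone.1 h1).2.1 (h2.trans (Finset.mem_filter.1 hl).2.symm)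

/-! ### Comparison in the mean with Poisson reductions -/

namespace Adapted

variable {S : (Chunk → ℝ) → Chunk → ℝ≥0∞} {μ : ℝ}

/-- The integrand is the same for every chunk, so the total intensity is `μ` times the number of
busy threads. -/
lemma lintegral_lossSum (hμ : 0 < μ) (hr : r.Valid N) (hS : Adapted L r N S) :
    ∫⁻ x, lossSum f M lam t₀ T Φ r N (S x) x
        ∂(Measure.infinitePi fun _ : Chunk => expMeasure μ) =
      ∫⁻ x, ∫⁻ t in Set.Ioi (0 : ℝ), if t₀ ≤ t ∧ t < T then
        (servedBefore r N (S x) x (ENNReal.ofReal t)).card * (ENNReal.ofReal μ *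
          ENNReal.ofReal (lossAt f M lam T t (Φ (doneBefore r N (S x) x (ENNReal.ofReal t))
          (servedBefore r N (S x) x (ENNReal.ofReal t))))) else 0 ∂volume
        ∂(Measure.infinitePi fun _ : Chunk => expMeasure μ) := by
  have h := hS.lintegral_sum_everDone hμ hr (G := fun _ t D V => if t₀ ≤ t ∧ t < T then
    ENNReal.ofReal (lossAt f M lam T t (Φ D V)) else 0) fun _ D V =>
      Measurable.ite (measurableSet_Ico (a := t₀) (b := T))
        continuous_lossAt.measurable.ennreal_ofReal measurable_const
  refine h.trans (lintegral_congr fun x => lintegral_congr fun t => ?_)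
  rw [Finset.sum_const, nsmul_eq_mul]
  split_ifs <;> simp

lemma measurable_profile (hS : Adapted L r N S) {γ : Type*} [MeasurableSpace γ]
    (g : (ℕ → ℕ∞) → γ) (t : ℝ≥0∞) : Measurable fun x =>
      g (Φ (doneBefore r N (S x) x t) (servedBefore r N (S x) x t)) :=
  measurable_state (s := S) (x := fun x => x) (t := fun _ => t)
    (G := fun _ D V => g (Φ D V)) hS.measurable measurable_pi_apply measurable_const
    fun _ _ => measurable_const

lemma lintegral_lossInt_ne_top (hμ : 0 < μ) (hf0 : ∀ S, 0 ≤ f S) (hfB : ∀ S, f S ≤ B)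
    (hlam : 0 ≤ lam) :
    ∫⁻ x, lossInt f M lam t₀ T Φ r N (S x) x
      ∂(Measure.infinitePi fun _ : Chunk => expMeasure μ) ≠ ⊤ := by
  have hprob := isProbabilityMeasure_expMeasure hμ
  refine ne_top_of_le_ne_top ?_ (lintegral_mono fun x => lossInt_le hf0 hfB hlam)
  rw [lintegral_const, measure_univ, mul_one]
  exact ENNReal.mul_ne_top ENNReal.ofReal_ne_top ENNReal.ofReal_ne_top

/-- When all threads are busy, or else no download changes the profile, and when a download reduces
the profile by at least one, the profile decreases faster than at the times of a Poisson process. -/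
lemma lintegral_le_mean (hμ : 0 < μ) (hr : r.Valid N) (hS : Adapted L r N S) (hf : Monotone f)
    (hf0 : ∀ S, 0 ≤ f S) (hfB : ∀ S, f S ≤ B)
    (hΦ : ∀ D, ∀ V ⊆ chunks r N, FiniteBy M (Φ D V)) (ht₀ : 0 ≤ t₀) (hT : t₀ ≤ T)
    (hjump : ∀ᵐ x ∂(Measure.infinitePi fun _ : Chunk => expMeasure μ), ∀ e, t₀ ≤ e → e < T →
      Φ (doneBy r N (S x) x (ENNReal.ofReal e)) (servedAt r N (S x) x (ENNReal.ofReal e)) ≤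
        sh (doneAt r N (S x) x (ENNReal.ofReal e)).card
        (Φ (doneBefore r N (S x) x (ENNReal.ofReal e))
          (servedBefore r N (S x) x (ENNReal.ofReal e))))
    (hbusy : ∀ᵐ x ∂(Measure.infinitePi fun _ : Chunk => expMeasure μ), ∀ t, t₀ < t → t < T →
      (servedBefore r N (S x) x (ENNReal.ofReal t)).card = L ∨
        sh 1 (Φ (doneBefore r N (S x) x (ENNReal.ofReal t))
          (servedBefore r N (S x) x (ENNReal.ofReal t))) =
        Φ (doneBefore r N (S x) x (ENNReal.ofReal t))
          (servedBefore r N (S x) x (ENNReal.ofReal t))) :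
    ∫⁻ x, ENNReal.ofReal (f (Φ (doneBefore r N (S x) x (ENNReal.ofReal T))
      (servedBefore r N (S x) x (ENNReal.ofReal T))))
      ∂(Measure.infinitePi fun _ : Chunk => expMeasure μ) ≤
    ∫⁻ x, ENNReal.ofReal (meanAt f M (L * μ) T t₀ (Φ (doneBefore r N (S x) x (ENNReal.ofReal t₀))
      (servedBefore r N (S x) x (ENNReal.ofReal t₀))))
      ∂(Measure.infinitePi fun _ : Chunk => expMeasure μ) := by
  have hlam : 0 ≤ L * μ := by positivity
  have h1 := lintegral_mono_ae (μ := Measure.infinitePi fun _ : Chunk => expMeasure μ)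
    (f := fun x => ENNReal.ofReal (f (Φ (doneBefore r N (S x) x (ENNReal.ofReal T))
      (servedBefore r N (S x) x (ENNReal.ofReal T)))) +
      lossSum f M (L * μ) t₀ T Φ r N (S x) x)
    (g := fun x => ENNReal.ofReal (meanAt f M (L * μ) T t₀
      (Φ (doneBefore r N (S x) x (ENNReal.ofReal t₀))
      (servedBefore r N (S x) x (ENNReal.ofReal t₀)))) +
      lossInt f M (L * μ) t₀ T Φ r N (S x) x) (by
      filter_upwards [hS.ae_finish_ne hμ hr, hjump] with x hx1 hx2
      exact mean_add_lossSum_le hr hf hf0 hfB hlam hΦ ht₀ hT (fun e => card_doneAt_le hx1 _) hx2)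
  have h2 := (le_lintegral_add _ _).trans h1
  rw [lintegral_add_left (hS.measurable_profile
    (fun S => ENNReal.ofReal (meanAt f M (L * μ) T t₀ S)) _)] at h2
  -- Busy threads yield the full rate `L * μ`; when not all are busy, a reduction does not change
  -- the profile and the loss is zero. The time `t₀` itself is a null set.
  have h3 : ∫⁻ x, lossInt f M (L * μ) t₀ T Φ r N (S x) x
      ∂(Measure.infinitePi fun _ : Chunk => expMeasure μ) ≤
      ∫⁻ x, lossSum f M (L * μ) t₀ T Φ r N (S x) x
      ∂(Measure.infinitePi fun _ : Chunk => expMeasure μ) := by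
    rw [hS.lintegral_lossSum hμ hr]
    refine lintegral_mono_ae ?_
    filter_upwards [hbusy] with x hx
    refine lintegral_mono_ae ?_
    have hne : ∀ᵐ t ∂(volume.restrict (Set.Ioi (0 : ℝ))), t ≠ t₀ :=
      ae_restrict_of_ae (by simp [ae_iff])
    filter_upwards [hne] with t ht
    split_ifs with h4
    · rcases hx t (lt_of_le_of_ne h4.1 (Ne.symm ht)) h4.2 with h5 | h5
      · rw [h5, mul_assoc, ENNReal.ofReal_mul (Nat.cast_nonneg _), ENNReal.ofReal_mul hμ.le,
          ENNReal.ofReal_natCast]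
      · rw [lossAt, poisLoss, h5]
        simp
    · exact le_rfl
  -- Cancellation in `ℝ≥0∞` is legitimate because the mean of the time integral is finite.
  exact ENNReal.le_of_add_le_add_right (lintegral_lossInt_ne_top hμ hf0 hfB hlam)
    ((add_le_add_right h3 _).trans h2)

/-- When a download reduces the profile by at most one, the profile decreases slower than at the
times of a Poisson process. -/
lemma mean_le_lintegral (hμ : 0 < μ) (hr : r.Valid N) (hS : Adapted L r N S) (hf : Monotone f)
    (hf0 : ∀ S, 0 ≤ f S) (hfB : ∀ S, f S ≤ B)
    (hΦ : ∀ D, ∀ V ⊆ chunks r N, FiniteBy M (Φ D V)) (ht₀ : 0 ≤ t₀) (hT : t₀ ≤ T)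
    (hjump : ∀ᵐ x ∂(Measure.infinitePi fun _ : Chunk => expMeasure μ), ∀ e, t₀ ≤ e → e < T →
        sh (doneAt r N (S x) x (ENNReal.ofReal e)).card
        (Φ (doneBefore r N (S x) x (ENNReal.ofReal e))
          (servedBefore r N (S x) x (ENNReal.ofReal e))) ≤
      Φ (doneBy r N (S x) x (ENNReal.ofReal e)) (servedAt r N (S x) x (ENNReal.ofReal e))) :
    ∫⁻ x, ENNReal.ofReal (meanAt f M (L * μ) T t₀ (Φ (doneBefore r N (S x) x (ENNReal.ofReal t₀))
      (servedBefore r N (S x) x (ENNReal.ofReal t₀))))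
      ∂(Measure.infinitePi fun _ : Chunk => expMeasure μ) ≤
    ∫⁻ x, ENNReal.ofReal (f (Φ (doneBefore r N (S x) x (ENNReal.ofReal T))
      (servedBefore r N (S x) x (ENNReal.ofReal T))))
      ∂(Measure.infinitePi fun _ : Chunk => expMeasure μ) := by
  have hlam : 0 ≤ L * μ := by positivity
  have h1 := lintegral_mono_ae (μ := Measure.infinitePi fun _ : Chunk => expMeasure μ)
    (f := fun x => ENNReal.ofReal (meanAt f M (L * μ) T t₀
      (Φ (doneBefore r N (S x) x (ENNReal.ofReal t₀))
      (servedBefore r N (S x) x (ENNReal.ofReal t₀)))) +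
      lossInt f M (L * μ) t₀ T Φ r N (S x) x)
    (g := fun x => ENNReal.ofReal (f (Φ (doneBefore r N (S x) x (ENNReal.ofReal T))
      (servedBefore r N (S x) x (ENNReal.ofReal T)))) +
      lossSum f M (L * μ) t₀ T Φ r N (S x) x) (by
      filter_upwards [hS.ae_finish_ne hμ hr, hjump] with x hx1 hx2
      exact mean_add_lossInt_le hr hf hf0 hfB hlam hΦ ht₀ hT (fun e => card_doneAt_le hx1 _) hx2)
  have h2 := (le_lintegral_add _ _).trans h1
  rw [lintegral_add_left (hS.measurable_profile (fun S => ENNReal.ofReal (f S)) _)] at h2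
  -- Any policy has at most `L` busy threads, so its downloads come at rate at most `L * μ`.
  have h3 : ∫⁻ x, lossSum f M (L * μ) t₀ T Φ r N (S x) x
      ∂(Measure.infinitePi fun _ : Chunk => expMeasure μ) ≤
      ∫⁻ x, lossInt f M (L * μ) t₀ T Φ r N (S x) x
      ∂(Measure.infinitePi fun _ : Chunk => expMeasure μ) := by
    rw [hS.lintegral_lossSum hμ hr]
    refine lintegral_mono_ae ?_
    filter_upwards [ae_pos_infinitePi hμ] with x hx
    refine setLIntegral_mono' measurableSet_Ioi fun t ht => ?_
    split_ifs with h4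
    · rw [mul_assoc, ENNReal.ofReal_mul (Nat.cast_nonneg _), ENNReal.ofReal_mul hμ.le,
        ENNReal.ofReal_natCast]
      gcongr
      exact (hS.feasible x hx).card_servedBefore_le hr ht
    · exact le_rfl
  exact ENNReal.le_of_add_le_add_right (lintegral_lossInt_ne_top (S := S) hμ hf0 hfB hlam)
    (h2.trans (add_le_add_right h3 _))

end Adapted

end Mean

/-! ### Comparison with an arbitrary policy -/

/-- `need r R D p` is the smallest number of chunks with which `p` of the requests in `R` can be
completed. -/
noncomputable def need (r : Requests) (R : Finset ℕ) (D : Finset Chunk) : ℕ → ℕ∞ :=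
  level (rem r D) 0 ∅ R

section Need

variable {L N : ℕ} {r : Requests} {R : Finset ℕ} {D V : Finset Chunk}

lemma cost_need (Q : Finset ℕ) : cost (rem r D) 0 ∅ R Q = ∑ i ∈ Q, rem r D i := by
  simp [cost]

/-- A chunk reduces the need of its own request only, and by at most one. -/
lemma sh_one_need_le {j : Chunk} (hj : j ∉ D) : sh 1 (need r R D) ≤ need r R (insert j D) := by
  intro p
  rw [sh, Nat.cast_one, tsub_le_iff_right]
  refine level_le_add (c := 1) fun Q hQ hc => ⟨Q, hQ, hc, ?_⟩
  rw [cost_need, cost_need]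
  calc ∑ i ∈ Q, rem r D i ≤ ∑ i ∈ Q, (rem r (insert j D) i + if j.1 = i then 1 else 0) := by
        refine Finset.sum_le_sum fun i _ => ?_
        rw [rem, rem, cnt_insert hj]
        omega
    _ ≤ _ := by
        rw [Finset.sum_add_distrib, Finset.sum_ite_eq]
        gcongr
        split_ifs <;> omega

/-- A group with the new request costs `r.k l` more than the rest of the group; a group without it
was possible before. -/
lemma arrive_need_le {l : ℕ} (hD : cnt D l = 0) :
    arrive (r.k l) (need r R D) ≤ need r (insert l R) D := by
  intro p
  cases p with
  | zero => simp [arrive, need, level_zero]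
  | succ p =>
    refine Finset.le_inf fun Q hQ => ?_
    rw [Finset.mem_powersetCard] at hQ
    rw [cost_need, arrive]
    by_cases hl : l ∈ Q
    · refine (min_le_right _ _).trans ?_
      have h1 : need r R D p ≤ (cost (rem r D) 0 ∅ R (Q.erase l) : ℕ∞) := by
        refine Finset.inf_le (f := fun Q => (cost (rem r D) 0 ∅ R Q : ℕ∞))
          (Finset.mem_powersetCard.2 ⟨?_, ?_⟩)
        · rw [← Finset.subset_insert_iff]
          exact hQ.1
        · rw [Finset.card_erase_of_mem hl, hQ.2]
          rfl
      rw [cost_need] at h1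
      rw [← Finset.sum_erase_add Q _ hl, Nat.cast_add]
      refine add_le_add h1 ?_
      rw [rem, hD, Nat.sub_zero]
    · refine (min_le_left _ _).trans ?_
      rw [← cost_need]
      refine Finset.inf_le (f := fun Q => (cost (rem r D) 0 ∅ R Q : ℕ∞))
        (Finset.mem_powersetCard.2 ⟨?_, hQ.2⟩)
      exact (Finset.subset_insert_iff_of_notMem hl).1 hQ.1

/-- The number of positive values of a profile. -/
noncomputable def positives (N : ℕ) (S : ℕ → ℕ∞) : ℕ :=
  ((Finset.range N).filter fun p => S (p + 1) ≠ 0).card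

lemma positives_mono : Monotone (positives N) := by
  intro S S' h
  refine Finset.card_le_card fun p hp => ?_
  rw [Finset.mem_filter] at hp ⊢
  exact ⟨hp.1, fun h1 => hp.2 (le_antisymm ((h (p + 1)).trans_eq h1) zero_le)⟩

lemma positives_le (S : ℕ → ℕ∞) : positives N S ≤ N :=
  (Finset.card_filter_le _ _).trans (Finset.card_range N).le

/-- A group of completed requests costs nothing, so `need` vanishes up to their number. -/
lemma positives_need_le :
    positives N (need r R D) ≤ N - (R.filter fun i => r.k i ≤ cnt D i).card := by
  set Z := R.filter fun i => r.k i ≤ cnt D i with hZ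
  have h1 : (Finset.range N).filter (fun p => need r R D (p + 1) ≠ 0) ⊆ Finset.Ico Z.card N := by
    intro p hp
    rw [Finset.mem_filter, Finset.mem_range] at hp
    rw [Finset.mem_Ico]
    refine ⟨?_, hp.1⟩
    by_contra! h2
    obtain ⟨Q, hQ, hc⟩ := Finset.exists_subset_card_eq (show p + 1 ≤ Z.card by omega)
    have h3 : need r R D (p + 1) ≤ (cost (rem r D) 0 ∅ R Q : ℕ∞) :=
      Finset.inf_le (f := fun Q => (cost (rem r D) 0 ∅ R Q : ℕ∞))
        (Finset.mem_powersetCard.2 ⟨hQ.trans (Finset.filter_subset _ _), hc⟩)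
    rw [cost_need, Finset.sum_eq_zero] at h3
    · exact hp.2 (le_antisymm h3 zero_le)
    · intro i hi
      have := (Finset.mem_filter.1 (hQ hi)).2
      rw [rem]
      omega
  exact (Finset.card_le_card h1).trans (Nat.card_Ico _ _).le

/-- The base of the induction over arrivals: without requests `need` is `⊤` at every positive index,
whatever the two states are. -/
lemma prof_empty_le {D' : Finset Chunk} : prof L r ∅ D V ≤ need r ∅ D' := by
  intro p
  cases p with
  | zero => simp [prof, profile]
  | succ p =>
    have : need r ∅ D' (p + 1) = ⊤ := by simp [need, level]
    rw [this]
    exact le_top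

lemma level_le_or_eq_top {α δ : ℕ → ℕ} {E A : Finset ℕ} {M : ℕ}
    (h : ∀ Q ⊆ A, cost α δ E A Q ≤ M) (q : ℕ) : level α δ E A q ≤ M ∨ level α δ E A q = ⊤ := by
  rcases (A.powersetCard q).eq_empty_or_nonempty with h0 | h0
  · right
    simp [level, h0]
  · left
    obtain ⟨Q, hQ, heq⟩ := Finset.exists_mem_eq_inf _ h0 fun Q => (cost α δ E A Q : ℕ∞)
    rw [level, heq]
    exact_mod_cast h Q (Finset.mem_powersetCard.1 hQ).1

/-- A bound for the finite values of all profiles. -/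
def maxLevel (r : Requests) (N : ℕ) : ℕ :=
  ∑ i ∈ Finset.range N, r.k i + ∑ i ∈ Finset.range N, r.k i +
    ∑ _i ∈ Finset.range N, (chunks r N).card

lemma sum_rem_le {Q : Finset ℕ} (hQ : Q ⊆ Finset.range N) :
    ∑ i ∈ Q, rem r D i ≤ ∑ i ∈ Finset.range N, r.k i :=
  (Finset.sum_le_sum fun _ _ => Nat.sub_le _ _).trans (Finset.sum_le_sum_of_subset hQ)

lemma finiteBy_need (hR : R ⊆ Finset.range N) : FiniteBy (maxLevel r N) (need r R D) := by
  refine fun p => level_le_or_eq_top (fun Q hQ => ?_) p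
  rw [cost_need]
  have := sum_rem_le (r := r) (D := D) (hQ.trans hR)
  rw [maxLevel]
  omega

lemma finiteBy_prof (hR : R ⊆ Finset.range N) (hV : V ⊆ chunks r N) :
    FiniteBy (maxLevel r N) (prof L r R D V) := by
  intro p
  rw [prof, profile]
  split_ifs with hp
  · exact Or.inl zero_le
  · refine (level_le_or_eq_top (M := maxLevel r N) (fun Q hQ => ?_) (p - (exh r R D V).card)).imp
      (fun h => tsub_le_self.trans h) fun h => ?_
    · have hA : avail r R D V ⊆ Finset.range N := (Finset.filter_subset _ _).trans hR
      have h1 := sum_rem_le (r := r) (D := D) (hQ.trans hA)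
      have h2 := sum_rem_le (r := r) (D := D) (Q := exh r R D V)
        ((Finset.filter_subset _ _).trans hR)
      have h3 : ∑ i ∈ avail r R D V \ Q, cnt V i ≤ ∑ _i ∈ Finset.range N, (chunks r N).card :=
        (Finset.sum_le_sum fun i _ => (Finset.card_filter_le _ _).trans
          (Finset.card_le_card hV)).trans
          (Finset.sum_le_sum_of_subset (Finset.sdiff_subset.trans hA))
      rw [cost, maxLevel]
      omega
    · rw [lev, h]
      rfl

/-- Without available requests the levels of positive index are `⊤`, so the profile only has the
values `0` and `⊤`. This settles the times at which SEDPT-R leaves threads idle. -/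
lemma sh_one_prof (h : avail r R D V = ∅) : sh 1 (prof L r R D V) = prof L r R D V := by
  funext p
  rw [sh, prof, profile]
  split_ifs with hp
  · rfl
  · have : lev r R D V (p - (exh r R D V).card) = ⊤ := by
      rw [lev, level, h, Finset.powersetCard_eq_empty.2 (by rw [Finset.card_empty]; omega),
        Finset.inf_empty]
    rw [this]
    rfl

variable {s : Chunk → ℝ≥0∞} {x : Chunk → ℝ}

lemma sh_need_le (hties : ∀ j l, j ≠ l → s j ≠ ⊤ → finish s x j ≠ finish s x l) {t : ℝ≥0∞}
    (ht : t ≠ ⊤) : sh (doneAt r N s x t).card (need r R (doneBefore r N s x t)) ≤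
      need r R (doneBy r N s x t) := by
  rcases (doneAt r N s x t).eq_empty_or_nonempty with h0 | ⟨j, hj⟩
  · rw [h0, Finset.card_empty, sh_zero, doneBy_eq_doneBefore ht]
    exact fun j hj hjt => absurd (h0 ▸ Finset.mem_filter.2 ⟨hj, hjt⟩ : j ∈ (∅ : Finset Chunk))
      (Finset.notMem_empty j)
  · obtain ⟨hjd, rfl⟩ := Finset.mem_filter.1 hj
    have h1 : (doneAt r N s x (finish s x j)).card = 1 :=
      le_antisymm (card_doneAt_le hties _) (Finset.card_pos.2 ⟨j, hj⟩)
    rw [h1, doneBy_eq_insert hties hjd]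
    exact sh_one_need_le notMem_doneBefore_finish

end Need

section Compare

variable {L N : ℕ} {r : Requests} {S S' : (Chunk → ℝ) → Chunk → ℝ≥0∞} {μ : ℝ}

lemma one_le_dist (i : ℕ) : 1 ≤ r.n i - r.k i + 1 := by omega

lemma arrivedBy_eq_range {m : ℕ} {T e : ℝ} (hm : m ≤ N) (h1 : ∀ i < m, (r.a i : ℝ) ≤ e)
    (h2 : ∀ i, m ≤ i → i < N → T ≤ r.a i) (he : e < T) : arrivedBy r N e = Finset.range m := by
  ext i
  rw [mem_arrivedBy, Finset.mem_range]
  constructor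
  · rintro ⟨h3, h4⟩
    by_contra! h5
    linarith [h2 i h5 h3]
  · exact fun h => ⟨h.trans_le hm, h1 i h⟩

lemma arrivedBefore_eq_range {m : ℕ} {T e : ℝ} (hm : m ≤ N) (h1 : ∀ i < m, (r.a i : ℝ) < e)
    (h2 : ∀ i, m ≤ i → i < N → T ≤ r.a i) (he : e ≤ T) :
    arrivedBefore r N e = Finset.range m := by
  ext i
  rw [mem_arrivedBefore, Finset.mem_range]
  constructor
  · rintro ⟨h3, h4⟩
    by_contra! h5
    linarith [h2 i h5 h3]
  · exact fun h => ⟨h.trans_le hm, h1 i h⟩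

/-- The profile of SEDPT-R is stochastically smaller than that of any other policy. -/
theorem lintegral_prof_le_lintegral_need (hμ : 0 < μ) (hr : r.Valid N) (hS : Adapted L r N S)
    (hg : ∀ x, (∀ j, 0 < x j) → IsGreedy L r N x (S x)) (hS' : Adapted L r N S') {B : ℝ} (m : ℕ)
    (hm : m ≤ N) (T : ℝ) (h1 : ∀ i < m, (r.a i : ℝ) ≤ T)
    (h2 : ∀ i, m ≤ i → i < N → T ≤ r.a i) (f : (ℕ → ℕ∞) → ℝ) (hf : Monotone f)
    (hf0 : ∀ S, 0 ≤ f S) (hfB : ∀ S, f S ≤ B) :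
    ∫⁻ x, ENNReal.ofReal (f (prof L r (Finset.range m) (doneBefore r N (S x) x (ENNReal.ofReal T))
      (servedBefore r N (S x) x (ENNReal.ofReal T))))
      ∂(Measure.infinitePi fun _ : Chunk => expMeasure μ) ≤
    ∫⁻ x, ENNReal.ofReal (f (need r (Finset.range m)
      (doneBefore r N (S' x) x (ENNReal.ofReal T))))
      ∂(Measure.infinitePi fun _ : Chunk => expMeasure μ) := by
  -- The functional has to vary, since the evolution after an arrival is pulled back into it.
  -- Simultaneous arrivals are treated one at a time, with `T` equal to the common arrival time.
  induction m generalizing T f with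
  | zero =>
    refine lintegral_mono fun x => ENNReal.ofReal_le_ofReal (hf ?_)
    rw [Finset.range_zero]
    exact prof_empty_le
  | succ m ih =>
    have hmN : ((m : ℕ∞)) < (N : ℕ∞) := by exact_mod_cast (by omega : m < N)
    have hmono : ∀ i < N, m ≤ i → (r.a m : ℝ) ≤ r.a i := fun i hi hmi => by
      exact_mod_cast hr.monotone m i hmi (by exact_mod_cast hi)
    have hmono' : ∀ i ≤ m, (r.a i : ℝ) ≤ r.a m := fun i hi => by
      exact_mod_cast hr.monotone i m hi hmN
    have hR : Finset.range (m + 1) ⊆ Finset.range N := Finset.range_subset_range.2 hm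
    set t₀ : ℝ := (r.a m : ℝ) with ht₀
    have ht0 : 0 ≤ t₀ := (r.a m).2
    have hT : t₀ ≤ T := h1 m (by omega)
    have hlam : 0 ≤ L * μ := by positivity
    -- The mean of `f` at time `T` for the Poisson reductions, seen from just before the arrival of
    -- request `m`; it is monotone and bounded like `f`.
    set g : (ℕ → ℕ∞) → ℝ := fun S => meanAt f (maxLevel r N) (L * μ) T t₀ (arrive (r.k m) S) with hgdef
    have hgm : Monotone g := fun S S' h => meanAt_mono hf hlam (arrive_mono _ h)
    have hg0 : ∀ S, 0 ≤ g S := fun S => meanAt_nonneg hf0 hlam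
    have hgB : ∀ S, g S ≤ B := fun S => poisMean_le hfB (by positivity)
    have hby : ∀ e, t₀ ≤ e → e < T → arrivedBy r N e = Finset.range (m + 1) := fun e he heT =>
      arrivedBy_eq_range hm (fun i hi => (hmono' i (by omega)).trans he) h2 heT
    have hbefore : ∀ e, t₀ < e → e ≤ T → arrivedBefore r N e = Finset.range (m + 1) :=
      fun e he heT => arrivedBefore_eq_range hm
        (fun i hi => (hmono' i (by omega)).trans_lt he) h2 heT
    have hgood : ∀ᵐ x ∂(Measure.infinitePi fun _ : Chunk => expMeasure μ), (∀ j, 0 < x j) ∧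
        ∀ j l, j ≠ l → S x j ≠ ⊤ → finish (S x) x j ≠ finish (S x) x l :=
      (ae_pos_infinitePi hμ).and (hS.ae_finish_ne hμ hr)
    have hinv : ∀ᵐ x ∂(Measure.infinitePi fun _ : Chunk => expMeasure μ), ∀ t, 0 ≤ t →
        Inv L r (arrivedBefore r N t) (doneBefore r N (S x) x (ENNReal.ofReal t))
          (servedBefore r N (S x) x (ENNReal.ofReal t)) := by
      filter_upwards [hgood] with x hx t ht
      exact ((hg x hx.1).inv_pot le_rfl (fun i _ => one_le_dist i) hr (hS.feasible x hx.1) hx.1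
        hx.2 ht).1
    calc _ ≤ ∫⁻ x, ENNReal.ofReal (meanAt f (maxLevel r N) (L * μ) T t₀
          (prof L r (Finset.range (m + 1)) (doneBefore r N (S x) x (ENNReal.ofReal t₀))
          (servedBefore r N (S x) x (ENNReal.ofReal t₀))))
          ∂(Measure.infinitePi fun _ : Chunk => expMeasure μ) := by
          refine hS.lintegral_le_mean (Φ := fun D V => prof L r (Finset.range (m + 1)) D V) hμ hr
            hf hf0 hfB (fun D V hV => finiteBy_prof hR hV) ht0 hT ?_ ?_
          · filter_upwards [hgood, hinv] with x hx hxi e he heT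
            obtain ⟨e1, -⟩ := inv_of_arrivedBefore (L := L) (d := 1) le_rfl hr
              (hS.feasible x hx.1) (fun i hi => mem_arrivedBy.2
                ⟨(mem_arrivedBefore.1 hi).1, (mem_arrivedBefore.1 hi).2.le⟩) subset_rfl
              (hxi e (ht0.trans he))
            have := ((hg x hx.1).jump le_rfl (fun i _ => one_le_dist i) hr (hS.feasible x hx.1)
              hx.1 hx.2 (ht0.trans he) e1).2.1
            rwa [hby e he heT] at this
          · filter_upwards [hgood] with x hx t ht htT
            have := (hg x hx.1).busy_before hr (hS.feasible x hx.1) (ht0.trans_lt ht)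
            rw [hbefore t ht htT.le] at this
            exact this.symm.imp_right sh_one_prof
      _ ≤ ∫⁻ x, ENNReal.ofReal (g (prof L r (Finset.range m)
          (doneBefore r N (S x) x (ENNReal.ofReal t₀))
          (servedBefore r N (S x) x (ENNReal.ofReal t₀))))
          ∂(Measure.infinitePi fun _ : Chunk => expMeasure μ) := by
          refine lintegral_mono_ae ?_
          filter_upwards [hgood, hinv] with x hx hxi
          refine ENNReal.ofReal_le_ofReal (meanAt_mono hf hlam ?_)
          obtain ⟨e1, -⟩ := inv_of_arrivedBefore (L := L) (d := 1) (R := Finset.range m) le_rfl hr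
              (hS.feasible x hx.1) (fun i hi => by
                obtain ⟨h3, h4⟩ := mem_arrivedBefore.1 hi
                rw [Finset.mem_range]
                by_contra! h5
                exact absurd h4 (not_lt.2 (hmono i h3 h5)))
              (fun i hi => by
                rw [Finset.mem_range] at hi
                exact mem_arrivedBy.2 ⟨by omega, hmono' i hi.le⟩) (hxi t₀ ht0)
          obtain ⟨h3, h4⟩ := (hS.feasible x hx.1).cnt_before_eq_zero (t := t₀) (i := m) le_rfl
          have := (e1.arrival (d := 1) (N := N) le_rfl Finset.notMem_range_self h3 h4
            (hr.one_le_k m hmN) (hr.k_le_n m hmN)).2.1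
          rwa [← Finset.range_add_one] at this
      _ ≤ ∫⁻ x, ENNReal.ofReal (g (need r (Finset.range m)
          (doneBefore r N (S' x) x (ENNReal.ofReal t₀))))
          ∂(Measure.infinitePi fun _ : Chunk => expMeasure μ) :=
          ih (by omega) t₀ (fun i hi => hmono' i hi.le) (fun i hi hiN => hmono i hiN hi) g hgm hg0
            hgB
      _ ≤ ∫⁻ x, ENNReal.ofReal (meanAt f (maxLevel r N) (L * μ) T t₀
          (need r (Finset.range (m + 1)) (doneBefore r N (S' x) x (ENNReal.ofReal t₀))))
          ∂(Measure.infinitePi fun _ : Chunk => expMeasure μ) := by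
          refine lintegral_mono_ae ?_
          filter_upwards [ae_pos_infinitePi hμ] with x hx
          refine ENNReal.ofReal_le_ofReal (meanAt_mono hf hlam ?_)
          obtain ⟨h3, -⟩ := (hS'.feasible x hx).cnt_before_eq_zero (t := t₀) (i := m) le_rfl
          have := arrive_need_le (r := r) (R := Finset.range m) h3
          rwa [← Finset.range_add_one] at this
      _ ≤ _ := by
          refine hS'.mean_le_lintegral (Φ := fun D _ => need r (Finset.range (m + 1)) D) hμ hr
            hf hf0 hfB (fun D V _ => finiteBy_need hR) ht0 hT ?_
          filter_upwards [hS'.ae_finish_ne hμ hr] with x hx e _ _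
          exact sh_need_le hx ENNReal.ofReal_ne_top

end Compare

/-! ### Flow times -/

section Flow

variable {d L N : ℕ} {r : Requests} {s : Chunk → ℝ≥0∞} {x : Chunk → ℝ} {μ : ℝ}

open Classical in
/-- The number of requests that are not completed before time `t`. -/
noncomputable def pending (r : Requests) (N : ℕ) (s : Chunk → ℝ≥0∞) (x : Chunk → ℝ) (t : ℝ≥0∞) :
    ℕ :=
  ((Finset.range N).filter fun i => t ≤ complTime r s x i).card

lemma lintegral_indicator_le (c : ℝ≥0∞) :
    ∫⁻ t in Set.Ioi (0 : ℝ), {t : ℝ | ENNReal.ofReal t ≤ c}.indicator 1 t = c := by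
  have hmeas : MeasurableSet {t : ℝ | ENNReal.ofReal t ≤ c} :=
    measurableSet_le ENNReal.measurable_ofReal measurable_const
  rw [lintegral_indicator_one hmeas, Measure.restrict_apply hmeas]
  by_cases hc : c = ⊤
  · simp [hc]
  · have : {t : ℝ | ENNReal.ofReal t ≤ c} ∩ Set.Ioi 0 = Set.Ioc 0 c.toReal := by
      ext t
      rw [Set.mem_inter_iff, Set.mem_ofPred_eq, Set.mem_Ioi, Set.mem_Ioc,
        ENNReal.ofReal_le_iff_le_toReal hc]
      tauto
    rw [this, Real.volume_Ioc, sub_zero, ENNReal.ofReal_toReal hc]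

/-- Each completion time is the length of the time during which it has not passed. Requests still to
arrive count as pending, so completion times appear here instead of flow times. -/
lemma sum_complTime : ∑ i ∈ Finset.range N, complTime r s x i =
    ∫⁻ t in Set.Ioi (0 : ℝ), (pending r N s x (ENNReal.ofReal t) : ℝ≥0∞) := by
  classical
  calc ∑ i ∈ Finset.range N, complTime r s x i = ∑ i ∈ Finset.range N, ∫⁻ t in Set.Ioi (0 : ℝ),
        {t : ℝ | ENNReal.ofReal t ≤ complTime r s x i}.indicator 1 t :=
        Finset.sum_congr rfl fun i _ => (lintegral_indicator_le _).symm
    _ = ∫⁻ t in Set.Ioi (0 : ℝ), ∑ i ∈ Finset.range N,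
        {t : ℝ | ENNReal.ofReal t ≤ complTime r s x i}.indicator 1 t :=
        (lintegral_finsetSum _ fun i _ => measurable_one.indicator
          (measurableSet_le ENNReal.measurable_ofReal measurable_const)).symm
    _ = _ := by
        refine lintegral_congr fun t => ?_
        rw [pending, Finset.card_eq_sum_ones, Finset.sum_filter, Nat.cast_sum]
        refine Finset.sum_congr rfl fun i _ => ?_
        simp [Set.indicator_apply]

lemma pending_eq (hr : r.Valid N) (t : ℝ≥0∞) : pending r N s x t =
    N - ((Finset.range N).filter fun i => r.k i ≤ cnt (doneBefore r N s x t) i).card := by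
  classical
  have h := Finset.card_filter_add_card_filter_not (s := Finset.range N)
    (fun i => t ≤ complTime r s x i)
  have h1 : (Finset.range N).filter (fun i => ¬ t ≤ complTime r s x i) =
      (Finset.range N).filter fun i => r.k i ≤ cnt (doneBefore r N s x t) i := by
    refine Finset.filter_congr fun i hi => ?_
    rw [← cnt_doneBefore_lt_iff hr (Finset.mem_range.1 hi), not_lt]
  rw [h1, Finset.card_range] at h
  rw [pending]
  omega

lemma Feasible.filter_arrived (hr : r.Valid N) (h : Feasible L r N x s) (t : ℝ) :
    (arrivedBefore r N t).filter (fun i => r.k i ≤ cnt (doneBefore r N s x (ENNReal.ofReal t)) i) =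
    (Finset.range N).filter fun i => r.k i ≤ cnt (doneBefore r N s x (ENNReal.ofReal t)) i := by
  ext i
  rw [Finset.mem_filter, Finset.mem_filter, mem_arrivedBefore, Finset.mem_range]
  refine ⟨fun h1 => ⟨h1.1.1, h1.2⟩, fun h1 => ⟨⟨h1.1, ?_⟩, h1.2⟩⟩
  by_contra! h2
  have h3 := (h.cnt_before_eq_zero h2).1
  have h4 := hr.one_le_k i (by exact_mod_cast h1.1)
  omega

lemma Feasible.positives_need_le_pending (hr : r.Valid N) (h : Feasible L r N x s) (t : ℝ) :
    positives N (need r (arrivedBefore r N t) (doneBefore r N s x (ENNReal.ofReal t))) ≤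
      pending r N s x (ENNReal.ofReal t) := by
  rw [pending_eq hr, ← h.filter_arrived hr]
  exact positives_need_le

lemma loss_nonneg {R : Finset ℕ} {D V : Finset Chunk} {j : Chunk} : 0 ≤ loss L N r R D V j := by
  rw [loss]
  split_ifs <;> positivity

lemma downloadLoss_nonneg {j : Chunk} : 0 ≤ downloadLoss L r N s x j := loss_nonneg

/-- Among `N` positions the zeros of the profile are at most the completed requests plus the losses,
by `Inv.card_zeros_le`; the other positions are the positive ones. -/
lemma IsGreedy.pending_le (hg : IsGreedy L r N x s) (hL : 1 ≤ L) (hr : r.Valid N)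
    (h : Feasible L r N x s) (hx : ∀ j, 0 < x j)
    (hties : ∀ j l, j ≠ l → s j ≠ ⊤ → finish s x j ≠ finish s x l) {t : ℝ} (ht : 0 < t) :
    (pending r N s x (ENNReal.ofReal t) : ℝ≥0∞) ≤
      positives N (prof L r (arrivedBefore r N t) (doneBefore r N s x (ENNReal.ofReal t))
        (servedBefore r N s x (ENNReal.ofReal t))) +
      ∑ j ∈ servedBefore r N s x (ENNReal.ofReal t), ENNReal.ofReal
        (loss L N r (arrivedBefore r N t) (doneBefore r N s x (ENNReal.ofReal t))
        (servedBefore r N s x (ENNReal.ofReal t)) j) := by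
  obtain ⟨h1, -⟩ := hg.inv_pot le_rfl (fun i _ => one_le_dist i) hr h hx hties ht.le
  have h2 := h1.card_zeros_le (N := N) hL (hg.busy_before hr h ht)
  rw [h.filter_arrived hr] at h2
  set A := (Finset.range N).filter fun i => r.k i ≤ cnt (doneBefore r N s x (ENNReal.ofReal t)) i
    with hA
  have h3 := Finset.card_filter_add_card_filter_not (s := Finset.range N)
    (fun p => prof L r (arrivedBefore r N t) (doneBefore r N s x (ENNReal.ofReal t))
        (servedBefore r N s x (ENNReal.ofReal t)) (p + 1) = 0)
  rw [Finset.card_range] at h3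
  have hAN : A.card ≤ N := (Finset.card_filter_le _ _).trans (Finset.card_range N).le
  have h4 := pending_eq (s := s) (x := x) hr (ENNReal.ofReal t)
  rw [← hA] at h4
  rw [← ENNReal.ofReal_sum_of_nonneg fun j _ => loss_nonneg, ← ENNReal.ofReal_natCast,
    ← ENNReal.ofReal_natCast, ← ENNReal.ofReal_add (Nat.cast_nonneg _)
      (Finset.sum_nonneg fun j _ => loss_nonneg)]
  refine ENNReal.ofReal_le_ofReal ?_
  have h5 : (pending r N s x (ENNReal.ofReal t) : ℝ) = N - A.card := by
    rw [h4, Nat.cast_sub hAN]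
  have h6 : ((((Finset.range N).filter fun p => prof L r (arrivedBefore r N t)
      (doneBefore r N s x (ENNReal.ofReal t)) (servedBefore r N s x (ENNReal.ofReal t))
      (p + 1) = 0).card : ℕ) : ℝ) + positives N (prof L r (arrivedBefore r N t)
      (doneBefore r N s x (ENNReal.ofReal t)) (servedBefore r N s x (ENNReal.ofReal t))) = N := by
    exact_mod_cast h3
  linarith

lemma measurableSet_arrivedBefore_eq (A : Finset ℕ) :
    MeasurableSet {t : ℝ | arrivedBefore r N t = A} :=
  measurableSet_filter_eq _ _ (fun _ _ => measurableSet_lt measurable_const measurable_id) A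

lemma measurableSet_arrivedBy_eq (A : Finset ℕ) :
    MeasurableSet {t : ℝ | arrivedBy r N t = A} :=
  measurableSet_filter_eq _ _ (fun _ _ => measurableSet_le measurable_const measurable_id) A

/-- The losses at downloads involve the arrivals up to that time, the pending requests those before
it; the two differ only at the finitely many arrival times. -/
lemma ae_arrivedBy_eq : ∀ᵐ t : ℝ, arrivedBy r N t = arrivedBefore r N t := by
  have h : ∀ᵐ t : ℝ, t ∉ (Finset.range N).image fun i => (r.a i : ℝ) :=
    measure_eq_zero_iff_ae_notMem.1 ((Finset.finite_toSet _).measure_zero volume)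
  filter_upwards [h] with t ht
  refine Finset.filter_congr fun i hi => ⟨fun h1 => lt_of_le_of_ne h1 ?_, le_of_lt⟩
  rintro h2
  exact ht (Finset.mem_image.2 ⟨i, hi, h2⟩)

/-! ### Mean total completion times of two schedules -/

variable {S S' : (Chunk → ℝ) → Chunk → ℝ≥0∞}

/-- The mean total loss of potential. -/
lemma lintegral_loss_le (hμ : 0 < μ) (hd : 1 ≤ d) (hdn : ∀ i < N, d ≤ r.n i - r.k i + 1)
    (hr : r.Valid N) (hS : Adapted L r N S)
    (hg : ∀ x, (∀ j, 0 < x j) → IsGreedy L r N x (S x)) :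
    ∫⁻ x, ∫⁻ t in Set.Ioi (0 : ℝ), ∑ j ∈ servedBefore r N (S x) x (ENNReal.ofReal t),
      ENNReal.ofReal (loss L N r (arrivedBefore r N t) (doneBefore r N (S x) x (ENNReal.ofReal t))
        (servedBefore r N (S x) x (ENNReal.ofReal t)) j) ∂volume
        ∂(Measure.infinitePi fun _ : Chunk => expMeasure μ) ≤
      ENNReal.ofReal (1 / μ * bound d L) * N := by
  have hprob := isProbabilityMeasure_expMeasure hμ
  have h := hS.lintegral_sum_everDone hμ hr
    (G := fun j t D V => ENNReal.ofReal (loss L N r (arrivedBy r N t) D V j)) fun j D V =>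
      measurable_comp_discrete (f := fun t => arrivedBy r N t)
        (G := fun A _ => ENNReal.ofReal (loss L N r A D V j)) measurableSet_arrivedBy_eq
        fun _ => measurable_const
  have h1 : ∫⁻ x, ∑ j ∈ everDone r N (S x) x,
      ENNReal.ofReal (downloadLoss L r N (S x) x j)
      ∂(Measure.infinitePi fun _ : Chunk => expMeasure μ) ≤ ENNReal.ofReal (bound d L * N) := by
    calc _ ≤ ∫⁻ _, ENNReal.ofReal (bound d L * N)
          ∂(Measure.infinitePi fun _ : Chunk => expMeasure μ) := by
          refine lintegral_mono_ae ?_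
          filter_upwards [ae_pos_infinitePi hμ, hS.ae_finish_ne hμ hr] with x hx hx'
          rw [← ENNReal.ofReal_sum_of_nonneg fun j _ => downloadLoss_nonneg]
          exact ENNReal.ofReal_le_ofReal ((hg x hx).sum_downloadLoss_le hd hdn hr
            (hS.feasible x hx) hx hx')
      _ = _ := by rw [lintegral_const, measure_univ, mul_one]
  -- The intensity `μ` turns the total loss at the downloads into `μ` times the time integral of the
  -- losses of the chunks under service.
  have h2 : ∫⁻ x, ∑ j ∈ everDone r N (S x) x,
      ENNReal.ofReal (downloadLoss L r N (S x) x j)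
      ∂(Measure.infinitePi fun _ : Chunk => expMeasure μ) = ENNReal.ofReal μ *
      ∫⁻ x, ∫⁻ t in Set.Ioi (0 : ℝ), ∑ j ∈ servedBefore r N (S x) x (ENNReal.ofReal t),
      ENNReal.ofReal (loss L N r (arrivedBefore r N t) (doneBefore r N (S x) x (ENNReal.ofReal t))
        (servedBefore r N (S x) x (ENNReal.ofReal t)) j) ∂volume
        ∂(Measure.infinitePi fun _ : Chunk => expMeasure μ) := by
    rw [← lintegral_const_mul' _ _ ENNReal.ofReal_ne_top]
    refine h.trans (lintegral_congr fun x => ?_)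
    rw [← lintegral_const_mul' _ _ ENNReal.ofReal_ne_top]
    refine lintegral_congr_ae ?_
    filter_upwards [ae_restrict_of_ae ae_arrivedBy_eq] with t ht
    rw [Finset.mul_sum, ht]
  rw [h2] at h1
  have h3 : ENNReal.ofReal (bound d L * N) =
      ENNReal.ofReal μ * (ENNReal.ofReal (1 / μ * bound d L) * N) := by
    rw [← mul_assoc, ← ENNReal.ofReal_mul hμ.le, ← ENNReal.ofReal_natCast, ← ENNReal.ofReal_mul
      (mul_nonneg hμ.le (mul_nonneg (by positivity) bound_nonneg))]
    congr 1
    field_simp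
  rw [h3] at h1
  exact (ENNReal.mul_le_mul_iff_right (by simpa using hμ) ENNReal.ofReal_ne_top).1 h1

/-- Arrival times are sorted, so the arrived requests form an initial segment, the form in which the
stochastic comparison is proved. -/
lemma exists_arrivedBefore_eq_range (hr : r.Valid N) (t : ℝ) :
    ∃ m ≤ N, arrivedBefore r N t = Finset.range m ∧ (∀ i < m, (r.a i : ℝ) ≤ t) ∧
      ∀ i, m ≤ i → i < N → t ≤ r.a i := by
  classical
  have hex : ∃ m, N ≤ m ∨ t ≤ r.a m := ⟨N, Or.inl le_rfl⟩
  set m := Nat.find hex with hm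
  have hlt : ∀ i < m, (r.a i : ℝ) < t := fun i hi => by
    have := Nat.find_min hex hi
    push Not at this
    exact this.2
  have hge : ∀ i, m ≤ i → i < N → t ≤ r.a i := fun i hi hiN => by
    rcases Nat.find_spec hex with h | h
    · omega
    · refine h.trans ?_
      exact_mod_cast hr.monotone _ i hi (by exact_mod_cast hiN)
  have hmN : m ≤ N := Nat.find_min' hex (Or.inl le_rfl)
  exact ⟨m, hmN, arrivedBefore_eq_range hmN hlt hge le_rfl, fun i hi => (hlt i hi).le, hge⟩

lemma Adapted.measurable_positives (hS : Adapted L r N S)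
    (Φ : Finset ℕ → Finset Chunk → Finset Chunk → ℕ → ℕ∞) :
    Measurable fun p : (Chunk → ℝ) × ℝ => (positives N (Φ (arrivedBefore r N p.2)
      (doneBefore r N (S p.1) p.1 (ENNReal.ofReal p.2))
      (servedBefore r N (S p.1) p.1 (ENNReal.ofReal p.2))) : ℝ≥0∞) :=
  measurable_state (s := fun p : (Chunk → ℝ) × ℝ => S p.1) (x := fun p : (Chunk → ℝ) × ℝ => p.1)
    (t := fun p : (Chunk → ℝ) × ℝ => ENNReal.ofReal p.2)
    (G := fun p D V => (positives N (Φ (arrivedBefore r N p.2) D V) : ℝ≥0∞))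
    (fun j => (hS.measurable j).comp measurable_fst)
    (fun j => (measurable_pi_apply j).comp measurable_fst)
    (ENNReal.measurable_ofReal.comp measurable_snd) fun D V =>
    measurable_comp_discrete (f := fun p : (Chunk → ℝ) × ℝ => arrivedBefore r N p.2)
      (G := fun A _ => (positives N (Φ A D V) : ℝ≥0∞))
      (fun A => measurable_snd (measurableSet_arrivedBefore_eq A)) fun _ => measurable_const

/-- Additivity of the lower integral requires only one measurable summand, so joint measurability of
the losses is not needed. -/
lemma lintegral_le_add_of_ae {α : Type*} [MeasurableSpace α] {ν : Measure α} [SFinite ν]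
    {h : α → ℝ≥0∞} {F G : α → ℝ → ℝ≥0∞} (hF : Measurable fun p : α × ℝ => F p.1 p.2)
    (hle : ∀ᵐ x ∂ν, h x ≤ ∫⁻ t in Set.Ioi (0 : ℝ), F x t + G x t) :
    ∫⁻ x, h x ∂ν ≤ ∫⁻ x, ∫⁻ t in Set.Ioi (0 : ℝ), F x t ∂volume ∂ν +
      ∫⁻ x, ∫⁻ t in Set.Ioi (0 : ℝ), G x t ∂volume ∂ν := by
  refine le_trans (lintegral_mono_ae ?_)
    (lintegral_add_left (hF.lintegral_prod_right' (ν := volume.restrict (Set.Ioi (0 : ℝ)))) _).le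
  filter_upwards [hle] with x hx
  exact hx.trans (lintegral_add_left (hF.comp measurable_prodMk_left) _).le

lemma lintegral_sum_complTime_le_add (hL : 1 ≤ L) (hμ : 0 < μ) (hr : r.Valid N)
    (hS : Adapted L r N S) (hg : ∀ x, (∀ j, 0 < x j) → IsGreedy L r N x (S x)) :
    ∫⁻ x, ∑ i ∈ Finset.range N, complTime r (S x) x i
      ∂(Measure.infinitePi fun _ : Chunk => expMeasure μ) ≤
    ∫⁻ x, ∫⁻ t in Set.Ioi (0 : ℝ), positives N (prof L r (arrivedBefore r N t)
        (doneBefore r N (S x) x (ENNReal.ofReal t)) (servedBefore r N (S x) x (ENNReal.ofReal t)))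
        ∂volume ∂(Measure.infinitePi fun _ : Chunk => expMeasure μ) +
      ∫⁻ x, ∫⁻ t in Set.Ioi (0 : ℝ), ∑ j ∈ servedBefore r N (S x) x (ENNReal.ofReal t),
        ENNReal.ofReal (loss L N r (arrivedBefore r N t)
        (doneBefore r N (S x) x (ENNReal.ofReal t))
        (servedBefore r N (S x) x (ENNReal.ofReal t)) j) ∂volume
        ∂(Measure.infinitePi fun _ : Chunk => expMeasure μ) := by
  have hprob := isProbabilityMeasure_expMeasure hμ
  refine lintegral_le_add_of_ae (hS.measurable_positives (fun R D V => prof L r R D V)) ?_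
  filter_upwards [ae_pos_infinitePi hμ, hS.ae_finish_ne hμ hr] with x hx hx'
  rw [sum_complTime]
  exact setLIntegral_mono' measurableSet_Ioi fun t ht =>
    (hg x hx).pending_le hL hr (hS.feasible x hx) hx hx' ht

/-- The stochastic comparison is used at each fixed time with the functional `positives N`; Tonelli
exchanges time and outcome on both sides. -/
lemma lintegral_positives_le (hμ : 0 < μ) (hr : r.Valid N)
    (hS : Adapted L r N S) (hg : ∀ x, (∀ j, 0 < x j) → IsGreedy L r N x (S x))
    (hS' : Adapted L r N S') :
    ∫⁻ x, ∫⁻ t in Set.Ioi (0 : ℝ), positives N (prof L r (arrivedBefore r N t)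
        (doneBefore r N (S x) x (ENNReal.ofReal t)) (servedBefore r N (S x) x (ENNReal.ofReal t)))
        ∂volume ∂(Measure.infinitePi fun _ : Chunk => expMeasure μ) ≤
    ∫⁻ x, ∑ i ∈ Finset.range N, complTime r (S' x) x i
      ∂(Measure.infinitePi fun _ : Chunk => expMeasure μ) := by
  have hprob := isProbabilityMeasure_expMeasure hμ
  have h1 := lintegral_lintegral_swap (μ := Measure.infinitePi fun _ : Chunk => expMeasure μ)
    (ν := volume.restrict (Set.Ioi (0 : ℝ)))
    (f := fun x t => (positives N (prof L r (arrivedBefore r N t)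
      (doneBefore r N (S x) x (ENNReal.ofReal t))
      (servedBefore r N (S x) x (ENNReal.ofReal t))) : ℝ≥0∞))
    (hS.measurable_positives (fun R D V => prof L r R D V)).aemeasurable
  have h2 := lintegral_lintegral_swap (μ := Measure.infinitePi fun _ : Chunk => expMeasure μ)
    (ν := volume.restrict (Set.Ioi (0 : ℝ)))
    (f := fun x t => (positives N (need r (arrivedBefore r N t)
      (doneBefore r N (S' x) x (ENNReal.ofReal t))) : ℝ≥0∞))
    (hS'.measurable_positives (fun R D _ => need r R D)).aemeasurable
  refine h1.trans_le (le_trans ?_ (h2.symm.trans_le ?_))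
  · refine setLIntegral_mono' measurableSet_Ioi fun t _ => ?_
    obtain ⟨m, hmN, hR, h3, h4⟩ := exists_arrivedBefore_eq_range hr t
    have := lintegral_prof_le_lintegral_need hμ hr hS hg hS' (B := N) m hmN t h3 h4
      (fun S => (positives N S : ℝ)) (fun S S' h => Nat.cast_le.2 (positives_mono h))
      (fun S => Nat.cast_nonneg _) (fun S => by exact_mod_cast positives_le S)
    simp only [hR]
    simpa only [ENNReal.ofReal_natCast] using this
  · refine lintegral_mono_ae ?_
    filter_upwards [ae_pos_infinitePi hμ] with x hx
    rw [sum_complTime]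
    exact lintegral_mono fun t =>
      Nat.cast_le.2 ((hS'.feasible x hx).positives_need_le_pending hr t)

/-- The mean total completion time of SEDPT-R compared with that of another policy. -/
theorem lintegral_sum_complTime_le (hL : 1 ≤ L) (hμ : 0 < μ) (hd : 1 ≤ d)
    (hdn : ∀ i < N, d ≤ r.n i - r.k i + 1) (hr : r.Valid N) (hS : Adapted L r N S)
    (hg : ∀ x, (∀ j, 0 < x j) → IsGreedy L r N x (S x)) (hS' : Adapted L r N S') :
    ∫⁻ x, ∑ i ∈ Finset.range N, complTime r (S x) x i
      ∂(Measure.infinitePi fun _ : Chunk => expMeasure μ) ≤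
    ∫⁻ x, ∑ i ∈ Finset.range N, complTime r (S' x) x i
      ∂(Measure.infinitePi fun _ : Chunk => expMeasure μ) +
      ENNReal.ofReal (1 / μ * bound d L) * N :=
  (lintegral_sum_complTime_le_add hL hμ hr hS hg).trans
    (add_le_add (lintegral_positives_le hμ hr hS hg hS') (lintegral_loss_le hμ hd hdn hr hS hg))

lemma Feasible.le_complTime (hr : r.Valid N) (h : Feasible L r N x s) {i : ℕ} (hi : i < N) :
    (r.a i : ℝ≥0∞) ≤ complTime r s x i := by
  rw [← cnt_doneBefore_lt_iff hr hi, ← ENNReal.ofReal_coe_nnreal,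
    (h.cnt_before_eq_zero le_rfl).1]
  exact hr.one_le_k i (by exact_mod_cast hi)

end Flow

section Flow

variable {d L N : ℕ} {r : Requests} {s : Chunk → ℝ≥0∞} {x : Chunk → ℝ} {μ : ℝ}

/-! ### Averages over seeds and over requests -/

section Policies

variable {Ω : Type*} [MeasurableSpace Ω] {P : Measure Ω} [IsProbabilityMeasure P]
  {X : Chunk → Ω → ℝ}

lemma map_eq_infinitePi (hμ : 0 < μ) (hX : ∀ j, Measurable (X j))
    (hlaw : ∀ j, P.map (X j) = expMeasure μ) (hindep : iIndepFun X P) :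
    P.map (fun ω j => X j ω) = Measure.infinitePi fun _ : Chunk => expMeasure μ := by
  have hprob := isProbabilityMeasure_expMeasure hμ
  have := (iIndepFun_iff_map_fun_eq_infinitePi_map hX).1 hindep
  rw [this]
  congr
  funext j
  rw [hlaw]

lemma sum_lintegral_prod {α β γ ι : Type*} [MeasurableSpace α] [MeasurableSpace β]
    [MeasurableSpace γ] (ν : Measure α) [SFinite ν] (P : Measure β) [SFinite P] {Y : β → γ}
    (hY : Measurable Y) (I : Finset ι) {F : ι → α × γ → ℝ≥0∞} (hF : ∀ i, Measurable (F i)) :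
    ∑ i ∈ I, ∫⁻ p : α × β, F i (p.1, Y p.2) ∂(ν.prod P) =
      ∫⁻ u, ∫⁻ y, ∑ i ∈ I, F i (u, y) ∂(P.map Y) ∂ν := by
  have hF' : ∀ i, Measurable fun p : α × β => F i (p.1, Y p.2) := fun i =>
    (hF i).comp (measurable_fst.prodMk (hY.comp measurable_snd))
  rw [← lintegral_finsetSum _ fun i _ => hF' i, lintegral_prod _
    (Finset.measurable_fun_sum _ fun i _ => hF' i).aemeasurable]
  refine lintegral_congr fun u => ?_
  have hm : Measurable fun y => ∑ i ∈ I, F i (u, y) :=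
    Finset.measurable_fun_sum _ fun i _ => (hF i).comp measurable_prodMk_left
  rw [lintegral_map hm hY]

lemma sum_meanComplTime (hμ : 0 < μ) (hX : ∀ j, Measurable (X j))
    (hlaw : ∀ j, P.map (X j) = expMeasure μ) (hindep : iIndepFun X P) (hr : r.Valid N)
    (π : OnlinePolicy L) : ∑ i ∈ Finset.range N, meanComplTime π P X r N i =
      ∫⁻ u : unitInterval, ∫⁻ x, ∑ i ∈ Finset.range N, complTime r (π.start u r N x) x i
        ∂(Measure.infinitePi fun _ : Chunk => expMeasure μ) ∂volume := by
  rw [← map_eq_infinitePi hμ hX hlaw hindep]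
  exact sum_lintegral_prod volume P (measurable_pi_lambda _ hX) (Finset.range N)
    (F := fun i p => complTime r (π.start p.1 r N p.2) p.2 i) fun i =>
    measurable_complTime (π.measurable r N hr) (fun j => (measurable_pi_apply j).comp measurable_snd)
      i

lemma le_meanComplTime (hμ : 0 < μ) (hX : ∀ j, Measurable (X j))
    (hlaw : ∀ j, P.map (X j) = expMeasure μ) (hindep : iIndepFun X P) (hr : r.Valid N)
    (π : OnlinePolicy L) {i : ℕ} (hi : i < N) : (r.a i : ℝ≥0∞) ≤ meanComplTime π P X r N i := by
  have hpos : ∀ᵐ ω ∂P, ∀ j, 0 < X j ω := by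
    have h := ae_pos_infinitePi hμ
    rw [← map_eq_infinitePi hμ hX hlaw hindep] at h
    exact ae_of_ae_map (measurable_pi_lambda _ hX).aemeasurable h
  calc (r.a i : ℝ≥0∞) = ∫⁻ _ : unitInterval × Ω, (r.a i : ℝ≥0∞) ∂(volume.prod P) := by
        rw [lintegral_const, measure_univ, mul_one]
    _ ≤ _ := by
        refine lintegral_mono_ae ?_
        filter_upwards [Measure.quasiMeasurePreserving_snd.ae hpos] with p hp
        exact (π.feasible p.1 r N _ hr hp).le_complTime hr hi

/-- The average flow time for finitely many requests. -/
lemma avgFlowTimeFin_le (hL : 1 ≤ L) (hμ : 0 < μ) (hX : ∀ j, Measurable (X j))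
    (hlaw : ∀ j, P.map (X j) = expMeasure μ) (hindep : iIndepFun X P) (hd : 1 ≤ d)
    (hdn : ∀ i < N, d ≤ r.n i - r.k i + 1) (hr : r.Valid N) {π : OnlinePolicy L}
    (hπ : π.IsSEDPTR) (π' : OnlinePolicy L) :
    avgFlowTimeFin π P X r N ≤ avgFlowTimeFin π' P X r N + ENNReal.ofReal (1 / μ * bound d L) := by
  have h1 : ∑ i ∈ Finset.range N, meanComplTime π P X r N i ≤
      ∑ i ∈ Finset.range N, meanComplTime π' P X r N i +
      ENNReal.ofReal (1 / μ * bound d L) * N := by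
    rw [sum_meanComplTime hμ hX hlaw hindep hr, sum_meanComplTime hμ hX hlaw hindep hr]
    set A := fun u : unitInterval => ∫⁻ x, ∑ i ∈ Finset.range N,
      complTime r (π.start u r N x) x i ∂(Measure.infinitePi fun _ : Chunk => expMeasure μ)
    set A' := fun u : unitInterval => ∫⁻ x, ∑ i ∈ Finset.range N,
      complTime r (π'.start u r N x) x i ∂(Measure.infinitePi fun _ : Chunk => expMeasure μ)
    set C := ENNReal.ofReal (1 / μ * bound d L) * N
    -- A fixed seed leaves an adapted schedule, and the bound holds for every pair of seeds. The two
    -- seeds can thus be averaged separately.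
    have h2 : ∀ u u', A u ≤ A' u' + C := fun u u' =>
      lintegral_sum_complTime_le hL hμ hd hdn hr (π.adapted u hr)
        (fun x hx => hπ u r N x hr hx) (π'.adapted u' hr)
    have h3 : ∀ u', ∫⁻ u, A u ≤ A' u' + C := fun u' => by
      calc ∫⁻ u, A u ≤ ∫⁻ _ : unitInterval, (A' u' + C) := lintegral_mono fun u => h2 u u'
        _ = _ := by rw [lintegral_const, measure_univ, mul_one]
    calc ∫⁻ u, A u = ∫⁻ _ : unitInterval, ∫⁻ u, A u := by
          rw [lintegral_const, measure_univ, mul_one]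
      _ ≤ ∫⁻ u', (A' u' + C) := lintegral_mono h3
      _ = _ := by rw [lintegral_add_right _ measurable_const, lintegral_const, measure_univ, mul_one]
  have h4 : ∑ i ∈ Finset.range N, (meanComplTime π P X r N i - (r.a i : ℝ≥0∞)) ≤
      ∑ i ∈ Finset.range N, (meanComplTime π' P X r N i - (r.a i : ℝ≥0∞)) +
      ENNReal.ofReal (1 / μ * bound d L) * N := by
    -- The arrival times have a finite sum and cancel. The subtraction has to be exact only for `π`;
    -- for `π'` truncation goes in the right direction.
    have hfin : ∑ i ∈ Finset.range N, (r.a i : ℝ≥0∞) ≠ ⊤ :=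
      ENNReal.sum_ne_top.2 fun i _ => ENNReal.coe_ne_top
    refine (ENNReal.add_le_add_iff_right hfin).1 ?_
    calc _ = ∑ i ∈ Finset.range N, meanComplTime π P X r N i := by
          rw [← Finset.sum_add_distrib]
          exact Finset.sum_congr rfl fun i hi => tsub_add_cancel_of_le
            (le_meanComplTime hμ hX hlaw hindep hr π (Finset.mem_range.1 hi))
      _ ≤ _ := h1
      _ ≤ _ := by
          rw [add_right_comm, ← Finset.sum_add_distrib]
          gcongr
          exact le_tsub_add
  rw [avgFlowTimeFin, avgFlowTimeFin]
  rcases Nat.eq_zero_or_pos N with rfl | hN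
  · simp
  · have hN0 : (N : ℝ≥0∞) ≠ 0 := by exact_mod_cast hN.ne'
    have hNt : (N : ℝ≥0∞) ≠ ⊤ := ENNReal.natCast_ne_top N
    refine (ENNReal.div_le_div_right h4 _).trans ?_
    rw [ENNReal.add_div, ENNReal.mul_div_cancel_right hN0 hNt]

lemma Requests.Valid.mono {N' : ℕ∞} {M : ℕ∞} (h : r.Valid N') (hM : M ≤ N') : r.Valid M where
  first_arrival := h.first_arrival
  monotone i j hij hj := h.monotone i j hij (hj.trans_le hM)
  one_le_k i hi := h.one_le_k i (hi.trans_le hM)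
  k_le_n i hi := h.k_le_n i (hi.trans_le hM)

lemma Requests.one_le_dMin {N' : ℕ∞} (h : 1 ≤ N') : 1 ≤ r.dMin N' := by
  have hne : {d : ℕ | ∃ i : ℕ, (i : ℕ∞) < N' ∧ d = r.n i - r.k i + 1}.Nonempty :=
    ⟨_, 0, lt_of_lt_of_le (by simp) h, rfl⟩
  obtain ⟨i, -, hi⟩ := Nat.sInf_mem hne
  rw [Requests.dMin, hi]
  omega

lemma Requests.dMin_le {N' : ℕ∞} {i : ℕ} (h : (i : ℕ∞) < N') : r.dMin N' ≤ r.n i - r.k i + 1 :=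
  Nat.sInf_le ⟨i, h, rfl⟩

/-- The average flow time of SEDPT-R is close to the optimal one. -/
theorem avgFlowTime_le (hL : 1 ≤ L) (hμ : 0 < μ) (hX : ∀ j, Measurable (X j))
    (hlaw : ∀ j, P.map (X j) = expMeasure μ) (hindep : iIndepFun X P) {N' : ℕ∞} (hN : 1 ≤ N')
    (hr : r.Valid N') {π : OnlinePolicy L} (hπ : π.IsSEDPTR) :
    avgFlowTime π P X r N' ≤
      optFlowTime L P X r N' + ENNReal.ofReal (1 / μ * bound (r.dMin N') L) := by
  rw [optFlowTime, ENNReal.iInf_add]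
  refine le_iInf fun π' => ?_
  -- The distance of the whole sequence bounds the distances of each initial part, so the error is
  -- the same for all `M` and survives the upper limit.
  have key : ∀ M : ℕ, (M : ℕ∞) ≤ N' → avgFlowTimeFin π P X r M ≤
      avgFlowTimeFin π' P X r M + ENNReal.ofReal (1 / μ * bound (r.dMin N') L) := fun M hM =>
    avgFlowTimeFin_le hL hμ hX hlaw hindep (Requests.one_le_dMin hN)
      (fun i hi => Requests.dMin_le (lt_of_lt_of_le (by exact_mod_cast hi) hM)) (hr.mono hM) hπ π'
  rw [avgFlowTime, avgFlowTime]
  split_ifs with h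
  · subst h
    calc _ ≤ Filter.limsup (fun M : ℕ => avgFlowTimeFin π' P X r M +
          ENNReal.ofReal (1 / μ * bound (r.dMin ⊤) L)) Filter.atTop :=
          Filter.limsup_le_limsup (Filter.Eventually.of_forall fun M => key M le_top)
      _ ≤ _ := by
          rw [limsup_add_const _ _ _ (by isBoundedDefault) (by isBoundedDefault)]
  · exact key _ (ENat.natCast_toNat h).le

end Policies

end Flow

/-! ### The assignment procedure -/

section Assignment

/-- The chunks of the unfinished requests in `R` that are neither downloaded nor under service. -/
def free (r : Requests) (R : Finset ℕ) (D V : Finset Chunk) : Finset Chunk :=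
  (R ×ˢ Finset.range (R.sup r.n)).filter fun j =>
    j.2 < r.n j.1 ∧ cnt D j.1 < r.k j.1 ∧ j ∉ D ∧ j ∉ V

variable {L N : ℕ} {r r' : Requests} {R : Finset ℕ} {D V : Finset Chunk} {j : Chunk}

lemma mem_free : j ∈ free r R D V ↔
    j.1 ∈ R ∧ j.2 < r.n j.1 ∧ cnt D j.1 < r.k j.1 ∧ j ∉ D ∧ j ∉ V := by
  rw [free, Finset.mem_filter, Finset.mem_product, Finset.mem_range]
  constructor
  · rintro ⟨⟨h1, -⟩, h2⟩
    exact ⟨h1, h2⟩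
  · rintro ⟨h1, h2⟩
    exact ⟨⟨h1, h2.1.trans_le (Finset.le_sup h1)⟩, h2⟩

/-- The chunks that SEDPT-R may assign. -/
def candidates (r : Requests) (R : Finset ℕ) (D V : Finset Chunk) : Finset Chunk :=
  (free r R D V).filter fun j => ∀ l ∈ free r R D V,
    (r.k j.1 : ℤ) - cnt D j.1 - cnt V j.1 ≤ r.k l.1 - cnt D l.1 - cnt V l.1

/-- `pick` is a function of the set of candidates, so ties are broken without looking at requests
that have not arrived. -/
lemma candidates_congr (h : ∀ i ∈ R, r.k i = r'.k i ∧ r.n i = r'.n i) :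
    candidates r R D V = candidates r' R D V := by
  have h1 : free r R D V = free r' R D V := by
    ext j
    rw [mem_free, mem_free]
    refine and_congr_right fun hj => ?_
    rw [(h _ hj).1, (h _ hj).2]
  rw [candidates, candidates, h1]
  refine Finset.filter_congr fun j hj => forall₂_congr fun l hl => ?_
  rw [(h _ (mem_free.1 hj).1).1, (h _ (mem_free.1 hl).1).1]

open Classical in
/-- An element of `J`. -/
noncomputable def pick (J : Finset Chunk) : Chunk := if h : J.Nonempty then h.choose else (0, 0)

lemma pick_mem {J : Finset Chunk} (h : J.Nonempty) : pick J ∈ J := by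
  rw [pick, dif_pos h]
  exact h.choose_spec

open Classical in
/-- One assignment, if possible. -/
noncomputable def assignOne (L : ℕ) (r : Requests) (R : Finset ℕ) (D V : Finset Chunk) :
    Finset Chunk :=
  if V.card < L ∧ (candidates r R D V).Nonempty then insert (pick (candidates r R D V)) V else V

/-- All assignments. -/
noncomputable def assignAll (L : ℕ) (r : Requests) (R : Finset ℕ) (D V : Finset Chunk) :
    Finset Chunk :=
  (assignOne L r R D)^[L] V

lemma pick_mem_free (h : (candidates r R D V).Nonempty) :
    pick (candidates r R D V) ∈ free r R D V :=
  (Finset.mem_filter.1 (pick_mem h)).1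

/-- Each effective assignment adds a chunk, so `L` iterations exhaust either the candidates or the
threads. -/
lemma assignOne_iterate (n : ℕ) :
    assignOne L r R D ((assignOne L r R D)^[n] V) = (assignOne L r R D)^[n] V ∨
      n ≤ ((assignOne L r R D)^[n] V).card := by
  induction n with
  | zero => exact Or.inr (Nat.zero_le _)
  | succ n ih =>
    rw [Function.iterate_succ_apply']
    set W := (assignOne L r R D)^[n] V
    by_cases h : W.card < L ∧ (candidates r R D W).Nonempty
    · have h1 : assignOne L r R D W = insert (pick (candidates r R D W)) W := if_pos h
      have h2 := (mem_free.1 (pick_mem_free h.2)).2.2.2.2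
      rcases ih with ih | ih
      · rw [h1] at ih
        exact absurd (Finset.insert_eq_self.1 ih) h2
      · right
        rw [h1, Finset.card_insert_of_notMem h2]
        omega
    · have h1 : assignOne L r R D W = W := if_neg h
      left
      rw [h1, h1]

lemma assignOne_assignAll : assignOne L r R D (assignAll L r R D V) = assignAll L r R D V := by
  rcases assignOne_iterate (L := L) (r := r) (R := R) (D := D) (V := V) L with h | h
  · exact h
  · exact if_neg fun h1 => absurd h1.1 (not_lt.2 h)

/-- Repeating the procedure in an unchanged situation starts nothing; hence decisions are needed
only at events. -/
lemma assignAll_assignAll : assignAll L r R D (assignAll L r R D V) = assignAll L r R D V :=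
  Function.iterate_fixed assignOne_assignAll L

lemma assignAll_congr (h : ∀ i ∈ R, r.k i = r'.k i ∧ r.n i = r'.n i) :
    assignAll L r R D V = assignAll L r' R D V := by
  have : assignOne L r R D = assignOne L r' R D := by
    funext W
    rw [assignOne, assignOne, candidates_congr h]
  rw [assignAll, this, assignAll]

/-- A property that is preserved by the assignments. -/
lemma assignAll_induction {p : Finset Chunk → Prop} (h0 : p V)
    (h : ∀ W, p W → W.card < L → (candidates r R D W).Nonempty →
      p (insert (pick (candidates r R D W)) W)) : p (assignAll L r R D V) := by
  rw [assignAll]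
  generalize hm : (assignOne L r R D)^[L] V = W
  have key : ∀ n, p ((assignOne L r R D)^[n] V) := by
    intro n
    induction n with
    | zero => exact h0
    | succ n ih =>
      rw [Function.iterate_succ_apply', assignOne]
      split_ifs with h1
      · exact h _ ih h1.1 h1.2
      · exact ih
  exact hm ▸ key L

lemma subset_assignAll : V ⊆ assignAll L r R D V :=
  assignAll_induction (p := fun W => V ⊆ W) subset_rfl
    fun _ h _ _ => h.trans (Finset.subset_insert _ _)

lemma mem_free_of_mem_assignAll (hj : j ∈ assignAll L r R D V) (hV : j ∉ V) :
    j ∈ free r R D V := by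
  refine assignAll_induction (p := fun W => V ⊆ W ∧ ∀ j ∈ W, j ∉ V → j ∈ free r R D V)
    (L := L) (r := r) (R := R) (D := D)
    ⟨subset_rfl, fun j hj hV => absurd hj hV⟩ (fun W hW _ hne => ?_) |>.2 j hj hV
  refine ⟨hW.1.trans (Finset.subset_insert _ _), fun l hl hlV => ?_⟩
  rcases Finset.mem_insert.1 hl with rfl | hl
  · obtain ⟨h1, h2, h3, h4, h5⟩ := mem_free.1 (pick_mem_free hne)
    exact mem_free.2 ⟨h1, h2, h3, h4, hlV⟩
  · exact hW.2 l hl hlV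

lemma card_assignAll_le (h : V.card ≤ L) : (assignAll L r R D V).card ≤ L := by
  refine assignAll_induction (p := fun W => W.card ≤ L) h fun W _ hlt _ => ?_
  exact (Finset.card_insert_le _ _).trans hlt

variable {s : Chunk → ℝ≥0∞} {x : Chunk → ℝ}

lemma waiting_iff_mem_free (hr : r.Valid N) (h : Feasible L r N x s) {t : ℝ≥0} :
    Waiting r N s x t V j ↔ j ∈ free r (arrivedBy r N t) (doneBy r N s x t) V := by
  rw [waiting_iff hr h, mem_free, mem_chunks]
  constructor
  · rintro ⟨h1, h2, h3⟩
    exact ⟨h2, h1.2, h3⟩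
  · rintro ⟨h1, h2, h3⟩
    exact ⟨⟨(mem_arrivedBy.1 h1).1, h2⟩, h1, h3⟩

lemma sedptStep_iff (hr : r.Valid N) (h : Feasible L r N x s) {t : ℝ≥0} (hV : V ⊆ chunks r N)
    {B : Set Chunk} : SEDPTStep L r N s x t V B ↔ V.card < L ∧
      ∃ j ∈ candidates r (arrivedBy r N t) (doneBy r N s x t) V, B = insert j (V : Set Chunk) := by
  rw [SEDPTStep, Set.encard_coe_eq_coe_finsetCard, Nat.cast_lt]
  refine and_congr_right fun _ => exists_congr fun j => ?_
  simp only [waiting_iff_mem_free hr h, remaining_eq h, assigned_eq hV, candidates,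
    Finset.mem_filter]
  tauto

lemma reflTransGen_assignAll (hr : r.Valid N) (h : Feasible L r N x s) {t : ℝ≥0}
    (hV : V ⊆ chunks r N) : Relation.ReflTransGen (SEDPTStep L r N s x t) V
      (assignAll L r (arrivedBy r N t) (doneBy r N s x t) V : Finset Chunk) := by
  refine assignAll_induction (L := L) (r := r) (R := arrivedBy r N t) (D := doneBy r N s x t)
    (p := fun W => W ⊆ chunks r N ∧ Relation.ReflTransGen (SEDPTStep L r N s x t) V W)
    ⟨hV, Relation.ReflTransGen.refl⟩ (fun W hW hlt hne => ?_) |>.2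
  refine ⟨Finset.insert_subset ?_ hW.1, hW.2.tail ?_⟩
  · obtain ⟨h1, h2, -⟩ := mem_free.1 (pick_mem_free hne)
    exact mem_chunks.2 ⟨(mem_arrivedBy.1 h1).1, h2⟩
  · exact (sedptStep_iff hr h hW.1).2 ⟨hlt, _, pick_mem hne, Finset.coe_insert _ _⟩

lemma not_sedptStep_assignAll (hr : r.Valid N) (h : Feasible L r N x s) {t : ℝ≥0}
    (hV : assignAll L r (arrivedBy r N t) (doneBy r N s x t) V ⊆ chunks r N) (B : Set Chunk) :
    ¬ SEDPTStep L r N s x t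
      (assignAll L r (arrivedBy r N t) (doneBy r N s x t) V : Finset Chunk) B := by
  rw [sedptStep_iff hr h hV]
  rintro ⟨hlt, j, hj, -⟩
  have h1 := assignOne_assignAll (L := L) (r := r) (R := arrivedBy r N t)
    (D := doneBy r N s x t) (V := V)
  rw [assignOne, if_pos ⟨hlt, j, hj⟩] at h1
  have h2 := (mem_free.1 (pick_mem_free ⟨j, hj⟩)).2.2.2.2
  exact h2 (Finset.insert_eq_self.1 h1)

end Assignment

/-! ### Schedules that follow the assignment procedure -/

/-- The chunks under service after the assignments at time `t`. -/
noncomputable def nextServed (L : ℕ) (r : Requests) (N : ℕ) (s : Chunk → ℝ≥0∞) (x : Chunk → ℝ)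
    (t : ℝ≥0∞) : Finset Chunk :=
  assignAll L r (arrivedBy r N t.toReal) (doneBy r N s x t) (servedPre r N s x t)

/-- At any time the chunks that are started are those that the procedure assigns. -/
def Follows (L : ℕ) (r : Requests) (N : ℕ) (x : Chunk → ℝ) (s : Chunk → ℝ≥0∞) : Prop :=
  ∀ (t : ℝ≥0) (j : Chunk), s j ≤ t ↔ s j < t ∨ j ∈ nextServed L r N s x t

section Follows

variable {L N N' : ℕ} {r r' : Requests} {s s' : Chunk → ℝ≥0∞} {x x' : Chunk → ℝ} {j : Chunk}

lemma mem_nextServed (hr : r.Valid N) {t : ℝ≥0} (hj : j ∈ nextServed L r N s x t) :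
    j ∈ chunks r N ∧ j ∉ doneBy r N s x t ∧ cnt (doneBy r N s x t) j.1 < r.k j.1 := by
  classical
  by_cases hV : j ∈ servedPre r N s x t
  · exact ⟨servedPre_subset_chunks hV, ((mem_servedPre_iff hr).1 hV).2⟩
  · obtain ⟨h1, h2, h3, h4, -⟩ := mem_free.1 (mem_free_of_mem_assignAll hj hV)
    exact ⟨mem_chunks.2 ⟨(mem_arrivedBy.1 h1).1, h2⟩, h4, h3⟩

lemma servedAt_eq_nextServed (hr : r.Valid N) {t : ℝ≥0}
    (h : ∀ j, s j ≤ t ↔ s j < t ∨ j ∈ nextServed L r N s x t) :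
    servedAt r N s x t = nextServed L r N s x t := by
  classical
  ext j
  rw [mem_servedAt_iff hr]
  constructor
  · rintro ⟨⟨h1, h2⟩, h3⟩
    rcases (h j).1 h2 with h4 | h4
    · refine subset_assignAll ((mem_servedPre_iff hr).2 ⟨?_, h3⟩)
      exact Finset.mem_filter.2 ⟨h1, h4⟩
    · exact h4
  · intro hj
    obtain ⟨h1, h2⟩ := mem_nextServed hr hj
    exact ⟨⟨h1, (h j).2 (Or.inr hj)⟩, h2⟩

lemma Follows.mem_free (hs : Follows L r N x s) {t : ℝ≥0} (ht : s j = t) :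
    j ∈ free r (arrivedBy r N t) (doneBy r N s x t) (servedPre r N s x t) := by
  classical
  have h1 : j ∈ nextServed L r N s x t := by
    rcases (hs t j).1 ht.le with h | h
    · exact absurd ht h.ne
    · exact h
  refine mem_free_of_mem_assignAll h1 fun h2 => ?_
  rw [servedPre, Finset.mem_filter] at h2
  exact absurd ht h2.2.1.ne

lemma Follows.start (hr : r.Valid N) (hs : Follows L r N x s) (hj : s j ≠ ⊤) :
    j.1 < N ∧ j.2 < r.n j.1 ∧ r.a j.1 ≤ s j ∧ s j < complTime r s x j.1 := by
  lift s j to ℝ≥0 using hj with t ht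
  obtain ⟨h1, h2, h3, -⟩ := MDSQueue.mem_free.1 (hs.mem_free ht.symm)
  obtain ⟨h4, h5⟩ := mem_arrivedBy.1 h1
  exact ⟨h4, h2, by exact_mod_cast h5, (cnt_doneBy_lt_iff hr h4).1 h3⟩

/-- The bound propagates from event to event: assignments stop at `L`, and completions and
terminations only remove chunks. -/
lemma Follows.card_servedAt_le (hr : r.Valid N) (hs : Follows L r N x s) {t : ℝ} (ht : 0 ≤ t) :
    (servedAt r N s x (ENNReal.ofReal t)).card ≤ L := by
  have hjump : ∀ t : ℝ, 0 ≤ t → (servedBefore r N s x (ENNReal.ofReal t)).card ≤ L →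
      (servedAt r N s x (ENNReal.ofReal t)).card ≤ L := by
    intro t ht h
    lift t to ℝ≥0 using ht
    rw [ENNReal.ofReal_coe_nnreal] at *
    rw [servedAt_eq_nextServed hr (hs t)]
    refine card_assignAll_le ((Finset.card_le_card ?_).trans h)
    rw [servedPre_eq_filter hr]
    exact Finset.filter_subset _ _
  refine hjump t ht ?_
  refine induction_jumps (E := events r N s x) (t₀ := 0)
    (P := fun t => (servedBefore r N s x (ENNReal.ofReal t)).card ≤ L)
    (P' := fun t => (servedAt r N s x (ENNReal.ofReal t)).card ≤ L) ?_ t ht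
    (fun t ht _ => hjump t ht) ?_
  · simp [servedBefore]
  · intro τ t hτ hτt _ hno h
    rwa [(state_eq_of_no_event hr hτ hτt hno).2]

lemma Follows.feasible (hr : r.Valid N) (hs : Follows L r N x s) : Feasible L r N x s where
  start j hj := hs.start hr hj
  threads t := by
    have h1 := hs.card_servedAt_le hr t.2
    have h2 : inService r s x t ⊆ (servedAt r N s x t : Finset Chunk) := by
      intro j hj
      simp only [servedAt, Finset.coe_filter, Set.mem_ofPred_eq]
      obtain ⟨h3, h4, -⟩ := hs.start hr (ne_top_of_le_ne_top ENNReal.coe_ne_top hj.1)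
      exact ⟨mem_chunks.2 ⟨h3, h4⟩, hj⟩
    refine (Set.encard_le_encard h2).trans ?_
    rw [Set.encard_coe_eq_coe_finsetCard]
    rw [NNReal.val_eq_coe, ENNReal.ofReal_coe_nnreal] at h1
    exact_mod_cast h1

lemma Follows.isGreedy (hr : r.Valid N) (hs : Follows L r N x s) : IsGreedy L r N x s := by
  intro t
  have h := hs.feasible hr
  have h1 := servedAt_eq_nextServed hr (hs t)
  rw [← coe_servedPre h t, ← coe_servedAt h t, h1]
  refine ⟨reflTransGen_assignAll hr h servedPre_subset_chunks,
    not_sedptStep_assignAll hr h ?_⟩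
  have h2 : nextServed L r N s x t ⊆ chunks r N := h1 ▸ servedAt_subset_chunks
  exact h2

/-- Schedules that follow the procedure do not anticipate. -/
lemma Follows.start_le_iff (hr : r.Valid N) (hr' : r'.Valid N') (hs : Follows L r N x s)
    (hs' : Follows L r' N' x' s') {t : ℝ≥0} (h : SameHistory t r N x s r' N' x' s') (j : Chunk) :
    s j ≤ t ↔ s' j ≤ t := by
  classical
  have hf := hs.feasible hr
  have hf' := hs'.feasible hr'
  by_contra hj
  set A := (chunks r N ∪ chunks r' N').filter fun l => s l ≠ s' l ∧ min (s l) (s' l) ≤ t with hA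
  have hmemA : ∀ l, s l ≠ s' l → min (s l) (s' l) ≤ t → l ∈ A := by
    intro l h1 h2
    refine Finset.mem_filter.2 ⟨Finset.mem_union.2 ?_, h1, h2⟩
    rcases min_le_iff.1 h2 with h3 | h3
    · exact Or.inl (hf.mem_chunks (ne_top_of_le_ne_top ENNReal.coe_ne_top h3))
    · exact Or.inr (hf'.mem_chunks (ne_top_of_le_ne_top ENNReal.coe_ne_top h3))
  have hAne : A.Nonempty := by
    refine ⟨j, hmemA j (fun h1 => hj (by rw [h1])) ?_⟩
    rw [min_le_iff]
    tauto
  -- At the earliest differing start the arrivals, the downloads and the chunks under service agree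
  -- in both situations, and with them the decision of the procedure.
  obtain ⟨l, hl, hmin⟩ := Finset.exists_min_image A (fun l => min (s l) (s' l)) hAne
  obtain ⟨-, hne, hle⟩ := Finset.mem_filter.1 hl
  obtain ⟨τ, hτ⟩ : ∃ τ : ℝ≥0, (τ : ℝ≥0∞) = min (s l) (s' l) :=
    ⟨_, ENNReal.coe_toNNReal (ne_top_of_le_ne_top ENNReal.coe_ne_top hle)⟩
  have hτt : τ ≤ t := by
    rw [← hτ] at hle
    exact_mod_cast hle
  have hbefore : ∀ i, s i < τ ↔ s' i < τ := by
    intro i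
    by_cases hi : s i = s' i
    · rw [hi]
    · have h1 : ¬ min (s i) (s' i) < τ := fun h1 => by
        have h2 := hmin i (hmemA i hi (h1.le.trans (by exact_mod_cast hτt)))
        rw [← hτ] at h2
        exact absurd h1 (not_lt.2 h2)
      rw [min_lt_iff, not_or] at h1
      tauto
  have hR : arrivedBy r N τ = arrivedBy r' N' τ := by
    ext i
    rw [mem_arrivedBy, mem_arrivedBy, NNReal.coe_le_coe, NNReal.coe_le_coe]
    constructor
    · rintro ⟨h1, h2⟩
      have h3 := (h.params i h1 (h2.trans hτt)).1
      exact ⟨((h.arrived i).1 ⟨h1, h2.trans hτt⟩).1, h3 ▸ h2⟩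
    · rintro ⟨h1, h2⟩
      obtain ⟨h4, h5⟩ := (h.arrived i).2 ⟨h1, h2.trans hτt⟩
      exact ⟨h4, (h.params i h4 h5).1 ▸ h2⟩
  have hpar : ∀ i ∈ arrivedBy r N τ, r.k i = r'.k i ∧ r.n i = r'.n i := by
    intro i hi
    obtain ⟨h1, h2⟩ := mem_arrivedBy.1 hi
    exact (h.params i h1 ((NNReal.coe_le_coe.1 h2).trans hτt)).2
  have hD : doneBy r N s x τ = doneBy r' N' s' x' τ := by
    rw [← Finset.coe_inj, coe_doneBy hf, coe_doneBy hf']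
    exact h.downloads τ hτt
  have harr : ∀ i, s i < τ → i.1 ∈ arrivedBy r N τ := fun i hi => by
    obtain ⟨h1, -, h2, -⟩ := hf.start i (ne_top_of_lt hi)
    exact mem_arrivedBy.2 ⟨h1, by exact_mod_cast h2.trans hi.le⟩
  have hV : servedPre r N s x τ = servedPre r' N' s' x' τ := by
    ext i
    rw [mem_servedPre_iff hr, mem_servedPre_iff hr', ← hD, startedBefore, startedBefore,
      Finset.mem_filter, Finset.mem_filter]
    constructor
    · rintro ⟨⟨-, h2⟩, h3, h4⟩
      have h5 := (hbefore i).1 h2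
      exact ⟨⟨hf'.mem_chunks (ne_top_of_lt h5), h5⟩, h3, (hpar _ (harr i h2)).1 ▸ h4⟩
    · rintro ⟨⟨-, h2⟩, h3, h4⟩
      have h5 := (hbefore i).2 h2
      exact ⟨⟨hf.mem_chunks (ne_top_of_lt h5), h5⟩, h3, (hpar _ (harr i h5)).1 ▸ h4⟩
  have hnext : nextServed L r N s x τ = nextServed L r' N' s' x' τ := by
    rw [nextServed, nextServed, ENNReal.coe_toReal, hD, hV, ← hR]
    exact assignAll_congr hpar
  have hiff : s l ≤ τ ↔ s' l ≤ τ := by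
    rw [hs τ l, hs' τ l, hbefore l, hnext]
  rw [hτ] at hiff
  refine hne (le_antisymm ?_ ?_)
  · by_contra! h1
    rw [min_eq_right h1.le] at hiff
    exact absurd (hiff.2 le_rfl) (not_le.2 h1)
  · by_contra! h1
    rw [min_eq_left h1.le] at hiff
    exact absurd (hiff.1 le_rfl) (not_le.2 h1)

end Follows

/-! ### Construction of the schedule, event by event -/

open Classical in
/-- The schedule `s` after the assignments at time `t`. -/
noncomputable def startNow (L : ℕ) (r : Requests) (N : ℕ) (x : Chunk → ℝ) (t : ℝ≥0∞)
    (s : Chunk → ℝ≥0∞) (j : Chunk) : ℝ≥0∞ :=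
  if s j = ⊤ ∧ j ∈ nextServed L r N s x t then t else s j

open Classical in
/-- The time of the first arrival or end of a download after time `t`. -/
noncomputable def nextEvent (r : Requests) (N : ℕ) (x : Chunk → ℝ) (t : ℝ≥0∞)
    (s : Chunk → ℝ≥0∞) : ℝ≥0∞ :=
  ((Finset.range N).inf fun i => if t < r.a i then (r.a i : ℝ≥0∞) else ⊤) ⊓
    (chunks r N).inf fun j => if t < finish s x j then finish s x j else ⊤

/-- The time of the event number `n`, and the chunks that have been started before. -/
noncomputable def run (L : ℕ) (r : Requests) (N : ℕ) (x : Chunk → ℝ) : ℕ → ℝ≥0∞ × (Chunk → ℝ≥0∞)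
  | 0 => (0, fun _ => ⊤)
  | n + 1 =>
    (nextEvent r N x (run L r N x n).1 (startNow L r N x (run L r N x n).1 (run L r N x n).2),
      startNow L r N x (run L r N x n).1 (run L r N x n).2)

/-- The schedule of SEDPT-R. -/
noncomputable def sedptStart (L : ℕ) (r : Requests) (N : ℕ) (x : Chunk → ℝ) (j : Chunk) : ℝ≥0∞ :=
  ⨅ n, (run L r N x n).2 j

section Run

variable {L N : ℕ} {r : Requests} {x : Chunk → ℝ} {s : Chunk → ℝ≥0∞} {t : ℝ≥0∞} {n m : ℕ}
  {j : Chunk}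

lemma lt_nextEvent (ht : t ≠ ⊤) : t < nextEvent r N x t s := by
  have ht' : t < ⊤ := lt_top_iff_ne_top.2 ht
  refine lt_inf_iff.2 ⟨(Finset.lt_inf_iff ht').2 fun i _ => ?_,
    (Finset.lt_inf_iff ht').2 fun j _ => ?_⟩
  · split_ifs with h
    · exact h
    · exact ht'
  · split_ifs with h
    · exact h
    · exact ht'

lemma nextEvent_le_arrival {i : ℕ} (hi : i < N) (h : t < r.a i) : nextEvent r N x t s ≤ r.a i := by
  refine inf_le_left.trans ((Finset.inf_le (Finset.mem_range.2 hi)).trans_eq ?_)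
  exact if_pos h

lemma nextEvent_le_finish (hj : j ∈ chunks r N) (h : t < finish s x j) :
    nextEvent r N x t s ≤ finish s x j := by
  refine inf_le_right.trans ((Finset.inf_le hj).trans_eq ?_)
  exact if_pos h

lemma nextEvent_cases (h : nextEvent r N x t s ≠ ⊤) :
    (∃ i < N, nextEvent r N x t s = r.a i) ∨
      ∃ j ∈ chunks r N, nextEvent r N x t s = finish s x j := by
  classical
  rw [nextEvent] at *
  rcases min_choice ((Finset.range N).inf fun i => if t < r.a i then (r.a i : ℝ≥0∞) else ⊤)
    ((chunks r N).inf fun j => if t < finish s x j then finish s x j else ⊤) with h1 | h1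
  · left
    rw [min_def] at *
    have hne : (Finset.range N).Nonempty := by
      by_contra h2
      rw [Finset.not_nonempty_iff_eq_empty] at h2
      rw [h1, h2, Finset.inf_empty] at h
      exact h rfl
    obtain ⟨i, hi, h3⟩ := Finset.exists_mem_eq_inf _ hne
      fun i => if t < r.a i then (r.a i : ℝ≥0∞) else ⊤
    rw [h1, h3] at h ⊢
    refine ⟨i, Finset.mem_range.1 hi, ?_⟩
    split_ifs at h ⊢ with h4
    · rfl
    · exact absurd rfl h
  · right
    have hne : (chunks r N).Nonempty := by
      by_contra h2
      rw [Finset.not_nonempty_iff_eq_empty] at h2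
      rw [h1, h2, Finset.inf_empty] at h
      exact h rfl
    obtain ⟨i, hi, h3⟩ := Finset.exists_mem_eq_inf _ hne
      fun j => if t < finish s x j then finish s x j else ⊤
    rw [h1, h3] at h ⊢
    refine ⟨i, hi, ?_⟩
    split_ifs at h ⊢ with h4
    · rfl
    · exact absurd rfl h

lemma run_lt_run_succ (h : (run L r N x n).1 ≠ ⊤) : (run L r N x n).1 < (run L r N x (n + 1)).1 :=
  lt_nextEvent h

lemma run_le_run_succ : (run L r N x n).1 ≤ (run L r N x (n + 1)).1 := by
  by_cases h : (run L r N x n).1 = ⊤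
  · have h1 : (run L r N x (n + 1)).1 = ⊤ := by
      rw [run, h, nextEvent]
      simp
    rw [h1]
    exact le_top
  · exact (run_lt_run_succ h).le

lemma run_mono : Monotone fun n => (run L r N x n).1 :=
  monotone_nat_of_le_succ fun _ => run_le_run_succ

lemma run_succ_of_ne_top (h : (run L r N x n).2 j ≠ ⊤) :
    (run L r N x (n + 1)).2 j = (run L r N x n).2 j :=
  if_neg fun h1 => h h1.1

lemma run_of_ne_top (h : (run L r N x n).2 j ≠ ⊤) (hnm : n ≤ m) :
    (run L r N x m).2 j = (run L r N x n).2 j := by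
  induction m, hnm using Nat.le_induction with
  | base => rfl
  | succ m _ ih => rw [run_succ_of_ne_top (ih ▸ h), ih]

lemma run_succ_of_eq_top (h : (run L r N x n).2 j = ⊤) :
    (run L r N x (n + 1)).2 j = (run L r N x n).1 ∨ (run L r N x (n + 1)).2 j = ⊤ := by
  classical
  rw [run]
  simp only [startNow]
  split_ifs with h1
  · exact Or.inl rfl
  · exact Or.inr h

lemma run_start_lt (h : (run L r N x n).2 j ≠ ⊤) : (run L r N x n).2 j < (run L r N x n).1 := by
  induction n with
  | zero => exact absurd rfl h
  | succ n ih =>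
    by_cases h1 : (run L r N x n).2 j = ⊤
    · rcases run_succ_of_eq_top h1 with h2 | h2
      · rw [h2] at h ⊢
        exact run_lt_run_succ h
      · exact absurd h2 h
    · rw [run_succ_of_ne_top h1]
      exact (ih h1).trans_le run_le_run_succ

/-- Event times increase, so a chunk that is not started before event `n` cannot receive an earlier
start afterwards. -/
lemma le_run_start (h : (run L r N x n).2 j = ⊤) (m : ℕ) :
    (run L r N x n).1 ≤ (run L r N x m).2 j := by
  induction m with
  | zero => exact le_top
  | succ m ih =>
    by_cases h1 : (run L r N x m).2 j = ⊤
    · rcases run_succ_of_eq_top h1 with h2 | h2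
      · rcases le_or_gt n m with h3 | h3
        · rw [h2]
          exact run_mono h3
        · by_cases h4 : (run L r N x (m + 1)).2 j = ⊤
          · rw [h4]
            exact le_top
          · rw [run_of_ne_top h4 (show m + 1 ≤ n by omega)] at h
            exact absurd h h4
      · rw [h2]
        exact le_top
    · rw [run_succ_of_ne_top h1]
      exact ih

lemma sedptStart_eq (h : (run L r N x n).2 j ≠ ⊤) : sedptStart L r N x j = (run L r N x n).2 j := by
  refine le_antisymm (iInf_le _ n) (le_iInf fun m => ?_)
  by_cases h1 : (run L r N x m).2 j = ⊤
  · rw [h1]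
    exact le_top
  · rw [← run_of_ne_top h1 (le_max_left m n), ← run_of_ne_top h (le_max_right m n)]

lemma le_sedptStart (h : (run L r N x n).2 j = ⊤) : (run L r N x n).1 ≤ sedptStart L r N x j :=
  le_iInf fun m => le_run_start h m

/-- The chunks started before the event number `n`. -/
lemma run_eq_of_lt (h : sedptStart L r N x j < (run L r N x n).1) :
    (run L r N x n).2 j = sedptStart L r N x j := by
  by_cases h1 : (run L r N x n).2 j = ⊤
  · exact absurd (le_sedptStart h1) (not_le.2 h)
  · exact (sedptStart_eq h1).symm

lemma sedptStart_lt_iff : sedptStart L r N x j < (run L r N x n).1 ↔ (run L r N x n).2 j ≠ ⊤ := by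
  constructor
  · intro h
    rw [run_eq_of_lt h]
    exact ne_top_of_lt h
  · intro h
    rw [sedptStart_eq h]
    exact run_start_lt h

lemma run_finish_eq (h : finish (run L r N x n).2 x j ≠ ⊤) :
    finish (run L r N x n).2 x j = finish (sedptStart L r N x) x j := by
  rw [finish, finish, sedptStart_eq]
  exact (ENNReal.add_ne_top.1 h).1

/-- There are finitely many events. -/
lemma exists_run_eq_top : ∃ n, (run L r N x n).1 = ⊤ := by
  classical
  by_contra! h
  have hmono : StrictMono fun n => (run L r N x n).1 :=
    strictMono_nat_of_lt_succ fun n => run_lt_run_succ (h n)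
  -- Every finite event time is `0`, an arrival or a finish in the final schedule: a finite set,
  -- which cannot contain a strictly increasing sequence.
  set E : Finset ℝ≥0∞ := insert 0 ((Finset.range N).image (fun i => (r.a i : ℝ≥0∞)) ∪
    (chunks r N).image fun j => finish (sedptStart L r N x) x j) with hE
  have hmem : ∀ n, (run L r N x n).1 ∈ E := by
    intro n
    cases n with
    | zero => exact Finset.mem_insert_self _ _
    | succ n =>
      refine Finset.mem_insert_of_mem (Finset.mem_union.2 ?_)
      have h1 := h (n + 1)
      rcases nextEvent_cases h1 with ⟨i, hi, h2⟩ | ⟨j, hj, h2⟩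
      · exact Or.inl (Finset.mem_image.2 ⟨i, Finset.mem_range.2 hi, h2.symm⟩)
      · refine Or.inr (Finset.mem_image.2 ⟨j, hj, ?_⟩)
        rw [← run_finish_eq (n := n + 1) (h2 ▸ h1)]
        exact h2.symm
  exact not_injective_infinite_finite (fun n => (⟨(run L r N x n).1, hmem n⟩ : E))
    fun a b hab => hmono.injective (Subtype.ext_iff.1 hab)

lemma exists_run_le_lt (t : ℝ≥0) : ∃ n, (run L r N x n).1 ≤ t ∧ t < (run L r N x (n + 1)).1 := by
  classical
  have hex : ∃ n, (t : ℝ≥0∞) < (run L r N x n).1 := by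
    obtain ⟨n, hn⟩ := exists_run_eq_top (L := L) (r := r) (N := N) (x := x)
    exact ⟨n, hn ▸ ENNReal.coe_lt_top⟩
  have h1 := Nat.find_spec hex
  have h2 : Nat.find hex ≠ 0 := by
    intro h2
    rw [h2] at h1
    exact not_lt_zero h1
  refine ⟨Nat.find hex - 1, not_lt.1 (Nat.find_min hex (by omega)), ?_⟩
  rwa [Nat.sub_add_cancel (by omega)]

/-- The decision at an event uses only earlier starts, and those are already final at that stage of
the construction. -/
lemma nextServed_run (hr : r.Valid N) (hx : ∀ j, 0 < x j) (ht : (run L r N x n).1 ≠ ⊤) :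
    nextServed L r N (run L r N x n).2 x (run L r N x n).1 =
      nextServed L r N (sedptStart L r N x) x (run L r N x n).1 := by
  classical
  have hD : doneBy r N (run L r N x n).2 x (run L r N x n).1 =
      doneBy r N (sedptStart L r N x) x (run L r N x n).1 := by
    refine doneBy_congr hr fun l _ hl => ?_
    suffices (run L r N x n).2 l = sedptStart L r N x l by rw [finish, finish, this]
    rcases hl with hl | hl
    · refine (sedptStart_eq fun h1 => ?_).symm
      rw [finish, h1, top_add, top_le_iff] at hl
      exact ht hl
    · refine run_eq_of_lt ((lt_finish hx fun h1 => ?_).trans_le hl)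
      rw [finish, h1, top_add, top_le_iff] at hl
      exact ht hl
  have hV : servedPre r N (run L r N x n).2 x (run L r N x n).1 =
      servedPre r N (sedptStart L r N x) x (run L r N x n).1 := by
    ext l
    rw [mem_servedPre_iff hr, mem_servedPre_iff hr, hD, startedBefore, startedBefore,
      Finset.mem_filter, Finset.mem_filter, sedptStart_lt_iff]
    refine and_congr_left fun _ => and_congr_right fun _ => ⟨fun h => ne_top_of_lt h, run_start_lt⟩
  rw [nextServed, nextServed, hD, hV]

lemma sedptStart_le_run_iff (hr : r.Valid N) (hx : ∀ j, 0 < x j) (ht : (run L r N x n).1 ≠ ⊤) :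
    sedptStart L r N x j ≤ (run L r N x n).1 ↔ sedptStart L r N x j < (run L r N x n).1 ∨
      j ∈ nextServed L r N (sedptStart L r N x) x (run L r N x n).1 := by
  classical
  rw [← nextServed_run hr hx ht, sedptStart_lt_iff]
  by_cases h1 : (run L r N x n).2 j = ⊤
  · have h2 : (run L r N x (n + 1)).2 j = if (run L r N x n).2 j = ⊤ ∧
        j ∈ nextServed L r N (run L r N x n).2 x (run L r N x n).1 then (run L r N x n).1
        else (run L r N x n).2 j := by
      rfl
    by_cases h3 : j ∈ nextServed L r N (run L r N x n).2 x (run L r N x n).1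
    · rw [if_pos ⟨h1, h3⟩] at h2
      have h4 : sedptStart L r N x j = (run L r N x n).1 := by
        rw [← h2]
        exact sedptStart_eq (by rwa [h2])
      exact iff_of_true h4.le (Or.inr h3)
    · rw [if_neg (fun h => h3 h.2), h1] at h2
      have h4 := le_sedptStart h2
      refine iff_of_false (fun h5 => ?_) (by tauto)
      exact absurd (h4.trans h5) (not_le.2 (run_lt_run_succ ht))
  · exact iff_of_true (sedptStart_lt_iff.2 h1).le (Or.inl h1)

lemma sedptStart_le_of_lt
    (h : sedptStart L r N x j < (run L r N x (n + 1)).1) :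
    sedptStart L r N x j ≤ (run L r N x n).1 := by
  have h1 := sedptStart_lt_iff.1 h
  by_cases h2 : (run L r N x n).2 j = ⊤
  · rcases run_succ_of_eq_top h2 with h3 | h3
    · rw [sedptStart_eq h1, h3]
    · exact absurd h3 h1
  · exact (sedptStart_lt_iff.2 h2).le

/-- Between two events nothing changes. -/
lemma nextServed_of_between (hr : r.Valid N) (hx : ∀ j, 0 < x j) {t : ℝ≥0}
    (h1 : (run L r N x n).1 < t) (h2 : t < (run L r N x (n + 1)).1) :
    nextServed L r N (sedptStart L r N x) x t =
      nextServed L r N (sedptStart L r N x) x (run L r N x n).1 := by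
  classical
  have ht : (run L r N x n).1 ≠ ⊤ := ne_top_of_lt h1
  set τ := (run L r N x n).1 with hτ
  have hR : arrivedBy r N (t : ℝ≥0∞).toReal = arrivedBy r N τ.toReal := by
    refine Finset.filter_congr fun i hi => ?_
    have e1 : ∀ u : ℝ≥0∞, u ≠ ⊤ → ((r.a i : ℝ) ≤ u.toReal ↔ (r.a i : ℝ≥0∞) ≤ u) := fun u hu => by
      rw [← ENNReal.toReal_le_toReal ENNReal.coe_ne_top hu, ENNReal.coe_toReal]
    rw [e1 _ ENNReal.coe_ne_top, e1 _ ht]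
    refine ⟨fun h3 => ?_, fun h3 => h3.trans h1.le⟩
    by_contra! h4
    exact absurd ((nextEvent_le_arrival (Finset.mem_range.1 hi) h4).trans h3) (not_le.2 h2)
  have hfin : ∀ l ∈ chunks r N, ¬ (τ < finish (sedptStart L r N x) x l ∧
      finish (sedptStart L r N x) x l ≤ t) := by
    rintro l hl ⟨h3, h4⟩
    have h5 : sedptStart L r N x l < (run L r N x (n + 1)).1 :=
      ((le_finish l).trans h4).trans_lt h2
    have h6 : finish (sedptStart L r N x) x l = finish (run L r N x (n + 1)).2 x l := by
      rw [finish, finish, run_eq_of_lt h5]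
    rw [h6] at h3 h4
    exact absurd ((nextEvent_le_finish hl h3).trans h4) (not_le.2 h2)
  have hD : doneBy r N (sedptStart L r N x) x t = doneBy r N (sedptStart L r N x) x τ := by
    unfold doneBy
    refine Finset.filter_congr fun l hl => and_congr_left fun _ => ⟨fun h3 => ?_, fun h3 =>
      h3.trans h1.le⟩
    by_contra! h4
    exact hfin l hl ⟨h4, h3⟩
  have hV : servedPre r N (sedptStart L r N x) x t = servedAt r N (sedptStart L r N x) x τ := by
    ext l
    rw [mem_servedPre_iff hr, mem_servedAt_iff hr, hD, startedBefore, Finset.mem_filter]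
    refine and_congr_left fun _ => and_congr_right fun _ =>
      ⟨fun h3 => sedptStart_le_of_lt (h3.trans h2), fun h3 => h3.trans_lt h1⟩
  have hτ' : ((τ.toNNReal : ℝ≥0) : ℝ≥0∞) = τ := ENNReal.coe_toNNReal ht
  have hat : servedAt r N (sedptStart L r N x) x τ = nextServed L r N (sedptStart L r N x) x τ := by
    rw [← hτ']
    refine servedAt_eq_nextServed hr fun l => ?_
    rw [hτ']
    exact sedptStart_le_run_iff hr hx ht
  -- At `t` the procedure is applied to its own output at the last event, and it is idempotent.
  rw [nextServed, hR, hD, hV, hat, nextServed, assignAll_assignAll]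

lemma follows_sedptStart (hr : r.Valid N) (hx : ∀ j, 0 < x j) :
    Follows L r N x (sedptStart L r N x) := by
  intro t j
  obtain ⟨n, h1, h2⟩ := exists_run_le_lt (L := L) (r := r) (N := N) (x := x) t
  have ht : (run L r N x n).1 ≠ ⊤ := ne_top_of_le_ne_top ENNReal.coe_ne_top h1
  rcases h1.eq_or_lt with h3 | h3
  · rw [← h3]
    exact sedptStart_le_run_iff hr hx ht
  · rw [nextServed_of_between hr hx h3 h2]
    constructor
    · exact fun h4 => Or.inl ((sedptStart_le_of_lt (h4.trans_lt h2)).trans_lt h3)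
    · rintro (h4 | h4)
      · exact h4.le
      · exact ((sedptStart_le_run_iff hr hx ht).2 (Or.inr h4)).trans h3.le

end Run

/-! ### Measurability -/

lemma measurableSet_nextServed {α : Type*} [MeasurableSpace α] {L N : ℕ} {r : Requests}
    {s : α → Chunk → ℝ≥0∞} {x : α → Chunk → ℝ} {t : α → ℝ≥0∞}
    (hs : ∀ j, Measurable fun a => s a j) (hx : ∀ j, Measurable fun a => x a j)
    (ht : Measurable t) (j : Chunk) :
    MeasurableSet {a | j ∈ nextServed L r N (s a) (x a) (t a)} := by
  refine measurableSet_setOfPred.2 (measurable_comp_discrete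
    (f := fun a => (arrivedBy r N (t a).toReal, doneBy r N (s a) (x a) (t a),
      servedPre r N (s a) (x a) (t a)))
    (G := fun b _ => j ∈ assignAll L r b.1 b.2.1 b.2.2) ?_ fun b => measurable_const)
  rintro ⟨R, D, V⟩
  simp only [Prod.mk.injEq]
  exact (ht.ennreal_toReal (measurableSet_arrivedBy_eq R)).inter
    ((measurableSet_doneBy_eq hs hx ht D).inter (measurableSet_servedPre_eq hs hx ht V))

lemma measurable_run (L : ℕ) (r : Requests) (N n : ℕ) :
    (Measurable fun x : Chunk → ℝ => (run L r N x n).1) ∧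
      ∀ j, Measurable fun x : Chunk → ℝ => (run L r N x n).2 j := by
  classical
  induction n with
  | zero => exact ⟨measurable_const, fun _ => measurable_const⟩
  | succ n ih =>
    have h1 : ∀ j, Measurable fun x : Chunk → ℝ => (run L r N x (n + 1)).2 j := fun j =>
      Measurable.ite (((ih.2 j) (measurableSet_singleton ⊤)).inter
        (measurableSet_nextServed ih.2 measurable_pi_apply ih.1 j)) ih.1 (ih.2 j)
    refine ⟨?_, h1⟩
    simp only [run, nextEvent, Finset.inf_eq_iInf]
    refine Measurable.inf (Measurable.iInf fun i => Measurable.iInf fun _ => ?_)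
      (Measurable.iInf fun j => Measurable.iInf fun _ => ?_)
    · exact Measurable.ite (measurableSet_lt ih.1 measurable_const) measurable_const
        measurable_const
    · have h2 := measurable_finish h1 measurable_pi_apply j
      exact Measurable.ite (measurableSet_lt ih.1 h2) h2 measurable_const

/-- SEDPT-R is an online policy. -/
noncomputable def sedptR (L : ℕ) : OnlinePolicy L where
  start _ r N x := sedptStart L r N x
  measurable r N _ j := (Measurable.iInf fun n => (measurable_run L r N n).2 j).comp measurable_snd
  feasible _ _ _ _ hr hx := (follows_sedptStart hr hx).feasible hr
  nonanticipating _ _ _ _ _ _ _ _ hr hr' hx hx' h :=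
    (follows_sedptStart hr hx).start_le_iff hr hr' (follows_sedptStart hr' hx') h

lemma isSEDPTR_sedptR (L : ℕ) : (sedptR L).IsSEDPTR :=
  fun _ _ _ _ hr hx => (follows_sedptStart hr hx).isGreedy hr

end MDSQueue

theorem theorem4 {Ω : Type*} [MeasurableSpace Ω] (P : Measure Ω) [IsProbabilityMeasure P]
    (L : ℕ) (hL : 1 ≤ L) (μ : ℝ) (hμ : 0 < μ)
    (X : MDSQueue.Chunk → Ω → ℝ) (hX_meas : ∀ j, Measurable (X j))
    (hX_law : ∀ j, P.map (X j) = expMeasure μ) (hX_indep : iIndepFun X P)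
    (N : ℕ∞) (hN : 1 ≤ N) (r : MDSQueue.Requests) (hr : r.Valid N) :
    (∃ π : MDSQueue.OnlinePolicy L, π.IsSEDPTR) ∧
    ∀ π : MDSQueue.OnlinePolicy L, π.IsSEDPTR →
      MDSQueue.optFlowTime L P X r N ≤ MDSQueue.avgFlowTime π P X r N ∧
      MDSQueue.avgFlowTime π P X r N ≤ MDSQueue.optFlowTime L P X r N +
        ENNReal.ofReal (1 / μ + 1 / μ * ∑ l ∈ Finset.Ico (r.dMin N) L, 1 / (l : ℝ)) := by
  refine ⟨⟨_, MDSQueue.isSEDPTR_sedptR L⟩, fun π hπ => ⟨iInf_le _ π, ?_⟩⟩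
  have h := MDSQueue.avgFlowTime_le hL hμ hX_meas hX_law hX_indep hN hr hπ
  rwa [MDSQueue.bound, mul_add, mul_one] at h
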